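/- \textbf{Setting.} Let $r\ge 2$ and let $E\subseteq\{0,\dots,r-1\}^2$ be the edge set of a directed graph that is irreducible (every state reaches every state) and aperiodic (for each state the possible return times have greatest common divisor $1$). For each state $i$ fix one edge $(i,\mathrm{ref}(i))\in E$. A parameter vector $\mathbf p\in\mathbb R^{d}$, $d=|E|-r$, assigns a number $p(i,l)$ to each of the other edges; it is \emph{admissible} if all $p(i,l)>0$ and, for each $i$, $\sum_{l\ne \mathrm{ref}(i)}p(i,l)<1$. It defines a transition matrix by $p(i,\mathrm{ref}(i))=1-\sum_{l\neq \mathrm{ref}(i)}p(i,l)$ and $p(i,l)=0$ for $(i,l)\notin E$. \emph{Data.} There are users $u=1,2,\dots$ with parameter vectors $\mathbf p_u$ drawn independently from a probability density $f$ on $\mathbb R^d$ such that, for some set $\mathcal R$ of admissible vectors and some $\delta_1,\delta_2>0$, $\delta_1\le f\le\delta_2$ on $\mathcal R$ and $f=0$ outside $\mathcal R$. Given $(\mathbf p_w)_w$, the data $X_u(1),X_u(2),\dots$ of each user $u$ form a stationary Markov chain with the transition matrix given by $\mathbf p_u$. The data of different users may be dependent, and the dependence is described by a fixed association graph $G$ on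 the set of users: for users $u\neq u'$ and almost every $(\mathbf p_w)_w$, conditionally on $(\mathbf p_w)_w$, the mutual information $I(X_u(k);X_{u'}(k))$ is positive for all $k$ if $u,u'$ are adjacent, and is $0$ for all $k$ otherwise; if $u,u'$ are adjacent, then, conditionally on $(\mathbf p_w)_w$, the process $(X_u(k),X_{u'}(k))_k$ is stationary and ergodic. The groups are the connected components $C$ of $G$, and the families $(\mathbf p_u,X_u)_{u\in C}$ of the different groups are independent. The group of user $1$ is finite, of size $s\ge1$. \emph{Mechanism.} Let $c,c',\alpha>0$ and $\beta>\alpha/4$. For $n$ users let $m=m(n)$ be an integer with $\bigl|m-c\,n^{\frac{2}{s(|E|-r)}+\alpha}\bigr|\le 1$ (any rounding), and let $a_n=c'n^{-\left(\frac1{s(|E|-r)}+\beta\right)}$. For every $n\ge1$ with $a_n\le1$: the noise levels $R_1,\dots,R_n$ are independent, uniform on $[0,a_n]$ and independent of all parameters and data; given these, the obfuscated data $Z_u(k)$, $u\le n$, $k\le m$, are independent, with $Z_u(k)=X_u(k)$ with probability $1-R_u$ and $Z_u(k)=l$ with probability $R_u/(r-1)$ for each $l\ne X_u(k)$; $\Pi$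 is a uniformly random permutation of $\{1,\dots,n\}$ independent of all the rest, and the adversary observes $\mathbf Y=(\mathbf Y_1,\dots,\mathbf Y_n)$ with $\mathbf Y_v=(Z_{\Pi^{-1}(v)}(k))_{k\le m}$. An estimator is a measurable function of $(\mathbf p_1,\dots,\mathbf p_n)$ and $\mathbf Y$ with values in $\{0,\dots,r-1\}$. \textbf{Theorem.} In this setting user $1$ has no privacy: for every $k\in\mathbb N$, $$\inf_{\widetilde X}\ P\bigl(\widetilde X\neq X_1(k)\bigr)\longrightarrow 0\qquad(n\to\infty),$$ where the infimum is over all estimators. Moreover, there are estimators $\widetilde{X}^{(n)}_k$ with $P\bigl(\widetilde X^{(n)}_k\neq X_1(k)\bigr)\to0$ for every $k$, that depend only on $E$, the choice of reference edges, $G$, $s$, $c,c',\alpha,\beta$, the sequence $m(n)$, $n$ and $k$, and neither on $f$ nor on the joint law of the data. -/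

import Mathlib

open MeasureTheory ProbabilityTheory Filter
open scoped ENNReal Topology

noncomputable section

namespace CorrelatedPrivacy

/-! ### The transition graph of the Markov chains -/

section TransitionGraph

variable {r : ℕ}

/-- The adjacency matrix of the directed transition graph with edge set `E`; the `(i, l)` entry of
its `k`-th power is the number of walks of length `k` from `i` to `l`. -/
def adjacency (E : Finset (Fin r × Fin r)) : Matrix (Fin r) (Fin r) ℕ :=
  Matrix.of fun i l => if (i, l) ∈ E then 1 else 0

/-- Every state can be reached from every state. -/
def IsIrreducible (E : Finset (Fin r × Fin r)) : Prop :=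
  ∀ i l, ∃ k, 0 < (adjacency E ^ k) i l

/-- Every state has period `1`: the possible return times have no common divisor other than `1`. -/
def IsAperiodic (E : Finset (Fin r × Fin r)) : Prop :=
  ∀ i, ∀ D : ℕ, (∀ k, 1 ≤ k → 0 < (adjacency E ^ k) i i → D ∣ k) → D = 1

/-- The edges whose probabilities are the free parameters of a chain.  For each state `i` the
probability of one outgoing edge `(i, ref i)` is determined by the others, which leaves
`|E| - r` free parameters. -/
abbrev FreeEdge (E : Finset (Fin r × Fin r)) (ref : Fin r → Fin r) : Type :=
  {e : Fin r × Fin r // e ∈ E ∧ e.2 ≠ ref e.1}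

/-- A parameter vector `𝐩 ∈ ℝ^(|E| - r)`. -/
abbrev Param (E : Finset (Fin r × Fin r)) (ref : Fin r → Fin r) : Type :=
  FreeEdge E ref → ℝ

/-- The transition matrix given by a parameter vector. -/
def transition (E : Finset (Fin r × Fin r)) (ref : Fin r → Fin r) (x : Param E ref)
    (i l : Fin r) : ℝ :=
  if h : (i, l) ∈ E then
    if h' : l = ref i then 1 - ∑ e : FreeEdge E ref with e.1.1 = i, x e
    else x ⟨(i, l), h, h'⟩
  else 0

/-- The parameter vectors for which all edges of the graph have positive probability. -/
def admissible (E : Finset (Fin r × Fin r)) (ref : Fin r → Fin r) : Set (Param E ref) :=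
  {x | (∀ e, 0 < x e) ∧ ∀ i : Fin r, ∑ e : FreeEdge E ref with e.1.1 = i, x e < 1}

/-- `ν` is the law of a stationary Markov chain `y 0, y 1, …` with transition matrix `Q`. -/
structure IsStationaryMarkov (Q : Fin r → Fin r → ℝ) (ν : Measure (ℕ → Fin r)) : Prop where
  stationary : MeasurePreserving (fun (y : ℕ → Fin r) k => y (k + 1)) ν ν
  markov : ∀ (k : ℕ) (x : ℕ → Fin r),
    ν {y | ∀ j ≤ k + 1, y j = x j} = ν {y | ∀ j ≤ k, y j = x j} * ENNReal.ofReal (Q (x k) (x (k + 1)))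

end TransitionGraph

/-! ### The users' data -/

section Data

variable {r : ℕ} [NeZero r] {E : Finset (Fin r × Fin r)} {ref : Fin r → Fin r}
  {Ω : Type*} [MeasurableSpace Ω]

/-- The mutual information of the two coordinates under a joint law `ν`. -/
def mutualInfo {α β : Type*} [MeasurableSpace α] [MeasurableSpace β] (ν : Measure (α × β)) :
    ℝ≥0∞ :=
  InformationTheory.klDiv ν (ν.fst.prod ν.snd)

/-- The regular conditional law of the trace of user `u`, given all the parameter vectors. -/
def traceLaw (μ : Measure Ω) [IsFiniteMeasure μ] (P : ℕ → Ω → Param E ref)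
    (X : ℕ → Ω → ℕ → Fin r) (u : ℕ) : Kernel (ℕ → Param E ref) (ℕ → Fin r) :=
  condDistrib (X u) (fun ω w => P w ω) μ

/-- The regular conditional law of the joint trace of users `u` and `v`, given all the parameter
vectors. -/
def pairLaw (μ : Measure Ω) [IsFiniteMeasure μ] (P : ℕ → Ω → Param E ref)
    (X : ℕ → Ω → ℕ → Fin r) (u v : ℕ) : Kernel (ℕ → Param E ref) (ℕ → Fin r × Fin r) :=
  condDistrib (fun ω k => (X u ω k, X v ω k)) (fun ω w => P w ω) μ

/-- The Markov chain model: the parameter vectors `P u` of the users `u = 0, 1, 2, …` are drawn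
independently from the density `f`, and, given the parameter vectors, the trace
`X u = (X u · 0, X u · 1, …)` of each user is a stationary Markov chain with the transition matrix
given by `P u`. -/
structure IsMarkovModel (μ : Measure Ω) [IsFiniteMeasure μ] (f : Param E ref → ℝ)
    (P : ℕ → Ω → Param E ref) (X : ℕ → Ω → ℕ → Fin r) : Prop where
  measurable_param : ∀ u, Measurable (P u)
  measurable_trace : ∀ u, Measurable (X u)
  indep_param : iIndepFun P μ
  law_param : ∀ u, μ.map (P u) = volume.withDensity fun x => ENNReal.ofReal (f x)
  markov : ∀ u, ∀ᵐ p ∂(μ.map fun ω w => P w ω),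
    IsStationaryMarkov (transition E ref (p u)) (traceLaw μ P X u p)

/-- `G` is the association graph of the users' data.  Given the parameters, two users are joined by
an edge iff their data at each time have positive mutual information, and in this case their
joint data are stationary and ergodic in time; the data of the different groups
(connected components of `G`) are independent. -/
structure IsAssociationGraph (G : SimpleGraph ℕ) (μ : Measure Ω) [IsFiniteMeasure μ]
    (P : ℕ → Ω → Param E ref) (X : ℕ → Ω → ℕ → Fin r) : Prop where
  dependent : ∀ u v, G.Adj u v → ∀ᵐ p ∂(μ.map fun ω w => P w ω),
    ∀ k : ℕ, 0 < mutualInfo ((pairLaw μ P X u v p).map fun y => y k)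
  independent : ∀ u v, u ≠ v → ¬ G.Adj u v → ∀ᵐ p ∂(μ.map fun ω w => P w ω),
    ∀ k : ℕ, mutualInfo ((pairLaw μ P X u v p).map fun y => y k) = 0
  ergodic : ∀ u v, G.Adj u v → ∀ᵐ p ∂(μ.map fun ω w => P w ω),
    Ergodic (fun (y : ℕ → Fin r × Fin r) k => y (k + 1)) (pairLaw μ P X u v p)
  indep_groups : iIndepFun
    (fun (C : G.ConnectedComponent) (ω : Ω) (u : C.supp) => (P u ω, X u ω)) μ

end Data

/-! ### Obfuscation and anonymization for the first `n` users and `m` data points per user -/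

section Mechanism

variable {r : ℕ} [NeZero r] {E : Finset (Fin r × Fin r)} {ref : Fin r → Fin r}
  {Ω : Type*} [MeasurableSpace Ω] {n m : ℕ}

/-- The `r`-ary symmetric channel with error probability `ρ`: the probability that the input `i` is
reported as `l`. -/
def channel (r : ℕ) (ρ : ℝ) (i l : Fin r) : ℝ :=
  if l = i then 1 - ρ else ρ / ((r : ℝ) - 1)

/-- `Z` is the obfuscated version of the data with random noise levels `R`: the `R u` are
independent, uniform on `[0, a]`, and independent of the users' parameters and data; given
parameters, data and noise levels, each data point is passed independently through
the symmetric channel with error probability `R u`. -/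
structure IsObfuscation (μ : Measure Ω) [IsFiniteMeasure μ] (P : ℕ → Ω → Param E ref)
    (X : ℕ → Ω → ℕ → Fin r) (a : ℝ) (R : Fin n → Ω → ℝ)
    (Z : Ω → Fin n → Fin m → Fin r) : Prop where
  measurable_noise : ∀ u, Measurable (R u)
  measurable_obfuscated : Measurable Z
  uniform_noise : ∀ u, pdf.IsUniform (R u) (Set.Icc 0 a) μ
  indep_noise : iIndepFun R μ
  noise_indep_data : IndepFun (fun ω u => R u ω) (fun ω => (fun w => P w ω, fun w => X w ω)) μ
  channel_law :
    ∀ᵐ t ∂(μ.map fun ω => ((fun w => P w ω, fun w => X w ω), fun u => R u ω)),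
      ∀ z : Fin n → Fin m → Fin r,
        condDistrib Z (fun ω => ((fun w => P w ω, fun w => X w ω), fun u => R u ω)) μ t {z} =
          ∏ u : Fin n, ∏ k : Fin m, ENNReal.ofReal (channel r (t.2 u) (t.1.2 u k) (z u k))

/-- All sets of permutations of the finite set of users are measurable. -/
instance permMeasurableSpace : MeasurableSpace (Equiv.Perm (Fin n)) := ⊤

/-- `Pi` is a uniformly random permutation of the users, independent of everything else. -/
structure IsRandomPermutation (μ : Measure Ω) (P : ℕ → Ω → Param E ref)
    (X : ℕ → Ω → ℕ → Fin r) (R : Fin n → Ω → ℝ) (Z : Ω → Fin n → Fin m → Fin r)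
    (Pi : Ω → Equiv.Perm (Fin n)) : Prop where
  measurable_perm : Measurable Pi
  uniform_perm : ∀ σ, μ {ω | Pi ω = σ} = (n.factorial : ℝ≥0∞)⁻¹
  indep_perm : IndepFun Pi
    (fun ω => ((fun w => P w ω, fun w => X w ω), (fun u => R u ω), Z ω)) μ

/-- The anonymized data `Y_v = Z_{Π⁻¹ v}`. -/
def anonymize (Pi : Ω → Equiv.Perm (Fin n)) (Z : Ω → Fin n → Fin m → Fin r) :
    Ω → Fin n → Fin m → Fin r :=
  fun ω v => Z ω ((Pi ω).symm v)

end Mechanism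

/-! ### The adversary -/

section Adversary

variable {r : ℕ} [NeZero r]

/-- An adversary's estimator of a data point: a function of what the adversary sees, the parameter
vectors of the `n` users and the anonymized observations. -/
abbrev Estimator (E : Finset (Fin r × Fin r)) (ref : Fin r → Fin r) (n m : ℕ) : Type :=
  {g : (Fin n → Param E ref) × (Fin n → Fin m → Fin r) → Fin r // Measurable g}

variable {E : Finset (Fin r × Fin r)} {ref : Fin r → Fin r} {Ω : Type*} [MeasurableSpace Ω]

/-- The probability that the estimator `g` errs on the data point of user `u` at time `k`. -/
def errorProb {n m : ℕ} (μ : Measure Ω) (P : ℕ → Ω → Param E ref) (X : ℕ → Ω → ℕ → Fin r)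
    (Y : Ω → Fin n → Fin m → Fin r) (u k : ℕ) (g : Estimator E ref n m) : ℝ≥0∞ :=
  μ {ω | g.1 (fun w => P w ω, Y ω) ≠ X u ω k}

/-- User `u` has no privacy: for every time `k`, the infimum over all estimators of the error
probability tends to `0` as the number `n` of users tends to infinity. -/
def NoPrivacy {m : ℕ → ℕ} (μ : Measure Ω) (P : ℕ → Ω → Param E ref) (X : ℕ → Ω → ℕ → Fin r)
    (Y : ∀ n, Ω → Fin n → Fin (m n) → Fin r) (u : ℕ) : Prop :=
  ∀ k : ℕ, Tendsto (fun n => ⨅ g : Estimator E ref n (m n), errorProb μ P X (Y n) u k g)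
    atTop (𝓝 0)

end Adversary

end CorrelatedPrivacy

end

noncomputable section

namespace CorrelatedPrivacy

/-! ### Weak law of large numbers for ergodic maps -/

section Ergodic

variable {α : Type*} [MeasurableSpace α] {ν : Measure α} {T : α → α}

lemma lp_eq_const_of_koopman_eq (hT : Ergodic T ν) (h : Lp ℝ 2 ν)
    (hh : Lp.compMeasurePreservingₗᵢ ℝ T hT.toMeasurePreserving h = h) :
    ∃ c : ℝ, (h : α → ℝ) =ᵐ[ν] fun _ => c := by
  have h1 : (h : α → ℝ) ∘ T =ᵐ[ν] h := by
    have := Lp.coeFn_compMeasurePreserving h hT.toMeasurePreserving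
    have h2 : Lp.compMeasurePreserving T hT.toMeasurePreserving h = h := hh
    rw [h2] at this
    exact this.symm
  exact hT.ae_eq_const_of_ae_eq_comp_ae (Lp.aestronglyMeasurable h) h1

/-- The weak law of large numbers for an ergodic map, a consequence of the mean ergodic theorem. -/
lemma tendsto_measure_average_sub [IsProbabilityMeasure ν] (hT : Ergodic T ν) {A : Set α} (hA : MeasurableSet A)
    {δ : ℝ} (hδ : 0 < δ) :
    Tendsto (fun n : ℕ => ν {x | δ ≤ |(n : ℝ)⁻¹ * ∑ k ∈ Finset.range n,
      A.indicator (fun _ => (1 : ℝ)) (T^[k] x) - ν.real A|}) atTop (𝓝 0) := by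
  set g : Lp ℝ 2 ν := indicatorConstLp 2 hA (measure_ne_top ν A) (1 : ℝ) with hg
  set U := Lp.compMeasurePreservingₗᵢ (E := ℝ) (p := 2) ℝ T hT.toMeasurePreserving with hU
  have hnorm : ‖U.toContinuousLinearMap‖ ≤ 1 := U.norm_toContinuousLinearMap_le
  have key := U.toContinuousLinearMap.tendsto_birkhoffAverage_orthogonalProjection hnorm g
  set K := U.toContinuousLinearMap.eqLocus (1 : Lp ℝ 2 ν →L[ℝ] Lp ℝ 2 ν) with hK
  set h : Lp ℝ 2 ν := (K.orthogonalProjectionOnto g : Lp ℝ 2 ν) with hh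
  have hUh : U h = h := (K.orthogonalProjectionOnto g).2
  obtain ⟨c, hc⟩ := lp_eq_const_of_koopman_eq hT h hUh
  set one : Lp ℝ 2 ν := indicatorConstLp 2 MeasurableSet.univ (measure_ne_top ν _) (1 : ℝ)
    with hone
  have hone_mem : one ∈ K := by
    change U one = one
    rw [hU, hone]
    change Lp.compMeasurePreserving T hT.toMeasurePreserving _ = _
    rw [Lp.indicatorConstLp_compMeasurePreserving]
    rfl
  have hcA : c = ν.real A := by
    have h1 : inner ℝ one (g - h) = 0 := by
      have := K.sub_starProjection_mem_orthogonal g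
      exact (Submodule.mem_orthogonal _ _).1 this one hone_mem
    have h2 : inner ℝ one g = ν.real A := by
      rw [hone, hg, L2.real_inner_indicatorConstLp_one_indicatorConstLp_one]
      simp
    have h3 : inner ℝ one h = c := by
      rw [hone, L2.inner_indicatorConstLp_one]
      simp [integral_congr_ae hc]
    rw [inner_sub_right, h2, h3] at h1
    linarith
  have hae : ∀ n : ℕ, (birkhoffAverage ℝ U.toContinuousLinearMap _root_.id n g : Lp ℝ 2 ν)
      =ᵐ[ν] fun x => (n : ℝ)⁻¹ * ∑ k ∈ Finset.range n,
        A.indicator (fun _ => (1 : ℝ)) (T^[k] x) := by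
    intro n
    have hk : ∀ k : ℕ, ((U.toContinuousLinearMap^[k] g : Lp ℝ 2 ν) : α → ℝ) =ᵐ[ν]
        fun x => A.indicator (fun _ => (1 : ℝ)) (T^[k] x) := by
      intro k
      have e1 : U.toContinuousLinearMap^[k] g =
          Lp.compMeasurePreserving (T^[k]) (hT.toMeasurePreserving.iterate k) g := by
        rw [← Lp.compMeasurePreserving_iterate]
        rfl
      rw [e1]
      refine (Lp.coeFn_compMeasurePreserving g (hT.toMeasurePreserving.iterate k)).trans ?_
      exact (hT.toMeasurePreserving.iterate k).quasiMeasurePreserving.ae_eq_comp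
        indicatorConstLp_coeFn
    rw [birkhoffAverage, birkhoffSum]
    refine (Lp.coeFn_smul _ _).trans ?_
    have hs : ((∑ k ∈ Finset.range n, _root_.id (U.toContinuousLinearMap^[k] g) : Lp ℝ 2 ν) : α → ℝ)
        =ᵐ[ν] fun x => ∑ k ∈ Finset.range n, A.indicator (fun _ => (1 : ℝ)) (T^[k] x) := by
      refine (Lp.coeFn_finsetSum _ _).trans ?_
      have := (ae_all_iff (μ := ν)).2 hk
      filter_upwards [this] with x hx
      rw [Finset.sum_apply]
      exact Finset.sum_congr rfl fun k _ => hx k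
    filter_upwards [hs] with x hx
    rw [Pi.smul_apply, hx, smul_eq_mul]
  have hm := tendstoInMeasure_of_tendsto_Lp key
  have hm' := (hm.congr (fun n => hae n) (hc.trans (ae_of_all _ fun _ => hcA)))
  simpa [Real.norm_eq_abs] using tendstoInMeasure_iff_norm.1 hm' δ hδ

end Ergodic

/-! ### Primitivity of the transition graph -/

section Graph

variable {r : ℕ} {E : Finset (Fin r × Fin r)} {ref : Fin r → Fin r}

lemma matrix_mul_apply_pos {A B : Matrix (Fin r) (Fin r) ℕ} {i j l : Fin r}
    (h1 : 0 < A i j) (h2 : 0 < B j l) : 0 < (A * B) i l := by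
  rw [Matrix.mul_apply]
  exact (Nat.mul_pos h1 h2).trans_le
    (Finset.single_le_sum (f := fun j => A i j * B j l) (fun _ _ => Nat.zero_le _)
      (Finset.mem_univ j))

lemma adjacency_pow_add_pos {a b : ℕ} {i j l : Fin r} (h1 : 0 < (adjacency E ^ a) i j)
    (h2 : 0 < (adjacency E ^ b) j l) : 0 < (adjacency E ^ (a + b)) i l := by
  rw [pow_add]
  exact matrix_mul_apply_pos h1 h2

/-- An irreducible aperiodic graph is primitive. -/
lemma exists_adjacency_pow_pos [NeZero r] (hirr : IsIrreducible E) (haper : IsAperiodic E) :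
    ∃ N : ℕ, ∀ i l, 0 < (adjacency E ^ N) i l := by
  choose k hk using hirr
  set S : Set ℕ := {t | 0 < (adjacency E ^ t) 0 0} with hS
  have hgcd : Nat.setGcd S = 1 := haper 0 _ fun t _ ht => Nat.setGcd_dvd_of_mem ht
  obtain ⟨n₀, hn₀⟩ := Nat.exists_mem_closure_of_ge S
  have hret : ∀ t ≥ n₀, 0 < (adjacency E ^ t) 0 0 := by
    intro t ht
    have hmem := hn₀ t ht (by rw [hgcd]; exact one_dvd t)
    clear ht
    induction hmem using AddSubmonoid.closure_induction with
    | mem x hx => exact hx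
    | zero => simp
    | add x y _ _ hx hy => exact adjacency_pow_add_pos hx hy
  set b : ℕ := (Finset.univ.sup fun i => k i 0) + (Finset.univ.sup fun l => k 0 l) with hb
  refine ⟨b + n₀, fun i l => ?_⟩
  have h1 : k i 0 ≤ Finset.univ.sup fun i => k i 0 :=
    Finset.le_sup (f := fun i => k i 0) (Finset.mem_univ i)
  have h2 : k 0 l ≤ Finset.univ.sup fun l => k 0 l :=
    Finset.le_sup (f := fun l => k 0 l) (Finset.mem_univ l)
  have h3 : b + n₀ = k i 0 + (b + n₀ - k i 0 - k 0 l) + k 0 l := by omega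
  rw [h3]
  exact adjacency_pow_add_pos (adjacency_pow_add_pos (hk i 0) (hret _ (by omega))) (hk 0 l)

lemma eq_iterate_ref_of_adjacency_pow_pos [IsEmpty (FreeEdge E ref)] (k : ℕ) :
    ∀ {i l : Fin r}, 0 < (adjacency E ^ k) i l → l = ref^[k] i := by
  induction k with
  | zero =>
    intro i l h
    by_contra hne
    have hne' : i ≠ l := fun h' => hne h'.symm
    simp [hne'] at h
  | succ k ih =>
    intro i l h
    rw [pow_succ, Matrix.mul_apply] at h
    obtain ⟨j, -, hj⟩ := Finset.exists_ne_zero_of_sum_ne_zero h.ne'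
    have hj1 := ih (Nat.pos_of_ne_zero (left_ne_zero_of_mul hj))
    have hj2 : (j, l) ∈ E := by
      by_contra hne
      exact right_ne_zero_of_mul hj (by simp [adjacency, hne])
    rw [Function.iterate_succ_apply', ← hj1]
    by_contra hne
    exact IsEmpty.false (⟨(j, l), hj2, hne⟩ : FreeEdge E ref)

lemma nonempty_freeEdge [NeZero r] (hr : 2 ≤ r) (hirr : IsIrreducible E) (haper : IsAperiodic E) :
    Nonempty (FreeEdge E ref) := by
  by_contra hne
  rw [not_nonempty_iff] at hne
  obtain ⟨N, hN⟩ := exists_adjacency_pow_pos hirr haper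
  have h1 := eq_iterate_ref_of_adjacency_pow_pos (ref := ref) N (hN 0 ⟨0, by omega⟩)
  have h2 := eq_iterate_ref_of_adjacency_pow_pos (ref := ref) N (hN 0 ⟨1, by omega⟩)
  have := h1.trans h2.symm
  simp at this

lemma card_freeEdge (href : ∀ i, (i, ref i) ∈ E) :
    Fintype.card (FreeEdge E ref) + r = E.card := by
  rw [Fintype.card_subtype]
  have h1 : (Finset.univ.filter fun e : Fin r × Fin r => e ∈ E ∧ e.2 ≠ ref e.1)
      = E.filter fun e => ¬ e.2 = ref e.1 := by
    ext e; simp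
  have h2 : (E.filter fun e => e.2 = ref e.1) = Finset.univ.image fun i => (i, ref i) := by
    ext ⟨i, l⟩
    simp only [Finset.mem_filter, Finset.mem_image, Finset.mem_univ, true_and, Prod.mk.injEq]
    constructor
    · rintro ⟨-, rfl⟩; exact ⟨i, rfl, rfl⟩
    · rintro ⟨j, rfl, rfl⟩; exact ⟨href j, rfl⟩
  have h3 : (E.filter fun e => e.2 = ref e.1).card = r := by
    rw [h2, Finset.card_image_of_injective _ (fun a b h => (Prod.mk.inj h).1)]
    simp
  rw [h1]
  have := Finset.card_filter_add_card_filter_not (s := E) (fun e => e.2 = ref e.1)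
  omega

end Graph

/-! ### The transition matrix -/

section Transition

variable {r : ℕ} {E : Finset (Fin r × Fin r)} {ref : Fin r → Fin r}

lemma measurable_transition (i l : Fin r) :
    Measurable fun p : Param E ref => transition E ref p i l := by
  unfold transition
  split_ifs
  · fun_prop
  · fun_prop
  · fun_prop

lemma transition_freeEdge (p : Param E ref) (e : FreeEdge E ref) :
    transition E ref p e.1.1 e.1.2 = p e := by
  have h1 : (e.1.1, e.1.2) ∈ E := e.2.1
  rw [transition, dif_pos h1, dif_neg e.2.2]

lemma transition_pos {p : Param E ref} (hp : p ∈ admissible E ref) {i l : Fin r}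
    (h : (i, l) ∈ E) : 0 < transition E ref p i l := by
  rw [transition, dif_pos h]
  split_ifs with h'
  · have := hp.2 i; linarith
  · exact hp.1 _

lemma transition_nonneg {p : Param E ref} (hp : p ∈ admissible E ref) (i l : Fin r) :
    0 ≤ transition E ref p i l := by
  by_cases h : (i, l) ∈ E
  · exact (transition_pos hp h).le
  · rw [transition, dif_neg h]

lemma sum_transition (href : ∀ i, (i, ref i) ∈ E) (p : Param E ref) (i : Fin r) :
    ∑ l, transition E ref p i l = 1 := by
  rw [← Finset.add_sum_erase _ _ (Finset.mem_univ (ref i))]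
  have h1 : transition E ref p i (ref i) = 1 - ∑ e : FreeEdge E ref with e.1.1 = i, p e := by
    rw [transition, dif_pos (href i), dif_pos rfl]
  have h2 : ∑ l ∈ Finset.univ.erase (ref i), transition E ref p i l
      = ∑ e : FreeEdge E ref with e.1.1 = i, p e := by
    symm
    refine Finset.sum_bij_ne_zero (fun e _ _ => e.1.2) ?_ ?_ ?_ ?_
    · intro e he _
      simp only [Finset.mem_filter, Finset.mem_univ, true_and] at he
      simpa [← he] using e.2.2
    · intro e he _ e' he' _ h
      simp only [Finset.mem_filter, Finset.mem_univ, true_and] at he he'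
      exact Subtype.ext (Prod.ext (he.trans he'.symm) h)
    · intro l hl hne
      have hl' : l ≠ ref i := by simpa using hl
      have hE : (i, l) ∈ E := by
        by_contra hE
        exact hne (by rw [transition, dif_neg hE])
      refine ⟨⟨(i, l), hE, hl'⟩, by simp, ?_, rfl⟩
      rwa [← transition_freeEdge p]
    · intro e he _
      simp only [Finset.mem_filter, Finset.mem_univ, true_and] at he
      rw [← he, transition_freeEdge]
  rw [h1, h2]
  ring

lemma transition_le_one (href : ∀ i, (i, ref i) ∈ E) {p : Param E ref}
    (hp : p ∈ admissible E ref) (i l : Fin r) : transition E ref p i l ≤ 1 := by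
  rw [← sum_transition href p i]
  exact Finset.single_le_sum (f := fun l => transition E ref p i l)
    (fun l _ => transition_nonneg hp i l) (Finset.mem_univ l)

/-- The transition matrix as a matrix. -/
def transMatrix (E : Finset (Fin r × Fin r)) (ref : Fin r → Fin r) (p : Param E ref) :
    Matrix (Fin r) (Fin r) ℝ :=
  Matrix.of (transition E ref p)

lemma transMatrix_pow_succ_apply (p : Param E ref) (k : ℕ) (i l : Fin r) :
    (transMatrix E ref p ^ (k + 1)) i l
      = ∑ j, transition E ref p i j * (transMatrix E ref p ^ k) j l := by
  rw [pow_succ', Matrix.mul_apply]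
  rfl

lemma measurable_transMatrix_pow (k : ℕ) (i l : Fin r) :
    Measurable fun p : Param E ref => (transMatrix E ref p ^ k) i l := by
  induction k generalizing i with
  | zero => simp
  | succ k ih =>
    simp_rw [transMatrix_pow_succ_apply]
    exact Finset.measurable_sum _ fun j _ => (measurable_transition i j).mul (ih j)

lemma transMatrix_pow_nonneg {p : Param E ref} (hp : p ∈ admissible E ref) (k : ℕ)
    (i l : Fin r) : 0 ≤ (transMatrix E ref p ^ k) i l := by
  induction k generalizing i with
  | zero => rw [pow_zero, Matrix.one_apply]; split_ifs <;> norm_num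
  | succ k ih =>
    rw [transMatrix_pow_succ_apply]
    exact Finset.sum_nonneg fun j _ => mul_nonneg (transition_nonneg hp i j) (ih j)

lemma sum_transMatrix_pow (href : ∀ i, (i, ref i) ∈ E) (p : Param E ref) (k : ℕ) (i : Fin r) :
    ∑ l, (transMatrix E ref p ^ k) i l = 1 := by
  induction k generalizing i with
  | zero => simp [Matrix.one_apply]
  | succ k ih =>
    simp_rw [transMatrix_pow_succ_apply]
    rw [Finset.sum_comm]
    simp_rw [← Finset.mul_sum, ih, mul_one]
    exact sum_transition href p i

lemma transMatrix_pow_le_one (href : ∀ i, (i, ref i) ∈ E) {p : Param E ref}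
    (hp : p ∈ admissible E ref) (k : ℕ) (i l : Fin r) : (transMatrix E ref p ^ k) i l ≤ 1 := by
  rw [← sum_transMatrix_pow href p k i]
  exact Finset.single_le_sum (f := fun l => (transMatrix E ref p ^ k) i l)
    (fun l _ => transMatrix_pow_nonneg hp k i l) (Finset.mem_univ l)

lemma transMatrix_pow_pos {p : Param E ref} (hp : p ∈ admissible E ref) (k : ℕ) {i l : Fin r}
    (h : 0 < (adjacency E ^ k) i l) : 0 < (transMatrix E ref p ^ k) i l := by
  induction k generalizing i with
  | zero =>
    by_cases hil : i = l
    · simp [hil]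
    · simp [hil] at h
  | succ k ih =>
    rw [pow_succ', Matrix.mul_apply] at h
    obtain ⟨j, -, hj⟩ := Finset.exists_ne_zero_of_sum_ne_zero h.ne'
    have hE : (i, j) ∈ E := by
      by_contra hne
      exact left_ne_zero_of_mul hj (by simp [adjacency, hne])
    rw [transMatrix_pow_succ_apply]
    refine (mul_pos (transition_pos hp hE)
      (ih (Nat.pos_of_ne_zero (right_ne_zero_of_mul hj)))).trans_le ?_
    exact Finset.single_le_sum
      (f := fun j => transition E ref p i j * (transMatrix E ref p ^ k) j l)
      (fun j _ => mul_nonneg (transition_nonneg hp i j) (transMatrix_pow_nonneg hp k j l))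
      (Finset.mem_univ j)

/-- A stochastic matrix with entries at least `κ` contracts the oscillation by `1 - κ`. -/
lemma mulVec_sub_le_of_le [NeZero r] {M : Matrix (Fin r) (Fin r) ℝ} {κ ρ : ℝ} (hκ : 0 ≤ κ)
    (hM : ∀ i l, κ ≤ M i l) (hsum : ∀ i, ∑ l, M i l = 1) {f : Fin r → ℝ}
    (hf : ∀ a b, f a - f b ≤ ρ) (a b : Fin r) :
    M.mulVec f a - M.mulVec f b ≤ (1 - κ) * ρ := by
  obtain ⟨b₀, hb₀⟩ := Finite.exists_min f
  have hρ : 0 ≤ ρ := by simpa using hf 0 0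
  have hlow : f b₀ ≤ M.mulVec f b := by
    have : ∑ l, M b l * f b₀ ≤ ∑ l, M b l * f l :=
      Finset.sum_le_sum fun l _ => mul_le_mul_of_nonneg_left (hb₀ l) (hκ.trans (hM b l))
    rwa [← Finset.sum_mul, hsum, one_mul] at this
  have hup : M.mulVec f a ≤ f b₀ + ρ - κ * ρ := by
    have h1 : ∑ l, M a l * f l ≤ ∑ l, (M a l * (f b₀ + ρ) - if l = b₀ then κ * ρ else 0) := by
      refine Finset.sum_le_sum fun l _ => ?_
      split_ifs with h
      · subst h
        nlinarith [hM a l]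
      · rw [sub_zero]
        exact mul_le_mul_of_nonneg_left (by linarith [hf l b₀]) (hκ.trans (hM a l))
    rw [Finset.sum_sub_distrib, ← Finset.sum_mul, hsum, one_mul] at h1
    rw [Finset.sum_ite_eq' Finset.univ b₀ fun _ => κ * ρ, if_pos (Finset.mem_univ b₀)] at h1
    exact h1
  linarith

/-- Uniform geometric mixing and positivity of the powers of an admissible transition matrix. -/
lemma exists_mixing [NeZero r] (hirr : IsIrreducible E) (haper : IsAperiodic E)
    (href : ∀ i, (i, ref i) ∈ E) {p : Param E ref} (hp : p ∈ admissible E ref) :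
    ∃ (κ : ℝ) (N : ℕ), 0 < κ ∧ κ ≤ 1 ∧ 0 < N ∧
      (∀ L ≥ N, ∀ a x, κ ≤ (transMatrix E ref p ^ L) a x) ∧
      ∀ L a b x, (transMatrix E ref p ^ L) a x - (transMatrix E ref p ^ L) b x
        ≤ (1 - κ) ^ (L / N) := by
  obtain ⟨N, hN⟩ := exists_adjacency_pow_pos hirr haper
  set Q := transMatrix E ref p with hQ
  obtain ⟨⟨i₀, l₀⟩, hmin⟩ := Finite.exists_min fun q : Fin r × Fin r => (Q ^ N) q.1 q.2
  set κ := (Q ^ N) i₀ l₀ with hκ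
  have hκpos : 0 < κ := transMatrix_pow_pos hp N (hN i₀ l₀)
  have hκ1 : κ ≤ 1 := transMatrix_pow_le_one href hp N i₀ l₀
  have hlow : ∀ L ≥ N, ∀ a x, κ ≤ (Q ^ L) a x := by
    intro L hL
    induction L, hL using Nat.le_induction with
    | base => exact fun a x => hmin (a, x)
    | succ L _ ih =>
      intro a x
      rw [hQ, transMatrix_pow_succ_apply]
      calc κ = ∑ j, transition E ref p a j * κ := by
            rw [← Finset.sum_mul, sum_transition href, one_mul]
        _ ≤ _ := Finset.sum_le_sum fun j _ =>
            mul_le_mul_of_nonneg_left (ih j x) (transition_nonneg hp a j)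
  have hN' : ∀ i l, κ ≤ (Q ^ (N + 1)) i l := hlow (N + 1) (Nat.le_succ N)
  have hsum : ∀ i, ∑ l, (Q ^ (N + 1)) i l = 1 := sum_transMatrix_pow href p (N + 1)
  refine ⟨κ, N + 1, hκpos, hκ1, Nat.succ_pos N, fun L hL => hlow L (by omega), ?_⟩
  have hstep : ∀ (j t : ℕ) (a b x : Fin r),
      (Q ^ ((N + 1) * j + t)) a x - (Q ^ ((N + 1) * j + t)) b x ≤ (1 - κ) ^ j := by
    intro j
    induction j with
    | zero =>
      intro t a b x
      rw [mul_zero, zero_add, pow_zero]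
      have h1 := transMatrix_pow_le_one href hp t a x
      have h2 := transMatrix_pow_nonneg hp t b x
      rw [← hQ] at h1 h2
      linarith
    | succ j ih =>
      intro t a b x
      have e : ∀ c, (Q ^ ((N + 1) * (j + 1) + t)) c x
          = (Q ^ (N + 1)).mulVec (fun d => (Q ^ ((N + 1) * j + t)) d x) c := by
        intro c
        rw [show (N + 1) * (j + 1) + t = (N + 1) + ((N + 1) * j + t) by ring, pow_add,
          Matrix.mul_apply]
        rfl
      rw [e, e, pow_succ' (1 - κ)]
      exact mulVec_sub_le_of_le hκpos.le hN' hsum (fun a b => ih t a b x) a b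
  intro L a b x
  have := hstep (L / (N + 1)) (L % (N + 1)) a b x
  rwa [Nat.div_add_mod] at this

end Transition

/-! ### Concentration of transition counts -/

section Concentration

variable {r : ℕ}

lemma measurableSet_path_eq (k : ℕ) (x : Fin r) : MeasurableSet {y : ℕ → Fin r | y k = x} :=
  measurableSet_eq_fun (measurable_pi_apply k) measurable_const

/-- The centred, weighted count of the transitions from `x` to `x'` before time `m`, where `q`
stands for the transition probability. -/
def transitionSum (b : ℕ → ℝ) (q : ℝ) (y : ℕ → Fin r) (m : ℕ) (x x' : Fin r) : ℝ :=
  ∑ k ∈ Finset.range m,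
    b k * (if y k = x then (if y (k + 1) = x' then (1 : ℝ) else 0) - q else 0)

lemma transitionSum_congr {b b' : ℕ → ℝ} {q : ℝ} {y y' : ℕ → Fin r} {m : ℕ} {x x' : Fin r}
    (hb : ∀ k < m, b k = b' k) (h : ∀ j ≤ m, y j = y' j) :
    transitionSum b q y m x x' = transitionSum b' q y' m x x' := by
  refine Finset.sum_congr rfl fun k hk => ?_
  have hk' := Finset.mem_range.1 hk
  rw [hb k hk', h k hk'.le, h (k + 1) hk']

/-- One step of the Markov property, for functions of the path up to time `k`. -/
lemma IsStationaryMarkov.lintegral_step {Q : Fin r → Fin r → ℝ} {ν : Measure (ℕ → Fin r)}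
    (hν : IsStationaryMarkov Q ν) (k : ℕ) (g : (ℕ → Fin r) → ℝ≥0∞)
    (hg : ∀ y y' : ℕ → Fin r, (∀ j ≤ k, y j = y' j) → g y = g y')
    (h : Fin r → Fin r → ℝ≥0∞) :
    ∫⁻ y, g y * h (y k) (y (k + 1)) ∂ν
      = ∫⁻ y, g y * ∑ l, ENNReal.ofReal (Q (y k) l) * h (y k) l ∂ν := by
  set e : (Fin (k + 1) → Fin r) → ℕ → Fin r := fun a j => a ⟨min j k, by omega⟩ with he
  set C : (Fin (k + 1) → Fin r) → Set (ℕ → Fin r) := fun a => {y | ∀ j ≤ k, y j = e a j} with hC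
  have hCm : ∀ a, MeasurableSet (C a) := by
    intro a
    have : C a = ⋂ j : ℕ, ⋂ _ : j ≤ k, (fun y : ℕ → Fin r => y j) ⁻¹' {e a j} := by
      ext y; simp [hC]
    rw [this]
    exact MeasurableSet.iInter fun j => MeasurableSet.iInter fun _ =>
      measurable_pi_apply j (measurableSet_singleton _)
  have hDm : ∀ a l, MeasurableSet (C a ∩ {y | y (k + 1) = l}) := fun a l =>
    (hCm a).inter (measurableSet_path_eq (k + 1) l)
  have hmem : ∀ (y : ℕ → Fin r) (a : Fin (k + 1) → Fin r), y ∈ C a ↔ a = fun i : Fin (k + 1) => y i := by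
    intro y a
    constructor
    · intro hy
      funext i
      have := hy i (by omega)
      rw [this]
      simp only [he]
      congr 1
      ext
      simp only
      omega
    · rintro rfl j hj
      simp [he, min_eq_left hj]
  have hL : ∀ y : ℕ → Fin r, g y * h (y k) (y (k + 1)) = ∑ a, ∑ l,
      (C a ∩ {y | y (k + 1) = l}).indicator (fun _ => g (e a) * h (e a k) l) y := by
    intro y
    rw [Finset.sum_eq_single (fun i : Fin (k + 1) => y i), Finset.sum_eq_single (y (k + 1))]
    · have h1 : y ∈ C fun i : Fin (k + 1) => y i := (hmem _ _).2 rfl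
      have h2 : y ∈ (C fun i : Fin (k + 1) => y i) ∩ {y' | y' (k + 1) = y (k + 1)} := ⟨h1, rfl⟩
      rw [Set.indicator_of_mem h2, ← hg y _ h1, ← h1 k le_rfl]
    · intro l _ hl
      rw [Set.indicator_of_notMem]
      exact fun hy => hl hy.2.symm
    · intro h; exact absurd (Finset.mem_univ _) h
    · intro a _ ha
      refine Finset.sum_eq_zero fun l _ => ?_
      rw [Set.indicator_of_notMem]
      exact fun hy => ha ((hmem _ _).1 hy.1)
    · intro h; exact absurd (Finset.mem_univ _) h
  have hR : ∀ y : ℕ → Fin r, g y * ∑ l, ENNReal.ofReal (Q (y k) l) * h (y k) l = ∑ a,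
      (C a).indicator (fun _ => g (e a) * ∑ l, ENNReal.ofReal (Q (e a k) l) * h (e a k) l) y := by
    intro y
    rw [Finset.sum_eq_single (fun i : Fin (k + 1) => y i)]
    · have h1 : y ∈ C fun i : Fin (k + 1) => y i := (hmem _ _).2 rfl
      rw [Set.indicator_of_mem h1, ← hg y _ h1, ← h1 k le_rfl]
    · intro a _ ha
      rw [Set.indicator_of_notMem]
      exact fun hy => ha ((hmem _ _).1 hy)
    · intro h; exact absurd (Finset.mem_univ _) h
  have hν' : ∀ a l, ν (C a ∩ {y | y (k + 1) = l})
      = ν (C a) * ENNReal.ofReal (Q (e a k) l) := by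
    intro a l
    have h1 := hν.markov k (Function.update (e a) (k + 1) l)
    have hne : ∀ j ≤ k, Function.update (e a) (k + 1) l j = e a j := fun j hj =>
      Function.update_of_ne (by omega) _ _
    have e1 : {y : ℕ → Fin r | ∀ j ≤ k + 1, y j = Function.update (e a) (k + 1) l j}
        = C a ∩ {y | y (k + 1) = l} := by
      ext y
      simp only [Set.mem_ofPred_eq, Set.mem_inter_iff, hC]
      constructor
      · intro hy
        refine ⟨fun j hj => by rw [hy j (by omega), hne j hj], ?_⟩
        rw [hy (k + 1) le_rfl, Function.update_self]
      · rintro ⟨hy, hl⟩ j hj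
        rcases Nat.lt_or_ge k j with hjk | hjk
        · obtain rfl : j = k + 1 := by omega
          rw [hl, Function.update_self]
        · rw [hy j hjk, hne j hjk]
    have e2 : {y : ℕ → Fin r | ∀ j ≤ k, y j = Function.update (e a) (k + 1) l j} = C a := by
      ext y
      simp only [Set.mem_ofPred_eq, hC]
      exact forall₂_congr fun j hj => by rw [hne j hj]
    rw [e1, e2, hne k le_rfl, Function.update_self] at h1
    exact h1
  rw [lintegral_congr hL, lintegral_congr hR, lintegral_finsetSum _ fun a _ => Finset.measurable_sum _ fun l _ =>
      measurable_const.indicator (hDm a l),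
    lintegral_finsetSum _ fun a _ => measurable_const.indicator (hCm a)]
  refine Finset.sum_congr rfl fun a _ => ?_
  rw [lintegral_finsetSum _ fun l _ => measurable_const.indicator (hDm a l),
    lintegral_indicator_const (hCm a), Finset.mul_sum, Finset.sum_mul]
  refine Finset.sum_congr rfl fun l _ => ?_
  rw [lintegral_indicator_const (hDm a l), hν']
  ring

/-- The exponential moment of one centred step of a Markov chain. -/
lemma sum_mul_exp_le {Q : Fin r → Fin r → ℝ} (h0 : ∀ i l, 0 ≤ Q i l)
    (h1 : ∀ i, ∑ l, Q i l = 1) (x x' a : Fin r) {t lam : ℝ} (ht : |t| ≤ lam) (hlam : lam ≤ 1) :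
    ∑ l, Q a l * Real.exp (t * (if a = x then (if l = x' then (1 : ℝ) else 0) - Q x x' else 0))
      ≤ Real.exp (lam ^ 2) := by
  have hlam0 : 0 ≤ lam := (abs_nonneg t).trans ht
  by_cases hax : a = x
  · subst hax
    have hq1 : Q a x' ≤ 1 := by
      rw [← h1 a]
      exact Finset.single_le_sum (f := fun l => Q a l) (fun l _ => h0 a l) (Finset.mem_univ x')
    have hD : ∀ l, |(if l = x' then (1 : ℝ) else 0) - Q a x'| ≤ 1 := by
      intro l
      have := h0 a x'
      split_ifs <;> rw [abs_le] <;> constructor <;> linarith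
    have hexp : ∀ l, Real.exp (t * ((if l = x' then (1 : ℝ) else 0) - Q a x'))
        ≤ 1 + t * ((if l = x' then (1 : ℝ) else 0) - Q a x') + lam ^ 2 := by
      intro l
      set u := t * ((if l = x' then (1 : ℝ) else 0) - Q a x') with hu
      have hul : |u| ≤ lam := by
        rw [hu, abs_mul]
        calc |t| * _ ≤ lam * 1 := mul_le_mul ht (hD l) (abs_nonneg _) hlam0
          _ = lam := mul_one _
      have h2 := Real.abs_exp_sub_one_sub_id_le (hul.trans hlam)
      have h3 : u ^ 2 ≤ lam ^ 2 := by
        rw [← sq_abs]; exact pow_le_pow_left₀ (abs_nonneg _) hul 2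
      have := (abs_le.1 h2).2
      linarith
    simp only [if_true]
    calc _ ≤ ∑ l, Q a l * (1 + t * ((if l = x' then (1 : ℝ) else 0) - Q a x') + lam ^ 2) :=
          Finset.sum_le_sum fun l _ => mul_le_mul_of_nonneg_left (hexp l) (h0 a l)
      _ = (1 - t * Q a x' + lam ^ 2) * ∑ l, Q a l
          + t * ∑ l, (if l = x' then Q a l else 0) := by
          rw [Finset.mul_sum, Finset.mul_sum, ← Finset.sum_add_distrib]
          refine Finset.sum_congr rfl fun l _ => ?_
          split_ifs <;> ring
      _ = lam ^ 2 + 1 := by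
          rw [h1, Finset.sum_ite_eq' Finset.univ x' fun l => Q a l, if_pos (Finset.mem_univ _)]
          ring
      _ ≤ _ := Real.add_one_le_exp _
  · simp only [if_neg hax, mul_zero, Real.exp_zero, mul_one, h1]
    exact Real.one_le_exp (sq_nonneg _)

lemma measurable_transitionSum (b : ℕ → ℝ) (q : ℝ) (m : ℕ) (x x' : Fin r) :
    Measurable fun y : ℕ → Fin r => transitionSum b q y m x x' := by
  unfold transitionSum
  refine Finset.measurable_sum _ fun k _ => measurable_const.mul ?_
  refine Measurable.ite (measurableSet_path_eq k x) ?_ measurable_const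
  refine Measurable.sub_const ?_ q
  exact Measurable.ite (measurableSet_path_eq (k + 1) x')
    measurable_const measurable_const

lemma IsStationaryMarkov.lintegral_exp_le {Q : Fin r → Fin r → ℝ} {ν : Measure (ℕ → Fin r)}
    [IsProbabilityMeasure ν] (hν : IsStationaryMarkov Q ν) (h0 : ∀ i l, 0 ≤ Q i l)
    (h1 : ∀ i, ∑ l, Q i l = 1) (x x' : Fin r) {b : ℕ → ℝ} {lam : ℝ} (hb : ∀ k, |b k| ≤ lam)
    (hlam : lam ≤ 1) (m : ℕ) :
    ∫⁻ y, ENNReal.ofReal (Real.exp (transitionSum b (Q x x') y m x x')) ∂ν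
      ≤ ENNReal.ofReal (Real.exp (m * lam ^ 2)) := by
  induction m with
  | zero => simp [transitionSum]
  | succ m ih =>
    have e1 : ∀ y : ℕ → Fin r,
        ENNReal.ofReal (Real.exp (transitionSum b (Q x x') y (m + 1) x x'))
        = ENNReal.ofReal (Real.exp (transitionSum b (Q x x') y m x x')) *
          (fun a l => ENNReal.ofReal (Real.exp (b m *
            (if a = x then (if l = x' then (1 : ℝ) else 0) - Q x x' else 0)))) (y m) (y (m + 1)) := by
      intro y
      rw [← ENNReal.ofReal_mul (Real.exp_nonneg _), ← Real.exp_add, transitionSum,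
        Finset.sum_range_succ]
      rfl
    rw [lintegral_congr e1, hν.lintegral_step m
      (fun y => ENNReal.ofReal (Real.exp (transitionSum b (Q x x') y m x x')))
      (h := fun a l => ENNReal.ofReal (Real.exp (b m *
        (if a = x then (if l = x' then (1 : ℝ) else 0) - Q x x' else 0))))
      (hg := fun y y' h => by rw [transitionSum_congr (fun _ _ => rfl) h])]
    have e2 : ∀ a : Fin r, ∑ l, ENNReal.ofReal (Q a l) * ENNReal.ofReal (Real.exp (b m *
            (if a = x then (if l = x' then (1 : ℝ) else 0) - Q x x' else 0)))
        ≤ ENNReal.ofReal (Real.exp (lam ^ 2)) := by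
      intro a
      simp_rw [← ENNReal.ofReal_mul (h0 a _)]
      rw [← ENNReal.ofReal_sum_of_nonneg
        fun l _ => mul_nonneg (h0 a l) (Real.exp_nonneg _)]
      exact ENNReal.ofReal_le_ofReal (sum_mul_exp_le h0 h1 x x' a (hb m) hlam)
    calc _ ≤ ∫⁻ y, ENNReal.ofReal (Real.exp (transitionSum b (Q x x') y m x x'))
            * ENNReal.ofReal (Real.exp (lam ^ 2)) ∂ν :=
          lintegral_mono fun y => mul_le_mul_right (e2 (y m)) _
      _ = (∫⁻ y, ENNReal.ofReal (Real.exp (transitionSum b (Q x x') y m x x')) ∂ν)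
            * ENNReal.ofReal (Real.exp (lam ^ 2)) :=
          lintegral_mul_const _
            (Real.measurable_exp.comp (measurable_transitionSum b _ m x x')).ennreal_ofReal
      _ ≤ ENNReal.ofReal (Real.exp (m * lam ^ 2)) * ENNReal.ofReal (Real.exp (lam ^ 2)) :=
          mul_le_mul_left ih _
      _ = _ := by
          rw [← ENNReal.ofReal_mul (Real.exp_nonneg _), ← Real.exp_add]
          push_cast
          ring_nf

lemma IsStationaryMarkov.measure_lt_transitionSum {Q : Fin r → Fin r → ℝ}
    {ν : Measure (ℕ → Fin r)} [IsProbabilityMeasure ν] (hν : IsStationaryMarkov Q ν)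
    (h0 : ∀ i l, 0 ≤ Q i l) (h1 : ∀ i, ∑ l, Q i l = 1) (x x' : Fin r) {b : ℕ → ℝ}
    (hb : ∀ k, |b k| ≤ 1) {ε : ℝ} (hε : 0 ≤ ε) (hε1 : ε ≤ 1) (m : ℕ) :
    ν {y | ε * m < transitionSum b (Q x x') y m x x'}
      ≤ ENNReal.ofReal (Real.exp (-(ε ^ 2 * m / 4))) := by
  have hmg := hν.lintegral_exp_le h0 h1 x x' (b := fun k => ε / 2 * b k) (lam := ε / 2)
    (fun k => by
      rw [abs_mul, abs_of_nonneg (by linarith)]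
      nlinarith [hb k]) (by linarith) m
  have hs : ∀ y : ℕ → Fin r, transitionSum (fun k => ε / 2 * b k) (Q x x') y m x x'
      = ε / 2 * transitionSum b (Q x x') y m x x' := by
    intro y
    simp only [transitionSum, Finset.mul_sum, mul_assoc]
  set c : ℝ≥0∞ := ENNReal.ofReal (Real.exp (ε / 2 * (ε * m))) with hc
  have hc0 : c ≠ 0 := by simp [hc, Real.exp_pos]
  have hc1 : c ≠ ⊤ := ENNReal.ofReal_ne_top
  have hsub : {y : ℕ → Fin r | ε * m < transitionSum b (Q x x') y m x x'} ⊆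
      {y | c ≤ ENNReal.ofReal
        (Real.exp (transitionSum (fun k => ε / 2 * b k) (Q x x') y m x x'))} := by
    intro y hy
    refine ENNReal.ofReal_le_ofReal (Real.exp_le_exp.2 ?_)
    rw [hs]
    exact mul_le_mul_of_nonneg_left (le_of_lt hy) (by linarith)
  calc _ ≤ _ := measure_mono hsub
    _ ≤ (∫⁻ y, ENNReal.ofReal
        (Real.exp (transitionSum (fun k => ε / 2 * b k) (Q x x') y m x x')) ∂ν) / c :=
        meas_ge_le_lintegral_div
          (Real.measurable_exp.comp (measurable_transitionSum _ _ m x x')).ennreal_ofReal.aemeasurable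
          hc0 hc1
    _ ≤ ENNReal.ofReal (Real.exp (m * (ε / 2) ^ 2)) / c := ENNReal.div_le_div_right hmg _
    _ = _ := by
        rw [hc, ← ENNReal.ofReal_div_of_pos (Real.exp_pos _), ← Real.exp_sub]
        ring_nf

lemma IsStationaryMarkov.measure_lt_abs_transitionSum {Q : Fin r → Fin r → ℝ}
    {ν : Measure (ℕ → Fin r)} [IsProbabilityMeasure ν] (hν : IsStationaryMarkov Q ν)
    (h0 : ∀ i l, 0 ≤ Q i l) (h1 : ∀ i, ∑ l, Q i l = 1) (x x' : Fin r) {b : ℕ → ℝ}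
    (hb : ∀ k, |b k| ≤ 1) {ε : ℝ} (hε : 0 ≤ ε) (hε1 : ε ≤ 1) (m : ℕ) :
    ν {y | ε * m < |transitionSum b (Q x x') y m x x'|}
      ≤ 2 * ENNReal.ofReal (Real.exp (-(ε ^ 2 * m / 4))) := by
  have hneg : ∀ y : ℕ → Fin r, transitionSum (fun k => - b k) (Q x x') y m x x'
      = - transitionSum b (Q x x') y m x x' := by
    intro y
    simp only [transitionSum, ← Finset.sum_neg_distrib, neg_mul]
  have hsub : {y : ℕ → Fin r | ε * m < |transitionSum b (Q x x') y m x x'|} ⊆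
      {y | ε * m < transitionSum b (Q x x') y m x x'} ∪
      {y | ε * m < transitionSum (fun k => - b k) (Q x x') y m x x'} := by
    intro y hy
    rcases lt_abs.1 (Set.mem_ofPred_eq ▸ hy) with h | h
    · exact Or.inl h
    · refine Or.inr ?_
      rw [Set.mem_ofPred_eq, hneg]
      exact h
  refine (measure_mono hsub).trans ((measure_union_le _ _).trans ?_)
  rw [two_mul]
  exact add_le_add (hν.measure_lt_transitionSum h0 h1 x x' hb hε hε1 m)
    (hν.measure_lt_transitionSum h0 h1 x x' (fun k => by rw [abs_neg]; exact hb k) hε hε1 m)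

end Concentration

/-! ### Empirical frequencies -/

section Frequencies

variable {r : ℕ}

/-- The number of visits to `x` before time `m`. -/
def freq (y : ℕ → Fin r) (m : ℕ) (x : Fin r) : ℝ :=
  ∑ k ∈ Finset.range m, if y k = x then (1 : ℝ) else 0

/-- The number of joint visits to `x` and `z` before time `m`. -/
def jointFreq (y y' : ℕ → Fin r) (m : ℕ) (x z : Fin r) : ℝ :=
  ∑ k ∈ Finset.range m, if y k = x ∧ y' k = z then (1 : ℝ) else 0

/-- The number of times before `m` at which two paths differ. -/
def hammingCount (y y' : ℕ → Fin r) (m : ℕ) : ℝ :=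
  ∑ k ∈ Finset.range m, if y k = y' k then (0 : ℝ) else 1

/-- The empirical covariance of visits to `x` and `z`, multiplied by `m ^ 2`. -/
def empCov (y y' : ℕ → Fin r) (m : ℕ) (x z : Fin r) : ℝ :=
  m * jointFreq y y' m x z - freq y m x * freq y' m z

/-- The weights that select the transitions inside the observation window. -/
def window (m k : ℕ) : ℝ := if k + 1 < m then 1 else 0

lemma abs_window_le (m k : ℕ) : |window m k| ≤ 1 := by
  unfold window; split_ifs <;> simp

lemma freq_nonneg (y : ℕ → Fin r) (m : ℕ) (x : Fin r) : 0 ≤ freq y m x :=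
  Finset.sum_nonneg fun k _ => by split_ifs <;> norm_num

lemma freq_le (y : ℕ → Fin r) (m : ℕ) (x : Fin r) : freq y m x ≤ m := by
  calc freq y m x ≤ ∑ _k ∈ Finset.range m, (1 : ℝ) :=
        Finset.sum_le_sum fun k _ => by split_ifs <;> norm_num
    _ = m := by simp

lemma abs_freq_sub_le (y y' : ℕ → Fin r) (m : ℕ) (x : Fin r) :
    |freq y m x - freq y' m x| ≤ hammingCount y y' m := by
  unfold freq hammingCount
  rw [← Finset.sum_sub_distrib]
  refine (Finset.abs_sum_le_sum_abs _ _).trans (Finset.sum_le_sum fun k _ => ?_)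
  by_cases h : y k = y' k
  · simp [h]
  · rw [if_neg h]
    split_ifs <;> norm_num

lemma abs_jointFreq_sub_le (y y' w w' : ℕ → Fin r) (m : ℕ) (x z : Fin r) :
    |jointFreq y w m x z - jointFreq y' w' m x z| ≤ hammingCount y y' m + hammingCount w w' m := by
  unfold jointFreq hammingCount
  rw [← Finset.sum_sub_distrib, ← Finset.sum_add_distrib]
  refine (Finset.abs_sum_le_sum_abs _ _).trans (Finset.sum_le_sum fun k _ => ?_)
  by_cases h : y k = y' k
  · by_cases h' : w k = w' k
    · simp [h, h']
    · rw [if_neg h', if_pos h]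
      split_ifs <;> norm_num
  · rw [if_neg h]
    split_ifs <;> norm_num

lemma abs_empCov_sub_le {y y' w w' : ℕ → Fin r} {m : ℕ} {ε : ℝ}
    (h : hammingCount y y' m ≤ ε * m) (h' : hammingCount w w' m ≤ ε * m) (x z : Fin r) :
    |empCov y w m x z - empCov y' w' m x z| ≤ 4 * ε * m ^ 2 := by
  have h1 := (abs_jointFreq_sub_le y y' w w' m x z).trans (add_le_add h h')
  have h2 := (abs_freq_sub_le y y' m x).trans h
  have h3 := (abs_freq_sub_le w w' m z).trans h'
  have hm : (0 : ℝ) ≤ m := Nat.cast_nonneg m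
  have e : empCov y w m x z - empCov y' w' m x z
      = m * (jointFreq y w m x z - jointFreq y' w' m x z)
        - ((freq y m x - freq y' m x) * freq w m z
          + freq y' m x * (freq w m z - freq w' m z)) := by
    unfold empCov; ring
  rw [e]
  refine (abs_sub _ _).trans ?_
  have a1 : |(m : ℝ) * (jointFreq y w m x z - jointFreq y' w' m x z)| ≤ m * (ε * m + ε * m) := by
    rw [abs_mul, abs_of_nonneg hm]
    exact mul_le_mul_of_nonneg_left h1 hm
  have a2 : |(freq y m x - freq y' m x) * freq w m z| ≤ ε * m * m := by
    rw [abs_mul, abs_of_nonneg (freq_nonneg w m z)]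
    exact mul_le_mul h2 (freq_le w m z) (freq_nonneg _ _ _) ((abs_nonneg _).trans h2)
  have a3 : |freq y' m x * (freq w m z - freq w' m z)| ≤ m * (ε * m) := by
    rw [abs_mul, abs_of_nonneg (freq_nonneg y' m x)]
    exact mul_le_mul (freq_le y' m x) h3 (abs_nonneg _) hm
  have a4 := abs_add_le ((freq y m x - freq y' m x) * freq w m z)
    (freq y' m x * (freq w m z - freq w' m z))
  nlinarith

lemma sum_shift_le {g : ℕ → ℝ} (hg : ∀ k, 0 ≤ g k) (m : ℕ) :
    ∑ k ∈ Finset.range m, (if k + 1 < m then g (k + 1) else 0) ≤ ∑ k ∈ Finset.range m, g k := by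
  rcases m with _ | m
  · simp
  · rw [Finset.sum_range_succ, if_neg (lt_irrefl _), add_zero, Finset.sum_range_succ' g m]
    have : ∑ k ∈ Finset.range m, (if k + 1 < m + 1 then g (k + 1) else 0)
        ≤ ∑ k ∈ Finset.range m, g (k + 1) :=
      Finset.sum_le_sum fun k _ => by split_ifs; exacts [le_rfl, hg _]
    linarith [hg 0]

lemma abs_transitionSum_sub_le {q : ℝ} (hq0 : 0 ≤ q) (hq1 : q ≤ 1) (y y' : ℕ → Fin r) (m : ℕ)
    (x x' : Fin r) :
    |transitionSum (window m) q y m x x' - transitionSum (window m) q y' m x x'|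
      ≤ 2 * hammingCount y y' m := by
  have hs := sum_shift_le (g := fun k => if y k = y' k then (0 : ℝ) else 1)
    (fun k => by split_ifs <;> norm_num) m
  have : |transitionSum (window m) q y m x x' - transitionSum (window m) q y' m x x'|
      ≤ ∑ k ∈ Finset.range m, ((if y k = y' k then (0 : ℝ) else 1) +
        if k + 1 < m then (if y (k + 1) = y' (k + 1) then (0 : ℝ) else 1) else 0) := by
    unfold transitionSum
    rw [← Finset.sum_sub_distrib]
    refine (Finset.abs_sum_le_sum_abs _ _).trans (Finset.sum_le_sum fun k _ => ?_)
    unfold window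
    by_cases hk : k + 1 < m
    · simp only [if_pos hk, one_mul]
      by_cases h : y k = y' k
      · by_cases h' : y (k + 1) = y' (k + 1)
        · simp [h, h']
        · rw [if_neg h', h]
          split_ifs <;> rw [abs_le] <;> constructor <;> linarith
      · rw [if_neg h]
        split_ifs <;> rw [abs_le] <;> constructor <;> linarith
    · simp only [if_neg hk, zero_mul, sub_self, abs_zero, add_zero]
      split_ifs <;> norm_num
  rw [Finset.sum_add_distrib] at this
  unfold hammingCount
  linarith

lemma transitionSum_sub_transitionSum (b : ℕ → ℝ) (q q' : ℝ) (y : ℕ → Fin r) (m : ℕ)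
    (x x' : Fin r) :
    transitionSum b q y m x x' - transitionSum b q' y m x x'
      = (q' - q) * ∑ k ∈ Finset.range m, b k * if y k = x then (1 : ℝ) else 0 := by
  unfold transitionSum
  rw [← Finset.sum_sub_distrib, Finset.mul_sum]
  refine Finset.sum_congr rfl fun k _ => ?_
  split_ifs <;> ring

lemma freq_sub_one_le_sum_window (y : ℕ → Fin r) (m : ℕ) (x : Fin r) :
    freq y m x - 1 ≤ ∑ k ∈ Finset.range m, window m k * if y k = x then (1 : ℝ) else 0 := by
  rcases m with _ | m
  · simp [freq]
  · rw [freq, Finset.sum_range_succ, Finset.sum_range_succ]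
    have : ∑ k ∈ Finset.range m, window (m + 1) k * (if y k = x then (1 : ℝ) else 0)
        = ∑ k ∈ Finset.range m, if y k = x then (1 : ℝ) else 0 := by
      refine Finset.sum_congr rfl fun k hk => ?_
      rw [window, if_pos (by have := Finset.mem_range.1 hk; omega), one_mul]
    rw [this, window, if_neg (lt_irrefl _), zero_mul, add_zero]
    have h2 : (if y m = x then (1 : ℝ) else 0) ≤ 1 := by split_ifs <;> norm_num
    linarith

/-- A path that fits two transition probabilities determines them up to a small error. -/
lemma abs_sub_le_of_transitionSum {y : ℕ → Fin r} {m : ℕ} {x x' : Fin r} {q q' A B M : ℝ}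
    (hM : 0 < M) (h1 : |transitionSum (window m) q y m x x'| ≤ A)
    (h2 : |transitionSum (window m) q' y m x x'| ≤ B) (h3 : M ≤ freq y m x - 1) :
    |q' - q| ≤ (A + B) / M := by
  have e := transitionSum_sub_transitionSum (window m) q q' y m x x'
  have hN := h3.trans (freq_sub_one_le_sum_window y m x)
  set N := ∑ k ∈ Finset.range m, window m k * if y k = x then (1 : ℝ) else 0 with hNdef
  have h4 : |q' - q| * N ≤ A + B := by
    rw [← abs_of_pos (hM.trans_le hN), ← abs_mul, ← e]
    exact (abs_sub _ _).trans (add_le_add h1 h2)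
  rw [le_div_iff₀ hM]
  exact (mul_le_mul_of_nonneg_left hN (abs_nonneg _)).trans h4

end Frequencies

/-! ### Weighted sums along a mixing chain -/

section Lag

variable {r : ℕ}

/-- The weights `b` shifted by `l + 1` and restricted to times in `[L, m)`. -/
def lagWeight (b : ℕ → ℝ) (L l m k : ℕ) : ℝ :=
  if L ≤ k + l + 1 ∧ k + l + 1 < m then b (k + l + 1) else 0

lemma sum_Ico_eq_lagSum (b F : ℕ → ℝ) {L l : ℕ} (m : ℕ) (hl : l < L) :
    ∑ k ∈ Finset.Ico L m, b k * F (k - (l + 1))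
      = ∑ j ∈ Finset.range m, lagWeight b L l m j * F j := by
  have e : ∑ j ∈ Finset.range m, lagWeight b L l m j * F j
      = ∑ j ∈ (Finset.range m).filter (fun j => L ≤ j + l + 1 ∧ j + l + 1 < m),
        b (j + l + 1) * F j := by
    rw [Finset.sum_filter]
    refine Finset.sum_congr rfl fun j _ => ?_
    unfold lagWeight
    split_ifs <;> simp
  rw [e]
  refine Finset.sum_nbij' (fun k => k - (l + 1)) (fun j => j + l + 1) ?_ ?_ ?_ ?_ ?_
  · intro k hk
    simp only [Finset.mem_Ico, Finset.mem_filter, Finset.mem_range] at hk ⊢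
    omega
  · intro j hj
    simp only [Finset.mem_Ico, Finset.mem_filter, Finset.mem_range] at hj ⊢
    omega
  · intro k hk
    simp only [Finset.mem_Ico] at hk
    omega
  · intro j hj
    omega
  · intro k hk
    simp only [Finset.mem_Ico] at hk
    rw [show k - (l + 1) + l + 1 = k by omega]

lemma step_eq_sum (Q : Matrix (Fin r) (Fin r) ℝ) (f : Fin r → ℝ) (a a' : Fin r) :
    f a' - Q.mulVec f a = ∑ x, ∑ x', f x' *
      (if a = x then (if a' = x' then (1 : ℝ) else 0) - Q x x' else 0) := by
  rw [Finset.sum_eq_single a]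
  · simp only [if_true, mul_sub, Finset.sum_sub_distrib]
    congr 1
    · simp
    · change ∑ l, Q a l * f l = _
      exact Finset.sum_congr rfl fun l _ => mul_comm (Q a l) (f l)
  · intro x _ hx
    exact Finset.sum_eq_zero fun x' _ => by rw [if_neg (Ne.symm hx), mul_zero]
  · intro h; exact absurd (Finset.mem_univ _) h

/-- If all lagged transition sums are small, then the visits to `x₀`, weighted by `b`, are close to
their predictions at lag `L`. -/
lemma abs_sum_sub_lag_le {Q : Matrix (Fin r) (Fin r) ℝ} {x₀ : Fin r} {b : ℕ → ℝ}
    {y : ℕ → Fin r} {m L : ℕ} {A : ℝ}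
    (hQ : ∀ l a, |(Q ^ l) a x₀| ≤ 1)
    (H : ∀ l < L, ∀ x x', |transitionSum (lagWeight b L l m) (Q x x') y m x x'| ≤ A) :
    |∑ k ∈ Finset.Ico L m, b k * ((if y k = x₀ then (1 : ℝ) else 0) - (Q ^ L) (y (k - L)) x₀)|
      ≤ L * (r ^ 2 * A) := by
  have hrec : ∀ l a, (Q ^ (l + 1)) a x₀ = Q.mulVec (fun c => (Q ^ l) c x₀) a := by
    intro l a
    rw [pow_succ', Matrix.mul_apply]
    rfl
  obtain ⟨F, hF⟩ : ∃ F : ℕ → ℕ → ℝ, ∀ l j, F l j = (Q ^ l) (y (j + 1)) x₀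
      - Q.mulVec (fun c => (Q ^ l) c x₀) (y j) := ⟨_, fun _ _ => rfl⟩
  have htel : ∀ k ∈ Finset.Ico L m,
      b k * ((if y k = x₀ then (1 : ℝ) else 0) - (Q ^ L) (y (k - L)) x₀)
      = ∑ l ∈ Finset.range L, b k * F l (k - (l + 1)) := by
    intro k hk
    have hk' := (Finset.mem_Ico.1 hk).1
    rw [← Finset.mul_sum]
    congr 1
    have h := Finset.sum_range_sub' (fun l => (Q ^ l) (y (k - l)) x₀) L
    simp only [pow_zero, Matrix.one_apply, Nat.sub_zero] at h
    rw [← h]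
    refine Finset.sum_congr rfl fun l hl => ?_
    have hl' := Finset.mem_range.1 hl
    rw [hF, hrec, show k - (l + 1) + 1 = k - l by omega]
  rw [Finset.sum_congr rfl htel, Finset.sum_comm]
  refine (Finset.abs_sum_le_sum_abs _ _).trans ?_
  have hbound : ∀ l ∈ Finset.range L, |∑ k ∈ Finset.Ico L m, b k * F l (k - (l + 1))| ≤ r ^ 2 * A := by
    intro l hl
    have hl' := Finset.mem_range.1 hl
    rw [sum_Ico_eq_lagSum b (F l) m hl']
    have e : ∑ j ∈ Finset.range m, lagWeight b L l m j * F l j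
        = ∑ x, ∑ x', (Q ^ l) x' x₀ * transitionSum (lagWeight b L l m) (Q x x') y m x x' := by
      simp_rw [hF, step_eq_sum Q (fun c => (Q ^ l) c x₀), transitionSum, Finset.mul_sum]
      rw [Finset.sum_comm]
      refine Finset.sum_congr rfl fun x _ => ?_
      rw [Finset.sum_comm]
      refine Finset.sum_congr rfl fun x' _ => Finset.sum_congr rfl fun j _ => ?_
      ring
    rw [e]
    calc _ ≤ ∑ x : Fin r, ∑ x' : Fin r,
          |(Q ^ l) x' x₀ * transitionSum (lagWeight b L l m) (Q x x') y m x x'| :=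
          (Finset.abs_sum_le_sum_abs _ _).trans
            (Finset.sum_le_sum fun x _ => Finset.abs_sum_le_sum_abs _ _)
      _ ≤ ∑ _x : Fin r, ∑ _x' : Fin r, A := by
          refine Finset.sum_le_sum fun x _ => Finset.sum_le_sum fun x' _ => ?_
          rw [abs_mul]
          calc _ ≤ 1 * A := mul_le_mul (hQ l x') (H l hl' x x') (abs_nonneg _) zero_le_one
            _ = A := one_mul A
      _ = r ^ 2 * A := by simp [sq, mul_assoc]
  calc _ ≤ ∑ _l ∈ Finset.range L, (r : ℝ) ^ 2 * A := Finset.sum_le_sum hbound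
    _ = _ := by simp

/-- The weighted number of visits to `x₀` is close to `c` times the total weight if the predictions
at lag `L` are all close to `c`. -/
lemma abs_sum_sub_const_le {Q : Matrix (Fin r) (Fin r) ℝ} {x₀ : Fin r} {b : ℕ → ℝ}
    {y : ℕ → Fin r} {m L : ℕ} {A c ρ : ℝ} (hb0 : ∀ k, 0 ≤ b k) (hb1 : ∀ k, b k ≤ 1)
    (hQ : ∀ l a, |(Q ^ l) a x₀| ≤ 1) (hc0 : 0 ≤ c) (hc1 : c ≤ 1)
    (hρ : ∀ a, |(Q ^ L) a x₀ - c| ≤ ρ)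
    (H : ∀ l < L, ∀ x x', |transitionSum (lagWeight b L l m) (Q x x') y m x x'| ≤ A) :
    |∑ k ∈ Finset.range m, b k * (if y k = x₀ then (1 : ℝ) else 0)
        - c * ∑ k ∈ Finset.range m, b k| ≤ L * (r ^ 2 * A) + m * ρ + L := by
  have hρ0 : 0 ≤ ρ := (abs_nonneg _).trans (hρ x₀)
  have e : ∑ k ∈ Finset.range m, b k * (if y k = x₀ then (1 : ℝ) else 0)
        - c * ∑ k ∈ Finset.range m, b k
      = ∑ k ∈ Finset.range m, b k * ((if y k = x₀ then (1 : ℝ) else 0) - c) := by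
    rw [Finset.mul_sum, ← Finset.sum_sub_distrib]
    exact Finset.sum_congr rfl fun k _ => by ring
  have hterm : ∀ k, |b k * ((if y k = x₀ then (1 : ℝ) else 0) - c)| ≤ 1 := by
    intro k
    rw [abs_mul, abs_of_nonneg (hb0 k)]
    have : |(if y k = x₀ then (1 : ℝ) else 0) - c| ≤ 1 := by
      split_ifs <;> rw [abs_le] <;> constructor <;> linarith
    calc _ ≤ 1 * 1 := mul_le_mul (hb1 k) this (abs_nonneg _) zero_le_one
      _ = 1 := one_mul 1
  have hlag := abs_sum_sub_lag_le hQ H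
  have hA : 0 ≤ L * (r ^ 2 * A) := (abs_nonneg _).trans hlag
  rw [e]
  rcases le_or_gt m L with hmL | hmL
  · calc _ ≤ ∑ k ∈ Finset.range m, |b k * ((if y k = x₀ then (1 : ℝ) else 0) - c)| :=
          Finset.abs_sum_le_sum_abs _ _
      _ ≤ ∑ _k ∈ Finset.range m, (1 : ℝ) := Finset.sum_le_sum fun k _ => hterm k
      _ = m := by simp
      _ ≤ L := by exact_mod_cast hmL
      _ ≤ _ := by
        have : 0 ≤ m * ρ := mul_nonneg (Nat.cast_nonneg m) hρ0
        linarith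
  · rw [← Finset.sum_range_add_sum_Ico _ hmL.le]
    have h1 : |∑ k ∈ Finset.range L, b k * ((if y k = x₀ then (1 : ℝ) else 0) - c)| ≤ L := by
      calc _ ≤ ∑ k ∈ Finset.range L, |b k * ((if y k = x₀ then (1 : ℝ) else 0) - c)| :=
            Finset.abs_sum_le_sum_abs _ _
        _ ≤ ∑ _k ∈ Finset.range L, (1 : ℝ) := Finset.sum_le_sum fun k _ => hterm k
        _ = L := by simp
    have e2 : ∑ k ∈ Finset.Ico L m, b k * ((if y k = x₀ then (1 : ℝ) else 0) - c)
        = ∑ k ∈ Finset.Ico L m,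
            b k * ((if y k = x₀ then (1 : ℝ) else 0) - (Q ^ L) (y (k - L)) x₀)
          + ∑ k ∈ Finset.Ico L m, b k * ((Q ^ L) (y (k - L)) x₀ - c) := by
      rw [← Finset.sum_add_distrib]
      exact Finset.sum_congr rfl fun k _ => by ring
    have h2 : |∑ k ∈ Finset.Ico L m, b k * ((Q ^ L) (y (k - L)) x₀ - c)| ≤ m * ρ := by
      calc _ ≤ ∑ k ∈ Finset.Ico L m, |b k * ((Q ^ L) (y (k - L)) x₀ - c)| :=
            Finset.abs_sum_le_sum_abs _ _
        _ ≤ ∑ _k ∈ Finset.Ico L m, ρ := by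
            refine Finset.sum_le_sum fun k _ => ?_
            rw [abs_mul, abs_of_nonneg (hb0 k)]
            calc _ ≤ 1 * ρ := mul_le_mul (hb1 k) (hρ _) (abs_nonneg _) zero_le_one
              _ = ρ := one_mul ρ
        _ = (m - L : ℕ) * ρ := by simp
        _ ≤ m * ρ := mul_le_mul_of_nonneg_right (by exact_mod_cast Nat.sub_le m L) hρ0
    have h3 := abs_add_le (∑ k ∈ Finset.range L, b k * ((if y k = x₀ then (1 : ℝ) else 0) - c))
      (∑ k ∈ Finset.Ico L m, b k * ((if y k = x₀ then (1 : ℝ) else 0) - c))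
    have h4 := abs_add_le (∑ k ∈ Finset.Ico L m,
            b k * ((if y k = x₀ then (1 : ℝ) else 0) - (Q ^ L) (y (k - L)) x₀))
      (∑ k ∈ Finset.Ico L m, b k * ((Q ^ L) (y (k - L)) x₀ - c))
    rw [← e2] at h4
    linarith

/-- The indicator of the visits of `y` to `z`. -/
def visits (y : ℕ → Fin r) (z : Fin r) (k : ℕ) : ℝ := if y k = z then 1 else 0

lemma visits_nonneg (y : ℕ → Fin r) (z : Fin r) (k : ℕ) : 0 ≤ visits y z k := by
  unfold visits; split_ifs <;> norm_num

lemma visits_le_one (y : ℕ → Fin r) (z : Fin r) (k : ℕ) : visits y z k ≤ 1 := by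
  unfold visits; split_ifs <;> norm_num

lemma abs_freq_sub_const_le {Q : Matrix (Fin r) (Fin r) ℝ} {x₀ : Fin r}
    {y : ℕ → Fin r} {m L : ℕ} {A c ρ : ℝ}
    (hQ : ∀ l a, |(Q ^ l) a x₀| ≤ 1) (hc0 : 0 ≤ c) (hc1 : c ≤ 1)
    (hρ : ∀ a, |(Q ^ L) a x₀ - c| ≤ ρ)
    (H : ∀ l < L, ∀ x x',
      |transitionSum (lagWeight (fun _ => 1) L l m) (Q x x') y m x x'| ≤ A) :
    |freq y m x₀ - c * m| ≤ L * (r ^ 2 * A) + m * ρ + L := by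
  have := abs_sum_sub_const_le (b := fun _ => 1) (fun _ => zero_le_one) (fun _ => le_rfl)
    hQ hc0 hc1 hρ H
  simpa [freq] using this

lemma abs_empCov_le {Q : Matrix (Fin r) (Fin r) ℝ} {x₀ z : Fin r}
    {y y' : ℕ → Fin r} {m L : ℕ} {A c ρ : ℝ}
    (hQ : ∀ l a, |(Q ^ l) a x₀| ≤ 1) (hc0 : 0 ≤ c) (hc1 : c ≤ 1)
    (hρ : ∀ a, |(Q ^ L) a x₀ - c| ≤ ρ)
    (H : ∀ l < L, ∀ x x',
      |transitionSum (lagWeight (fun _ => 1) L l m) (Q x x') y m x x'| ≤ A)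
    (H' : ∀ l < L, ∀ x x',
      |transitionSum (lagWeight (visits y' z) L l m) (Q x x') y m x x'| ≤ A) :
    |empCov y y' m x₀ z| ≤ 2 * m * (L * (r ^ 2 * A) + m * ρ + L) := by
  set ξ := L * (r ^ 2 * A) + m * ρ + L with hξ
  have h1 : |freq y m x₀ - c * m| ≤ ξ := abs_freq_sub_const_le hQ hc0 hc1 hρ H
  have h2 : |jointFreq y y' m x₀ z - c * freq y' m z| ≤ ξ := by
    have := abs_sum_sub_const_le (visits_nonneg y' z) (visits_le_one y' z) hQ hc0 hc1 hρ H'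
    have e : ∑ k ∈ Finset.range m, visits y' z k * (if y k = x₀ then (1 : ℝ) else 0)
        = jointFreq y y' m x₀ z := by
      refine Finset.sum_congr rfl fun k _ => ?_
      unfold visits
      by_cases h : y k = x₀ <;> by_cases h' : y' k = z <;> simp [h, h']
    rw [e] at this
    exact this
  have hm : (0 : ℝ) ≤ m := Nat.cast_nonneg m
  have e : empCov y y' m x₀ z = m * (jointFreq y y' m x₀ z - c * freq y' m z)
      - (freq y m x₀ - c * m) * freq y' m z := by
    unfold empCov; ring
  rw [e]
  refine (abs_sub _ _).trans ?_
  have a1 : |(m : ℝ) * (jointFreq y y' m x₀ z - c * freq y' m z)| ≤ m * ξ := by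
    rw [abs_mul, abs_of_nonneg hm]
    exact mul_le_mul_of_nonneg_left h2 hm
  have a2 : |(freq y m x₀ - c * m) * freq y' m z| ≤ ξ * m := by
    rw [abs_mul, abs_of_nonneg (freq_nonneg y' m z)]
    exact mul_le_mul h1 (freq_le y' m z) (freq_nonneg _ _ _) ((abs_nonneg _).trans h1)
  linarith

end Lag

/-! ### Probability bounds in the Markov chain model -/

section Model

variable {r : ℕ} {E : Finset (Fin r × Fin r)} {ref : Fin r → Fin r}
  {Ω : Type*} [MeasurableSpace Ω] {μ : Measure Ω} [IsProbabilityMeasure μ]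
  {f : Param E ref → ℝ} {P : ℕ → Ω → Param E ref} {X : ℕ → Ω → ℕ → Fin r}

lemma measure_iUnion_fintype_le_card_mul {κ : Type*} [Fintype κ] {α : Type*} [MeasurableSpace α]
    {ν : Measure α} {A : κ → Set α} {b : ℝ≥0∞} (h : ∀ i, ν (A i) ≤ b) :
    ν {ω | ∃ i, ω ∈ A i} ≤ Fintype.card κ * b := by
  have e : {ω | ∃ i, ω ∈ A i} = ⋃ i, A i := by ext; simp
  rw [e]
  calc ν (⋃ i, A i) ≤ ∑ i, ν (A i) := measure_iUnion_fintype_le ν A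
    _ ≤ ∑ _i : κ, b := Finset.sum_le_sum fun i _ => h i
    _ = _ := by simp

lemma tendsto_measure_of_ae_eventually_notMem {α : Type*} [MeasurableSpace α] {ν : Measure α}
    [IsFiniteMeasure ν] {T : ℕ → Set α} (hT : ∀ n, MeasurableSet (T n))
    (h : ∀ᵐ x ∂ν, ∀ᶠ n in atTop, x ∉ T n) : Tendsto (fun n => ν (T n)) atTop (𝓝 0) := by
  have h2 := tendsto_measure_of_ae_tendsto_indicator_of_isFiniteMeasure (μ := ν) atTop
    (A := ∅) MeasurableSet.empty hT (by
      filter_upwards [h] with x hx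
      filter_upwards [hx] with n hn
      simp [hn])
  simpa using h2

lemma measurable_transitionSum_comp {α : Type*} [MeasurableSpace α] {B : α → ℕ → ℝ}
    {q : α → ℝ} {y : α → ℕ → Fin r} (hB : ∀ k, Measurable fun v => B v k) (hq : Measurable q)
    (hy : Measurable y) (m : ℕ) (x x' : Fin r) :
    Measurable fun v => transitionSum (B v) (q v) (y v) m x x' := by
  unfold transitionSum
  have hy' : ∀ k (x : Fin r), MeasurableSet {v | y v k = x} := fun k x =>
    hy (measurableSet_path_eq k x)
  refine Finset.measurable_sum _ fun k _ => (hB k).mul ?_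
  refine Measurable.ite (hy' k x) ?_ measurable_const
  exact (Measurable.ite (hy' (k + 1) x') measurable_const measurable_const).sub hq

lemma abs_lagWeight_le {b : ℕ → ℝ} (hb : ∀ k, |b k| ≤ 1) (L l m k : ℕ) :
    |lagWeight b L l m k| ≤ 1 := by
  unfold lagWeight; split_ifs
  · exact hb _
  · simp

lemma abs_visits_le (y : ℕ → Fin r) (z : Fin r) (k : ℕ) : |visits y z k| ≤ 1 := by
  rw [abs_of_nonneg (visits_nonneg y z k)]
  exact visits_le_one y z k

variable [NeZero r]

instance (u : ℕ) : IsMarkovKernel (traceLaw μ P X u) := by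
  unfold traceLaw; infer_instance

instance (u v : ℕ) : IsMarkovKernel (pairLaw μ P X u v) := by
  unfold pairLaw; infer_instance

lemma IsMarkovModel.ae_admissible (hM : IsMarkovModel μ f P X) (hf : Measurable f)
    {S : Set (Param E ref)} (hS : S ⊆ admissible E ref) (hf0 : ∀ x, x ∉ S → f x = 0) :
    ∀ᵐ ω ∂μ, ∀ u, P u ω ∈ admissible E ref := by
  rw [ae_all_iff]
  intro u
  refine ae_of_ae_map (hM.measurable_param u).aemeasurable ?_
  rw [hM.law_param u, ae_withDensity_iff hf.ennreal_ofReal]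
  refine ae_of_all _ fun x hx => hS ?_
  by_contra hxS
  exact hx (by rw [hf0 x hxS, ENNReal.ofReal_zero])

lemma IsMarkovModel.measurable_params (hM : IsMarkovModel μ f P X) :
    Measurable fun ω w => P w ω := measurable_pi_iff.2 hM.measurable_param

/-- Transition counts of a user concentrate, uniformly in the transition probabilities. -/
lemma IsMarkovModel.measure_lt_abs_transitionSum (hM : IsMarkovModel μ f P X)
    (href : ∀ i, (i, ref i) ∈ E) (hadm : ∀ᵐ ω ∂μ, ∀ u, P u ω ∈ admissible E ref) (u : ℕ)
    (x x' : Fin r) {b : ℕ → ℝ} (hb : ∀ k, |b k| ≤ 1) {ε : ℝ} (hε : 0 ≤ ε) (hε1 : ε ≤ 1) (m : ℕ) :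
    μ {ω | ε * m < |transitionSum b (transition E ref (P u ω) x x') (X u ω) m x x'|}
      ≤ 2 * ENNReal.ofReal (Real.exp (-(ε ^ 2 * m / 4))) := by
  set A : Set ((ℕ → Param E ref) × (ℕ → Fin r)) :=
    {z | ε * m < |transitionSum b (transition E ref (z.1 u) x x') z.2 m x x'|} with hA
  have hAm : MeasurableSet A := by
    refine measurableSet_lt measurable_const ?_
    have := measurable_transitionSum_comp (B := fun _ : (ℕ → Param E ref) × (ℕ → Fin r) => b)
      (fun k => measurable_const) ((measurable_transition x x').comp
        ((measurable_pi_apply u).comp measurable_fst)) measurable_snd m x x'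
    exact this.abs
  have hPX : Measurable fun ω => ((fun w => P w ω), X u ω) :=
    hM.measurable_params.prodMk (hM.measurable_trace u)
  have e : {ω | ε * m < |transitionSum b (transition E ref (P u ω) x x') (X u ω) m x x'|}
      = (fun ω => ((fun w => P w ω), X u ω)) ⁻¹' A := rfl
  rw [e, ← Measure.map_apply hPX hAm,
    ← compProd_map_condDistrib (X := fun ω w => P w ω) (hM.measurable_trace u).aemeasurable,
    Measure.compProd_apply hAm]
  have hadm' : ∀ᵐ p ∂(μ.map fun ω w => P w ω), p u ∈ admissible E ref := by
    refine (ae_map_iff hM.measurable_params.aemeasurable ?_).2 ?_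
    · have : MeasurableSet (admissible E ref) := by
        have : admissible E ref = (⋂ e, {x | 0 < x e}) ∩
            ⋂ i : Fin r, {x | ∑ e : FreeEdge E ref with e.1.1 = i, x e < 1} := by
          ext x; simp [admissible]
        rw [this]
        refine (MeasurableSet.iInter fun e => measurableSet_lt measurable_const
          (measurable_pi_apply e)).inter (MeasurableSet.iInter fun i => ?_)
        exact measurableSet_lt (by fun_prop) measurable_const
      exact this.preimage (measurable_pi_apply u)
    · filter_upwards [hadm] with ω hω using hω u
  have : IsProbabilityMeasure (μ.map fun ω w => P w ω) :=
    Measure.isProbabilityMeasure_map hM.measurable_params.aemeasurable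
  calc _ ≤ ∫⁻ _p, 2 * ENNReal.ofReal (Real.exp (-(ε ^ 2 * m / 4))) ∂(μ.map fun ω w => P w ω) := by
        refine lintegral_mono_ae ?_
        filter_upwards [hM.markov u, hadm'] with p hp hpa
        exact hp.measure_lt_abs_transitionSum (ν := traceLaw μ P X u p)
          (fun i l => transition_nonneg hpa i l)
          (fun i => sum_transition href (p u) i) x x' hb hε hε1 m
    _ = _ := by simp

/-- The same with weights that depend on an independent source. -/
lemma IsMarkovModel.measure_lt_abs_transitionSum_of_indep (hM : IsMarkovModel μ f P X)
    (href : ∀ i, (i, ref i) ∈ E) (hadm : ∀ᵐ ω ∂μ, ∀ u, P u ω ∈ admissible E ref) (u : ℕ)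
    (x x' : Fin r) {α : Type*} [MeasurableSpace α] {V : Ω → α} (hV : Measurable V)
    (hind : IndepFun (fun ω => (P u ω, X u ω)) V μ) {B : α → ℕ → ℝ}
    (hB : ∀ k, Measurable fun v => B v k) (hb : ∀ v k, |B v k| ≤ 1) {ε : ℝ} (hε : 0 ≤ ε)
    (hε1 : ε ≤ 1) (m : ℕ) :
    μ {ω | ε * m < |transitionSum (B (V ω)) (transition E ref (P u ω) x x') (X u ω) m x x'|}
      ≤ 2 * ENNReal.ofReal (Real.exp (-(ε ^ 2 * m / 4))) := by
  set A : Set ((Param E ref × (ℕ → Fin r)) × α) :=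
    {z | ε * m < |transitionSum (B z.2) (transition E ref z.1.1 x x') z.1.2 m x x'|} with hA
  have hAm : MeasurableSet A := by
    refine measurableSet_lt measurable_const ?_
    have := measurable_transitionSum_comp (α := (Param E ref × (ℕ → Fin r)) × α)
      (B := fun z => B z.2) (fun k => (hB k).comp measurable_snd)
      ((measurable_transition x x').comp (measurable_fst.comp measurable_fst))
      (measurable_snd.comp measurable_fst) m x x'
    exact this.abs
  have hPX : Measurable fun ω => (P u ω, X u ω) :=
    (hM.measurable_param u).prodMk (hM.measurable_trace u)
  have e : {ω | ε * m < |transitionSum (B (V ω)) (transition E ref (P u ω) x x') (X u ω) m x x'|}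
      = (fun ω => ((P u ω, X u ω), V ω)) ⁻¹' A := rfl
  have : IsProbabilityMeasure (μ.map V) := Measure.isProbabilityMeasure_map hV.aemeasurable
  have : IsProbabilityMeasure (μ.map fun ω => (P u ω, X u ω)) :=
    Measure.isProbabilityMeasure_map hPX.aemeasurable
  rw [e, ← Measure.map_apply (hPX.prodMk hV) hAm,
    (indepFun_iff_map_prod_eq_prod_map_map hPX.aemeasurable hV.aemeasurable).1 hind,
    Measure.prod_apply_symm hAm]
  calc _ ≤ ∫⁻ _v, 2 * ENNReal.ofReal (Real.exp (-(ε ^ 2 * m / 4))) ∂(μ.map V) := by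
        refine lintegral_mono fun v => ?_
        rw [Measure.map_apply hPX (measurable_prodMk_right hAm)]
        exact hM.measure_lt_abs_transitionSum href hadm u x x' (hb v) hε hε1 m
    _ = _ := by simp

lemma IsMarkovModel.measure_exists_window (hM : IsMarkovModel μ f P X)
    (href : ∀ i, (i, ref i) ∈ E) (hadm : ∀ᵐ ω ∂μ, ∀ u, P u ω ∈ admissible E ref)
    {ε : ℝ} (hε : 0 ≤ ε) (hε1 : ε ≤ 1) (n m : ℕ) :
    μ {ω | ∃ i : Fin n × Fin r × Fin r, ε * m < |transitionSum (window m)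
        (transition E ref (P i.1 ω) i.2.1 i.2.2) (X i.1 ω) m i.2.1 i.2.2|}
      ≤ (n * (r * r) : ℕ) * (2 * ENNReal.ofReal (Real.exp (-(ε ^ 2 * m / 4)))) := by
  have := measure_iUnion_fintype_le_card_mul (ν := μ) (A := fun i : Fin n × Fin r × Fin r =>
    {ω | ε * m < |transitionSum (window m)
        (transition E ref (P i.1 ω) i.2.1 i.2.2) (X i.1 ω) m i.2.1 i.2.2|})
    (fun i => hM.measure_lt_abs_transitionSum href hadm i.1 i.2.1 i.2.2 (abs_window_le m) hε hε1 m)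
  simpa using this

lemma IsMarkovModel.measure_exists_lag (hM : IsMarkovModel μ f P X)
    (href : ∀ i, (i, ref i) ∈ E) (hadm : ∀ᵐ ω ∂μ, ∀ u, P u ω ∈ admissible E ref)
    {ε : ℝ} (hε : 0 ≤ ε) (hε1 : ε ≤ 1) (u L m : ℕ) :
    μ {ω | ∃ i : Fin L × Fin r × Fin r, ε * m < |transitionSum (lagWeight (fun _ => 1) L i.1 m)
        (transition E ref (P u ω) i.2.1 i.2.2) (X u ω) m i.2.1 i.2.2|}
      ≤ (L * (r * r) : ℕ) * (2 * ENNReal.ofReal (Real.exp (-(ε ^ 2 * m / 4)))) := by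
  have := measure_iUnion_fintype_le_card_mul (ν := μ) (A := fun i : Fin L × Fin r × Fin r =>
    {ω | ε * m < |transitionSum (lagWeight (fun _ => 1) L i.1 m)
        (transition E ref (P u ω) i.2.1 i.2.2) (X u ω) m i.2.1 i.2.2|})
    (fun i => hM.measure_lt_abs_transitionSum href hadm u i.2.1 i.2.2
      (abs_lagWeight_le (fun _ => by simp) L i.1 m) hε hε1 m)
  simpa using this

lemma IsMarkovModel.measure_exists_lag_visits (hM : IsMarkovModel μ f P X)
    (href : ∀ i, (i, ref i) ∈ E) (hadm : ∀ᵐ ω ∂μ, ∀ u, P u ω ∈ admissible E ref)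
    {ε : ℝ} (hε : 0 ≤ ε) (hε1 : ε ≤ 1) (u w L m : ℕ)
    (hind : IndepFun (fun ω => (P u ω, X u ω)) (X w) μ) :
    μ {ω | ∃ i : Fin r × Fin L × Fin r × Fin r,
        ε * m < |transitionSum (lagWeight (visits (X w ω) i.1) L i.2.1 m)
          (transition E ref (P u ω) i.2.2.1 i.2.2.2) (X u ω) m i.2.2.1 i.2.2.2|}
      ≤ (r * (L * (r * r)) : ℕ) * (2 * ENNReal.ofReal (Real.exp (-(ε ^ 2 * m / 4)))) := by
  have := measure_iUnion_fintype_le_card_mul (ν := μ)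
    (A := fun i : Fin r × Fin L × Fin r × Fin r =>
    {ω | ε * m < |transitionSum (lagWeight (visits (X w ω) i.1) L i.2.1 m)
          (transition E ref (P u ω) i.2.2.1 i.2.2.2) (X u ω) m i.2.2.1 i.2.2.2|})
    (fun i => hM.measure_lt_abs_transitionSum_of_indep href hadm u i.2.2.1 i.2.2.2
      (hM.measurable_trace w) hind (B := fun y k => lagWeight (visits y i.1) L i.2.1 m k)
      (fun k => by
        unfold lagWeight visits
        split_ifs
        · exact Measurable.ite (measurableSet_path_eq _ _) measurable_const measurable_const
        · exact measurable_const)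
      (fun y k => abs_lagWeight_le (abs_visits_le y i.1) L i.2.1 m k) hε hε1 m)
  simpa using this

end Model

/-! ### Detection of dependent users -/

section Detection

variable {r : ℕ}

lemma exists_ne_mul_of_mutualInfo_pos {π : Measure (Fin r × Fin r)} [IsProbabilityMeasure π]
    (h : 0 < mutualInfo π) :
    ∃ x z, π.real {(x, z)} ≠ π.real (Prod.fst ⁻¹' {x}) * π.real (Prod.snd ⁻¹' {z}) := by
  by_contra! hcon
  have e : π = π.fst.prod π.snd := by
    refine Measure.ext_of_singleton fun q => ?_
    obtain ⟨x, z⟩ := q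
    have h1 := hcon x z
    rw [← Set.singleton_prod_singleton, Measure.prod_prod, Set.singleton_prod_singleton,
      Measure.fst_apply (measurableSet_singleton x), Measure.snd_apply (measurableSet_singleton z),
      ← ENNReal.toReal_eq_toReal_iff' (measure_ne_top _ _)
        (ENNReal.mul_ne_top (measure_ne_top _ _) (measure_ne_top _ _)), ENNReal.toReal_mul]
    exact h1
  rw [mutualInfo, ← e, InformationTheory.klDiv_self] at h
  exact lt_irrefl _ h

lemma indicator_one_eq_ite {α : Type*} {A : Set α} {a : α} {p : Prop} [Decidable p]
    (h : a ∈ A ↔ p) : A.indicator (fun _ => (1 : ℝ)) a = if p then 1 else 0 := by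
  by_cases hp : p
  · rw [Set.indicator_of_mem (h.2 hp), if_pos hp]
  · rw [Set.indicator_of_notMem (fun ha => hp (h.1 ha)), if_neg hp]

lemma shift_iterate {α : Type*} (k : ℕ) (y : ℕ → α) :
    (fun (y : ℕ → α) j => y (j + 1))^[k] y = fun j => y (j + k) := by
  induction k generalizing y with
  | zero => rfl
  | succ k ih =>
    rw [Function.iterate_succ_apply, ih]
    funext j
    exact congrArg y (by omega)

/-- The empirical covariance of an ergodic pair of paths with positive mutual information does not
tend to zero. -/
lemma tendsto_measure_forall_empCov_le {ν : Measure (ℕ → Fin r × Fin r)} [IsProbabilityMeasure ν]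
    (hν : Ergodic (fun (y : ℕ → Fin r × Fin r) k => y (k + 1)) ν)
    (hpos : 0 < mutualInfo (ν.map fun y => y 0)) {m : ℕ → ℕ} (hm : Tendsto m atTop atTop)
    {t : ℕ → ℝ} (ht : Tendsto t atTop (𝓝 0)) :
    Tendsto (fun n => ν {y | ∀ x z, |empCov (fun k => (y k).1) (fun k => (y k).2) (m n) x z|
      ≤ t n * m n ^ 2}) atTop (𝓝 0) := by
  have hev : Measurable fun y : ℕ → Fin r × Fin r => y 0 := measurable_pi_apply 0
  have : IsProbabilityMeasure (ν.map fun y => y 0) :=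
    Measure.isProbabilityMeasure_map hev.aemeasurable
  obtain ⟨x, z, hxz⟩ := exists_ne_mul_of_mutualInfo_pos hpos
  set A₁ : Set (ℕ → Fin r × Fin r) := (fun y => y 0) ⁻¹' {(x, z)} with hA₁
  set A₂ : Set (ℕ → Fin r × Fin r) := (fun y => y 0) ⁻¹' (Prod.fst ⁻¹' {x}) with hA₂
  set A₃ : Set (ℕ → Fin r × Fin r) := (fun y => y 0) ⁻¹' (Prod.snd ⁻¹' {z}) with hA₃
  have m₁ : MeasurableSet A₁ := hev (measurableSet_singleton _)
  have m₂ : MeasurableSet A₂ := hev (measurable_fst (measurableSet_singleton _))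
  have m₃ : MeasurableSet A₃ := hev (measurable_snd (measurableSet_singleton _))
  rw [map_measureReal_apply hev (measurableSet_singleton _),
    map_measureReal_apply hev (measurable_fst (measurableSet_singleton _)),
    map_measureReal_apply hev (measurable_snd (measurableSet_singleton _))] at hxz
  change ν.real A₁ ≠ ν.real A₂ * ν.real A₃ at hxz
  set δ := |ν.real A₁ - ν.real A₂ * ν.real A₃| with hδdef
  have hδ : 0 < δ := abs_pos.2 (sub_ne_zero.2 hxz)
  have hδ4 : 0 < δ / 4 := by linarith
  have L := fun (A : Set (ℕ → Fin r × Fin r)) (hA : MeasurableSet A) =>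
    (tendsto_measure_average_sub hν hA hδ4).comp hm
  have hsum := ((L A₁ m₁).add ((L A₂ m₂).add (L A₃ m₃)))
  simp only [add_zero] at hsum
  refine tendsto_of_tendsto_of_tendsto_of_le_of_le' tendsto_const_nhds hsum
    (Eventually.of_forall fun _ => zero_le) ?_
  filter_upwards [ht.eventually_lt_const hδ4, hm.eventually_gt_atTop 0] with n htn hmn
  refine le_trans (measure_mono ?_) ((measure_union_le _ _).trans
    (add_le_add_right (measure_union_le _ _) _))
  intro y hy
  have hmpos : (0 : ℝ) < m n := by exact_mod_cast hmn
  by_contra hno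
  simp only [Set.mem_union, Set.mem_ofPred_eq, not_or, not_le, shift_iterate] at hno
  obtain ⟨h1, h2, h3⟩ := hno
  have e1 : ∑ k ∈ Finset.range (m n), A₁.indicator (fun _ => (1 : ℝ)) (fun j => y (j + k))
      = jointFreq (fun k => (y k).1) (fun k => (y k).2) (m n) x z := by
    refine Finset.sum_congr rfl fun k _ => ?_
    exact indicator_one_eq_ite (by simp [hA₁, Prod.ext_iff])
  have e2 : ∑ k ∈ Finset.range (m n), A₂.indicator (fun _ => (1 : ℝ)) (fun j => y (j + k))
      = freq (fun k => (y k).1) (m n) x := by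
    refine Finset.sum_congr rfl fun k _ => ?_
    exact indicator_one_eq_ite (by simp [hA₂])
  have e3 : ∑ k ∈ Finset.range (m n), A₃.indicator (fun _ => (1 : ℝ)) (fun j => y (j + k))
      = freq (fun k => (y k).2) (m n) z := by
    refine Finset.sum_congr rfl fun k _ => ?_
    exact indicator_one_eq_ite (by simp [hA₃])
  rw [e1] at h1
  rw [e2] at h2
  rw [e3] at h3
  have hc := (Set.mem_ofPred_eq ▸ hy :) x z
  rw [empCov] at hc
  set F := jointFreq (fun k => (y k).1) (fun k => (y k).2) (m n) x z
  set f₁ := freq (fun k => (y k).1) (m n) x with hf₁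
  set f₂ := freq (fun k => (y k).2) (m n) z with hf₂
  set M : ℝ := (m n : ℝ)
  have hb : |M⁻¹ * F - (M⁻¹ * f₁) * (M⁻¹ * f₂)| ≤ t n := by
    have e : M⁻¹ * F - (M⁻¹ * f₁) * (M⁻¹ * f₂) = (M ^ 2)⁻¹ * (M * F - f₁ * f₂) := by
      field_simp
    rw [e, abs_mul, abs_of_pos (by positivity), inv_mul_le_iff₀ (by positivity)]
    linarith
  have hA2 : |ν.real A₂| ≤ 1 := by
    rw [abs_of_nonneg measureReal_nonneg]; exact measureReal_le_one
  have hF2 : |M⁻¹ * f₂| ≤ 1 := by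
    rw [abs_of_nonneg (mul_nonneg (by positivity) (freq_nonneg _ _ _)),
      inv_mul_le_iff₀ hmpos, mul_one]
    exact freq_le _ _ _
  have key : δ ≤ |M⁻¹ * F - (M⁻¹ * f₁) * (M⁻¹ * f₂)| + |M⁻¹ * F - ν.real A₁|
      + |M⁻¹ * f₁ - ν.real A₂| + |M⁻¹ * f₂ - ν.real A₃| := by
    have e : ν.real A₁ - ν.real A₂ * ν.real A₃
        = (M⁻¹ * F - (M⁻¹ * f₁) * (M⁻¹ * f₂)) - (M⁻¹ * F - ν.real A₁)
          + (M⁻¹ * f₁ - ν.real A₂) * (M⁻¹ * f₂) + ν.real A₂ * (M⁻¹ * f₂ - ν.real A₃) := by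
      ring
    rw [hδdef, e]
    refine (abs_add_le _ _).trans (add_le_add ((abs_add_le _ _).trans
      (add_le_add (abs_sub _ _) ?_)) ?_)
    · rw [abs_mul]; exact mul_le_of_le_one_right (abs_nonneg _) hF2
    · rw [abs_mul]; exact mul_le_of_le_one_left (abs_nonneg _) hA2
  linarith

variable {E : Finset (Fin r × Fin r)} {ref : Fin r → Fin r}
  {Ω : Type*} [MeasurableSpace Ω] {μ : Measure Ω} [IsProbabilityMeasure μ]
  {f : Param E ref → ℝ} {P : ℕ → Ω → Param E ref} {X : ℕ → Ω → ℕ → Fin r}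

lemma measurable_empCov {α : Type*} [MeasurableSpace α] {y y' : α → ℕ → Fin r}
    (hy : Measurable y) (hy' : Measurable y') (m : ℕ) (x z : Fin r) :
    Measurable fun v => empCov (y v) (y' v) m x z := by
  have h1 : ∀ k (x : Fin r), MeasurableSet {v | y v k = x} := fun k x =>
    hy (measurableSet_path_eq k x)
  have h2 : ∀ k (x : Fin r), MeasurableSet {v | y' v k = x} := fun k x =>
    hy' (measurableSet_path_eq k x)
  unfold empCov jointFreq freq
  refine (measurable_const.mul ?_).sub (Measurable.mul ?_ ?_)
  · exact Finset.measurable_sum _ fun k _ =>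
      Measurable.ite ((h1 k x).inter (h2 k z)) measurable_const measurable_const
  · exact Finset.measurable_sum _ fun k _ =>
      Measurable.ite (h1 k x) measurable_const measurable_const
  · exact Finset.measurable_sum _ fun k _ =>
      Measurable.ite (h2 k z) measurable_const measurable_const

variable [NeZero r]

lemma IsAssociationGraph.tendsto_measure_undetected {G : SimpleGraph ℕ}
    (hG : IsAssociationGraph G μ P X) (hM : IsMarkovModel μ f P X) {u v : ℕ} (huv : G.Adj u v)
    {m : ℕ → ℕ} (hm : Tendsto m atTop atTop) {t : ℕ → ℝ} (ht : Tendsto t atTop (𝓝 0)) :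
    Tendsto (fun n => μ {ω | ∀ x z, |empCov (X u ω) (X v ω) (m n) x z| ≤ t n * m n ^ 2})
      atTop (𝓝 0) := by
  set A : ℕ → Set (ℕ → Fin r × Fin r) := fun n => {y | ∀ x z,
    |empCov (fun k => (y k).1) (fun k => (y k).2) (m n) x z| ≤ t n * m n ^ 2} with hA
  have hAm : ∀ n, MeasurableSet (A n) := by
    intro n
    have : A n = ⋂ x, ⋂ z, {y | |empCov (fun k => (y k).1) (fun k => (y k).2) (m n) x z|
        ≤ t n * m n ^ 2} := by
      ext; simp [hA]
    rw [this]
    refine MeasurableSet.iInter fun x => MeasurableSet.iInter fun z => ?_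
    refine measurableSet_le (Measurable.abs ?_) measurable_const
    exact measurable_empCov
      (measurable_pi_iff.2 fun k => measurable_fst.comp (measurable_pi_apply k))
      (measurable_pi_iff.2 fun k => measurable_snd.comp (measurable_pi_apply k)) _ x z
  have hXm : Measurable fun ω k => (X u ω k, X v ω k) := measurable_pi_iff.2 fun k =>
    ((measurable_pi_apply k).comp (hM.measurable_trace u)).prodMk
      ((measurable_pi_apply k).comp (hM.measurable_trace v))
  have e : ∀ n, μ {ω | ∀ x z, |empCov (X u ω) (X v ω) (m n) x z| ≤ t n * m n ^ 2}
      = ∫⁻ p, pairLaw μ P X u v p (A n) ∂(μ.map fun ω w => P w ω) := by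
    intro n
    have h := setLIntegral_preimage_condDistrib (μ := μ) hM.measurable_params hXm.aemeasurable
      (hAm n) MeasurableSet.univ
    rw [Set.preimage_univ, setLIntegral_univ, Set.univ_inter] at h
    rw [lintegral_map ((pairLaw μ P X u v).measurable_coe (hAm n)) hM.measurable_params]
    exact h.symm
  simp_rw [e]
  have : IsProbabilityMeasure (μ.map fun ω w => P w ω) :=
    Measure.isProbabilityMeasure_map hM.measurable_params.aemeasurable
  have h0 := tendsto_lintegral_of_dominated_convergence (μ := μ.map fun ω w => P w ω)
    (F := fun n p => pairLaw μ P X u v p (A n)) (f := fun _ => 0) (fun _ => 1)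
    (fun n => (pairLaw μ P X u v).measurable_coe (hAm n))
    (fun n => ae_of_all _ fun p => prob_le_one) (by simp) (by
      filter_upwards [hG.dependent u v huv, hG.ergodic u v huv] with p hp hp'
      exact tendsto_measure_forall_empCov_le hp' (hp 0) hm ht)
  simpa using h0

end Detection

/-! ### Obfuscation -/

section Obfuscation

variable {r : ℕ}

lemma sum_channel_mul_ite (hr : 2 ≤ r) {ρ : ℝ} (i : Fin r) (A B : ℝ≥0∞) :
    ∑ l, ENNReal.ofReal (channel r ρ i l) * (if l = i then A else B)
      = ENNReal.ofReal (1 - ρ) * A + ENNReal.ofReal ρ * B := by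
  have hr' : (2 : ℝ) ≤ r := by exact_mod_cast hr
  rw [← Finset.add_sum_erase _ _ (Finset.mem_univ i)]
  congr 1
  · simp [channel]
  · have : ∀ l ∈ Finset.univ.erase i,
        ENNReal.ofReal (channel r ρ i l) * (if l = i then A else B)
          = ENNReal.ofReal (ρ / ((r : ℝ) - 1)) * B := by
      intro l hl
      have hl' := Finset.ne_of_mem_erase hl
      rw [channel, if_neg hl', if_neg hl']
    rw [Finset.sum_congr rfl this, Finset.sum_const, Finset.card_erase_of_mem (Finset.mem_univ i),
      Finset.card_univ, Fintype.card_fin, nsmul_eq_mul, ← mul_assoc]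
    congr 1
    rw [← ENNReal.ofReal_natCast, ← ENNReal.ofReal_mul (Nat.cast_nonneg _),
      Nat.cast_sub (by omega), Nat.cast_one]
    congr 1
    have : (r : ℝ) - 1 ≠ 0 := by linarith
    field_simp

lemma sum_channel (hr : 2 ≤ r) {ρ : ℝ} (h0 : 0 ≤ ρ) (h1 : ρ ≤ 1) (i : Fin r) :
    ∑ l, ENNReal.ofReal (channel r ρ i l) = 1 := by
  have := sum_channel_mul_ite hr (ρ := ρ) i 1 1
  simp only [ite_self, mul_one] at this
  rw [this, ← ENNReal.ofReal_add (by linarith) h0]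
  simp

variable [NeZero r]

/-- The observed part of a trace as an infinite path. -/
def extendPath {m : ℕ} (z : Fin m → Fin r) (k : ℕ) : Fin r :=
  if h : k < m then z ⟨k, h⟩ else 0

lemma extendPath_fin {m : ℕ} (z : Fin m → Fin r) (k : Fin m) : extendPath z k = z k := by
  simp [extendPath]

lemma hammingCount_extendPath {m : ℕ} (z : Fin m → Fin r) (y : ℕ → Fin r) :
    hammingCount (extendPath z) y m = ∑ k : Fin m, if z k = y k then (0 : ℝ) else 1 := by
  unfold hammingCount
  rw [Finset.sum_range]
  simp_rw [extendPath_fin]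

variable {E : Finset (Fin r × Fin r)} {ref : Fin r → Fin r}
  {Ω : Type*} [MeasurableSpace Ω] {μ : Measure Ω} [IsProbabilityMeasure μ]
  {f : Param E ref → ℝ} {P : ℕ → Ω → Param E ref} {X : ℕ → Ω → ℕ → Fin r}
  {n m : ℕ} {a : ℝ} {R : Fin n → Ω → ℝ} {Z : Ω → Fin n → Fin m → Fin r}

lemma IsObfuscation.ae_noise_mem (hO : IsObfuscation μ P X a R Z) :
    ∀ᵐ ω ∂μ, ∀ u, 0 ≤ R u ω ∧ R u ω ≤ a := by
  rw [ae_all_iff]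
  intro u
  refine ae_of_ae_map (p := fun x => 0 ≤ x ∧ x ≤ a) (hO.measurable_noise u).aemeasurable ?_
  have h := hO.uniform_noise u
  unfold pdf.IsUniform at h
  rw [h]
  exact ProbabilityTheory.ae_cond_mem measurableSet_Icc

/-- The source of the obfuscation: parameters, data and noise levels. -/
def source (P : ℕ → Ω → Param E ref) (X : ℕ → Ω → ℕ → Fin r) (R : Fin n → Ω → ℝ) (ω : Ω) :
    ((ℕ → Param E ref) × (ℕ → ℕ → Fin r)) × (Fin n → ℝ) :=
  ((fun w => P w ω, fun w => X w ω), fun u => R u ω)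

lemma IsObfuscation.measurable_source (hO : IsObfuscation μ P X a R Z)
    (hM : IsMarkovModel μ f P X) : Measurable (source P X R) :=
  (hM.measurable_params.prodMk (measurable_pi_iff.2 hM.measurable_trace)).prodMk
    (measurable_pi_iff.2 hO.measurable_noise)

lemma sum_prod_prod {κ κ' β : Type*} [Fintype κ] [Fintype κ'] [Fintype β] [DecidableEq κ]
    [DecidableEq κ'] (g : κ → κ' → β → ℝ≥0∞) :
    ∑ z : κ → κ' → β, ∏ u, ∏ k, g u k (z u k) = ∏ u, ∏ k, ∑ l, g u k l := by
  have h1 : ∀ u, ∏ k, ∑ l, g u k l = ∑ y : κ' → β, ∏ k, g u k (y k) := by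
    intro u
    rw [Finset.prod_univ_sum]
    simp
  simp_rw [h1]
  rw [Finset.prod_univ_sum]
  simp

/-- Integrating out the obfuscation channel. -/
lemma IsObfuscation.lintegral_prod (hO : IsObfuscation μ P X a R Z) (hM : IsMarkovModel μ f P X)
    (φ : ((ℕ → Param E ref) × (ℕ → ℕ → Fin r)) × (Fin n → ℝ) → ℝ≥0∞) (hφ : Measurable φ)
    (h : ((ℕ → Param E ref) × (ℕ → ℕ → Fin r)) × (Fin n → ℝ) → Fin n → Fin m → Fin r → ℝ≥0∞)
    (hh : ∀ u k l, Measurable fun t => h t u k l) :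
    ∫⁻ ω, φ (source P X R ω) * ∏ u, ∏ k : Fin m, h (source P X R ω) u k (Z ω u k) ∂μ
      = ∫⁻ ω, φ (source P X R ω) * ∏ u, ∏ k : Fin m, ∑ l,
          ENNReal.ofReal (channel r (R u ω) (X u ω k) l) * h (source P X R ω) u k l ∂μ := by
  have hs := hO.measurable_source hM
  set F : (((ℕ → Param E ref) × (ℕ → ℕ → Fin r)) × (Fin n → ℝ)) × (Fin n → Fin m → Fin r)
    → ℝ≥0∞ := fun q => φ q.1 * ∏ u, ∏ k : Fin m, h q.1 u k (q.2 u k) with hF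
  have hFm : Measurable F := by
    refine measurable_from_prod_countable_left fun z => ?_
    exact hφ.mul (Finset.measurable_prod _ fun u _ => Finset.measurable_prod _ fun k _ =>
      hh u k (z u k))
  have e1 : ∫⁻ ω, φ (source P X R ω) * ∏ u, ∏ k : Fin m, h (source P X R ω) u k (Z ω u k) ∂μ
      = ∫⁻ q, F q ∂(μ.map fun ω => (source P X R ω, Z ω)) :=
    (lintegral_map hFm (hs.prodMk hO.measurable_obfuscated)).symm
  rw [e1, ← compProd_map_condDistrib (X := source P X R) hO.measurable_obfuscated.aemeasurable,
    Measure.lintegral_compProd hFm]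
  have e2 : ∀ᵐ t ∂(μ.map (source P X R)),
      ∫⁻ z, F (t, z) ∂(condDistrib Z (source P X R) μ t)
        = φ t * ∏ u, ∏ k : Fin m, ∑ l, ENNReal.ofReal (channel r (t.2 u) (t.1.2 u k) l) * h t u k l := by
    filter_upwards [hO.channel_law] with t ht
    rw [lintegral_fintype]
    have ht' : ∀ z, condDistrib Z (source P X R) μ t {z}
        = ∏ u : Fin n, ∏ k : Fin m, ENNReal.ofReal (channel r (t.2 u) (t.1.2 u k) (z u k)) := ht
    simp_rw [ht', hF]
    rw [← sum_prod_prod fun u (k : Fin m) l =>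
      ENNReal.ofReal (channel r (t.2 u) (t.1.2 u k) l) * h t u k l, Finset.mul_sum]
    refine Finset.sum_congr rfl fun z _ => ?_
    simp_rw [Finset.prod_mul_distrib]
    ring
  rw [lintegral_congr_ae e2, lintegral_map ?_ hs]
  · rfl
  · refine hφ.mul (Finset.measurable_prod _ fun u _ => Finset.measurable_prod _ fun k _ =>
      Finset.measurable_sum _ fun l _ => Measurable.mul ?_ (hh u k l))
    refine Measurable.ennreal_ofReal ?_
    have hR : Measurable fun t : ((ℕ → Param E ref) × (ℕ → ℕ → Fin r)) × (Fin n → ℝ) => t.2 u :=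
      (measurable_pi_apply u).comp measurable_snd
    have hX : Measurable fun t : ((ℕ → Param E ref) × (ℕ → ℕ → Fin r)) × (Fin n → ℝ) =>
        t.1.2 u k :=
      (measurable_pi_apply (k : ℕ)).comp
        ((measurable_pi_apply (u : ℕ)).comp (measurable_snd.comp measurable_fst))
    unfold channel
    exact Measurable.ite (measurableSet_eq_fun measurable_const hX)
      (measurable_const.sub hR) (hR.div_const _)

/-- The event that a data point is changed has small probability. -/
lemma IsObfuscation.measure_ne_le (hO : IsObfuscation μ P X a R Z) (hM : IsMarkovModel μ f P X)
    (hr : 2 ≤ r) (ha1 : a ≤ 1) (u : Fin n) (k : Fin m) :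
    μ {ω | Z ω u k ≠ X u ω k} ≤ ENNReal.ofReal a := by
  have hXm : ∀ (u' : Fin n) (k' : Fin m) (l : Fin r), MeasurableSet
      {t : ((ℕ → Param E ref) × (ℕ → ℕ → Fin r)) × (Fin n → ℝ) | l = t.1.2 u' k'} := fun u' k' l =>
    measurableSet_eq_fun measurable_const ((measurable_pi_apply (k' : ℕ)).comp
        ((measurable_pi_apply (u' : ℕ)).comp (measurable_snd.comp measurable_fst)))
  have key := hO.lintegral_prod hM (fun _ => 1) measurable_const
    (fun t u' k' l => if u' = u ∧ k' = k then (if l = t.1.2 u' k' then 0 else 1) else 1) (by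
      intro u' k' l
      by_cases huk : u' = u ∧ k' = k
      · simp only [if_pos huk]
        exact Measurable.ite (hXm u' k' l) measurable_const measurable_const
      · simp only [if_neg huk]
        exact measurable_const)
  have hset : MeasurableSet {ω | Z ω u k ≠ X u ω k} := by
    refine MeasurableSet.compl (measurableSet_eq_fun ?_ ?_)
    · exact (measurable_pi_apply k).comp ((measurable_pi_apply u).comp hO.measurable_obfuscated)
    · exact (measurable_pi_apply (k : ℕ)).comp (hM.measurable_trace u)
  have hprod : ∀ g : Fin n → Fin m → ℝ≥0∞, (∀ u' k', ¬ (u' = u ∧ k' = k) → g u' k' = 1) →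
      ∏ u', ∏ k', g u' k' = g u k := by
    intro g hg
    rw [Finset.prod_eq_single u, Finset.prod_eq_single k]
    · exact fun k' _ hk' => hg u k' fun h => hk' h.2
    · intro h; exact absurd (Finset.mem_univ _) h
    · exact fun u' _ hu' => Finset.prod_eq_one fun k' _ => hg u' k' fun h => hu' h.1
    · intro h; exact absurd (Finset.mem_univ _) h
  have hl : ∫⁻ ω, {ω | Z ω u k ≠ X u ω k}.indicator 1 ω ∂μ = ∫⁻ ω, ENNReal.ofReal (R u ω) ∂μ := by
    refine Eq.trans (lintegral_congr fun ω => ?_) (key.trans (lintegral_congr_ae ?_))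
    · rw [one_mul, hprod _ fun u' k' h => if_neg h, if_pos ⟨rfl, rfl⟩]
      by_cases h : Z ω u k = X u ω k
      · rw [Set.indicator_of_notMem (by simpa using h)]; exact (if_pos h).symm
      · rw [Set.indicator_of_mem h]; exact (if_neg h).symm
    · filter_upwards [hO.ae_noise_mem] with ω hω
      rw [one_mul, hprod]
      · simp only [and_self, if_true]
        have := sum_channel_mul_ite hr (ρ := R u ω) (X u ω k) 0 1
        rw [mul_zero, zero_add, mul_one] at this
        exact this
      · intro u' k' h
        simp only [if_neg h, mul_one]
        exact sum_channel hr (hω u').1 ((hω u').2.trans ha1) _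
  rw [← lintegral_indicator_one hset, hl]
  calc _ ≤ ∫⁻ _ω, ENNReal.ofReal a ∂μ := by
        refine lintegral_mono_ae ?_
        filter_upwards [hO.ae_noise_mem] with ω hω
        exact ENNReal.ofReal_le_ofReal (hω u).2
    _ = _ := by simp

/-- The number of changed data points of a user is exponentially unlikely to be large. -/
lemma IsObfuscation.measure_lt_hammingCount (hO : IsObfuscation μ P X a R Z)
    (hM : IsMarkovModel μ f P X) (hr : 2 ≤ r) (ha1 : a ≤ 1) {ε : ℝ}
    (haε : 4 * a ≤ ε) (u : Fin n) :
    μ {ω | ε * m < hammingCount (extendPath (Z ω u)) (X u ω) m}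
      ≤ ENNReal.ofReal (Real.exp (-(ε * m / 2))) := by
  have hXm : ∀ (u' : Fin n) (k' : Fin m) (l : Fin r), MeasurableSet
      {t : ((ℕ → Param E ref) × (ℕ → ℕ → Fin r)) × (Fin n → ℝ) | l = t.1.2 u' k'} := fun u' k' l =>
    measurableSet_eq_fun measurable_const ((measurable_pi_apply (k' : ℕ)).comp
        ((measurable_pi_apply (u' : ℕ)).comp (measurable_snd.comp measurable_fst)))
  set B : ℝ≥0∞ := ENNReal.ofReal (Real.exp 1) with hB
  have key := hO.lintegral_prod hM (fun _ => 1) measurable_const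
    (fun t u' k' l => if u' = u then (if l = t.1.2 u' k' then 1 else B) else 1) (by
      intro u' k' l
      by_cases huk : u' = u
      · simp only [if_pos huk]
        exact Measurable.ite (hXm u' k' l) measurable_const measurable_const
      · simp only [if_neg huk]
        exact measurable_const)
  have hprod : ∀ g : Fin n → Fin m → ℝ≥0∞, (∀ u' k', u' ≠ u → g u' k' = 1) →
      ∏ u', ∏ k', g u' k' = ∏ k', g u k' := by
    intro g hg
    rw [Finset.prod_eq_single u]
    · exact fun u' _ hu' => Finset.prod_eq_one fun k' _ => hg u' k' hu'
    · intro h; exact absurd (Finset.mem_univ _) h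
  have hL : ∫⁻ ω, ENNReal.ofReal (Real.exp (hammingCount (extendPath (Z ω u)) (X u ω) m)) ∂μ
      ≤ ENNReal.ofReal (Real.exp (2 * a * m)) := by
    have e : ∫⁻ ω, ENNReal.ofReal (Real.exp (hammingCount (extendPath (Z ω u)) (X u ω) m)) ∂μ
        = ∫⁻ ω, ∏ k : Fin m, (ENNReal.ofReal (1 - R u ω) * 1 + ENNReal.ofReal (R u ω) * B) ∂μ := by
      refine Eq.trans (lintegral_congr fun ω => ?_) (key.trans (lintegral_congr_ae ?_))
      · rw [one_mul, hprod _ fun u' k' h => if_neg h, hammingCount_extendPath, Real.exp_sum,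
          ENNReal.ofReal_prod_of_nonneg fun _ _ => Real.exp_nonneg _]
        refine Finset.prod_congr rfl fun k _ => ?_
        simp only [if_true]
        by_cases h : Z ω u k = X u ω k
        · rw [if_pos h, Real.exp_zero, ENNReal.ofReal_one]
          exact (if_pos h).symm
        · rw [if_neg h]
          exact (if_neg h).symm
      · filter_upwards [hO.ae_noise_mem] with ω hω
        rw [one_mul, hprod]
        · refine Finset.prod_congr rfl fun k _ => ?_
          simp only [if_true]
          exact sum_channel_mul_ite hr (X u ω k) 1 B
        · intro u' k' h
          simp only [if_neg h, mul_one]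
          exact sum_channel hr (hω u').1 ((hω u').2.trans ha1) _
    rw [e]
    calc _ ≤ ∫⁻ _ω, ENNReal.ofReal (Real.exp (2 * a * m)) ∂μ := by
          refine lintegral_mono_ae ?_
          filter_upwards [hO.ae_noise_mem] with ω hω
          rw [Finset.prod_const, Finset.card_univ, Fintype.card_fin, mul_one, hB,
            ← ENNReal.ofReal_mul (hω u).1, ← ENNReal.ofReal_add (by linarith [(hω u).2])
              (mul_nonneg (hω u).1 (Real.exp_nonneg _)), ← ENNReal.ofReal_pow
              (add_nonneg (by linarith [(hω u).2]) (mul_nonneg (hω u).1 (Real.exp_nonneg _)))]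
          refine ENNReal.ofReal_le_ofReal ?_
          rw [mul_comm (2 * a), Real.exp_nat_mul]
          refine pow_le_pow_left₀ (add_nonneg (by linarith [(hω u).2])
            (mul_nonneg (hω u).1 (Real.exp_nonneg _))) ?_ m
          have h3 : Real.exp 1 ≤ 3 := Real.exp_one_lt_three.le
          have h4 := Real.add_one_le_exp (2 * a)
          nlinarith [(hω u).1, (hω u).2]
      _ = _ := by simp
  set c : ℝ≥0∞ := ENNReal.ofReal (Real.exp (ε * m)) with hc
  have hc0 : c ≠ 0 := by simp [hc, Real.exp_pos]
  have hsub : {ω | ε * m < hammingCount (extendPath (Z ω u)) (X u ω) m} ⊆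
      {ω | c ≤ ENNReal.ofReal (Real.exp (hammingCount (extendPath (Z ω u)) (X u ω) m))} := by
    intro ω hω
    exact ENNReal.ofReal_le_ofReal (Real.exp_le_exp.2 (le_of_lt hω))
  have hmeas : Measurable fun ω => hammingCount (extendPath (Z ω u)) (X u ω) m := by
    simp_rw [hammingCount_extendPath]
    refine Finset.measurable_sum _ fun k _ => Measurable.ite (measurableSet_eq_fun ?_ ?_)
      measurable_const measurable_const
    · exact (measurable_pi_apply k).comp ((measurable_pi_apply u).comp hO.measurable_obfuscated)
    · exact (measurable_pi_apply (k : ℕ)).comp (hM.measurable_trace u)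
  calc _ ≤ _ := measure_mono hsub
    _ ≤ (∫⁻ ω, ENNReal.ofReal (Real.exp (hammingCount (extendPath (Z ω u)) (X u ω) m)) ∂μ) / c :=
        meas_ge_le_lintegral_div
          (Real.measurable_exp.comp hmeas).ennreal_ofReal.aemeasurable hc0 ENNReal.ofReal_ne_top
    _ ≤ ENNReal.ofReal (Real.exp (2 * a * m)) / c := ENNReal.div_le_div_right hL _
    _ ≤ _ := by
        rw [hc, ← ENNReal.ofReal_div_of_pos (Real.exp_pos _), ← Real.exp_sub]
        refine ENNReal.ofReal_le_ofReal (Real.exp_le_exp.2 ?_)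
        have : 2 * a * m ≤ ε / 2 * m := mul_le_mul_of_nonneg_right (by linarith) (Nat.cast_nonneg m)
        linarith

lemma IsObfuscation.measure_exists_hammingCount (hO : IsObfuscation μ P X a R Z)
    (hM : IsMarkovModel μ f P X) (hr : 2 ≤ r) (ha1 : a ≤ 1) {ε : ℝ}
    (haε : 4 * a ≤ ε) :
    μ {ω | ∃ u : Fin n, ε * m < hammingCount (extendPath (Z ω u)) (X u ω) m}
      ≤ n * ENNReal.ofReal (Real.exp (-(ε * m / 2))) := by
  have := measure_iUnion_fintype_le_card_mul (ν := μ)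
    (A := fun u : Fin n => {ω | ε * m < hammingCount (extendPath (Z ω u)) (X u ω) m})
    (fun u => hO.measure_lt_hammingCount hM hr ha1 haε u)
  simpa using this

end Obfuscation

/-! ### Dependence structure of tuples of paths -/

section Structure

variable {r : ℕ}

/-- Two paths of length `m` look dependent at level `τ`. -/
def LooksDependent (y y' : ℕ → Fin r) (m : ℕ) (τ : ℝ) : Prop :=
  ∃ x z, τ * m ^ 2 < |empCov y y' m x z|

/-- The tuple `w` of paths looks like a group with association graph `A`: adjacent members look
dependent, and no member looks dependent on a path outside of the tuple. -/
def LooksLikeGroup {κ ι : Type*} (A : ι → ι → Prop) (D : κ → κ → Prop) (w : ι → κ) : Prop :=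
  (∀ i j, A i j → D (w i) (w j)) ∧ ∀ i b, D (w i) b → b ∈ Set.range w

lemma LooksLikeGroup.range_subset {κ ι : Type*} {A : ι → ι → Prop} {D : κ → κ → Prop}
    {w w' : ι → κ} (hw : LooksLikeGroup A D w) (hw' : LooksLikeGroup A D w') {i₀ : ι}
    (hA : ∀ i, Relation.ReflTransGen A i₀ i) (h0 : w i₀ = w' i₀) :
    Set.range w' ⊆ Set.range w := by
  rintro _ ⟨i, rfl⟩
  induction hA i with
  | refl => exact ⟨i₀, h0⟩
  | tail _ hij ih =>
    obtain ⟨k, hk⟩ := ih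
    exact hw.2 k _ (hk ▸ hw'.1 _ _ hij)

/-- A tuple that looks like a connected group is determined, up to order, by one of its members. -/
lemma ncard_looksLikeGroup_le {κ ι : Type*} [Fintype κ] [Fintype ι] {A : ι → ι → Prop}
    {D : κ → κ → Prop} {i₀ : ι} (hA : ∀ i, Relation.ReflTransGen A i₀ i) :
    {w : ι → κ | LooksLikeGroup A D w}.ncard
      ≤ Fintype.card κ * Fintype.card ι ^ Fintype.card ι := by
  classical
  have hfib : ∀ b : κ, {w : ι → κ | LooksLikeGroup A D w ∧ w i₀ = b}.ncard
      ≤ Fintype.card ι ^ Fintype.card ι := by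
    intro b
    rcases Set.eq_empty_or_nonempty {w : ι → κ | LooksLikeGroup A D w ∧ w i₀ = b} with h | ⟨w, hw⟩
    · rw [h, Set.ncard_empty]; exact Nat.zero_le _
    · have hsub : {w : ι → κ | LooksLikeGroup A D w ∧ w i₀ = b} ⊆
          (fun g : ι → ι => w ∘ g) '' Set.univ := by
        intro w' hw'
        have hr := LooksLikeGroup.range_subset hw.1 hw'.1 hA (hw.2.trans hw'.2.symm)
        choose g hg using fun i => hr ⟨i, rfl⟩
        exact ⟨g, Set.mem_univ _, funext hg⟩
      calc _ ≤ ((fun g : ι → ι => w ∘ g) '' Set.univ).ncard :=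
            Set.ncard_le_ncard hsub (Set.toFinite _)
        _ ≤ (Set.univ : Set (ι → ι)).ncard := Set.ncard_image_le (Set.toFinite _)
        _ = _ := by rw [Set.ncard_univ, Nat.card_eq_fintype_card, Fintype.card_fun]
  have e : {w : ι → κ | LooksLikeGroup A D w}
      = ⋃ b ∈ (Finset.univ : Finset κ), {w : ι → κ | LooksLikeGroup A D w ∧ w i₀ = b} := by
    ext w; simp
  rw [e]
  calc _ ≤ ∑ b ∈ (Finset.univ : Finset κ), {w : ι → κ | LooksLikeGroup A D w ∧ w i₀ = b}.ncard :=
        Finset.set_ncard_biUnion_le _ _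
    _ ≤ ∑ _b ∈ (Finset.univ : Finset κ), Fintype.card ι ^ Fintype.card ι :=
        Finset.sum_le_sum fun b _ => hfib b
    _ = _ := by simp

end Structure

/-! ### Independence -/

section Independence

variable {Ω 𝒴 𝒰 𝒱 : Type*} [MeasurableSpace Ω] [MeasurableSpace 𝒴] [MeasurableSpace 𝒰]
  [MeasurableSpace 𝒱] {μ : Measure Ω} [IsProbabilityMeasure μ]

lemma indepFun_prodMk_right {Y : Ω → 𝒴} {U : Ω → 𝒰} {V : Ω → 𝒱} (hY : Measurable Y)
    (hU : Measurable U) (hV : Measurable V) (h1 : IndepFun Y U μ)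
    (h2 : IndepFun (fun ω => (Y ω, U ω)) V μ) : IndepFun Y (fun ω => (U ω, V ω)) μ := by
  have : IsProbabilityMeasure (μ.map Y) := Measure.isProbabilityMeasure_map hY.aemeasurable
  have : IsProbabilityMeasure (μ.map U) := Measure.isProbabilityMeasure_map hU.aemeasurable
  have : IsProbabilityMeasure (μ.map V) := Measure.isProbabilityMeasure_map hV.aemeasurable
  have h3 : IndepFun U V μ := h2.comp measurable_snd measurable_id
  rw [indepFun_iff_map_prod_eq_prod_map_map hY.aemeasurable (hU.prodMk hV).aemeasurable,
    (indepFun_iff_map_prod_eq_prod_map_map hU.aemeasurable hV.aemeasurable).1 h3,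
    ← Measure.prodAssoc_prod,
    ← (indepFun_iff_map_prod_eq_prod_map_map hY.aemeasurable hU.aemeasurable).1 h1,
    ← (indepFun_iff_map_prod_eq_prod_map_map (hY.prodMk hU).aemeasurable hV.aemeasurable).1 h2,
    Measure.map_map MeasurableEquiv.prodAssoc.measurable ((hY.prodMk hU).prodMk hV)]
  rfl

lemma lintegral_indicator_mul_le_of_indepFun {Y : Ω → 𝒴} {V : Ω → 𝒱} (hY : Measurable Y)
    (hV : Measurable V) (h : IndepFun Y V μ) {A : Set (𝒴 × 𝒱)} (hA : MeasurableSet A)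
    {b : ℝ≥0∞} (hb : ∀ v, μ {ω | (Y ω, v) ∈ A} ≤ b) {ψ : 𝒱 → ℝ≥0∞} (hψ : Measurable ψ) :
    ∫⁻ ω, A.indicator 1 (Y ω, V ω) * ψ (V ω) ∂μ ≤ b * ∫⁻ ω, ψ (V ω) ∂μ := by
  have : IsProbabilityMeasure (μ.map Y) := Measure.isProbabilityMeasure_map hY.aemeasurable
  have : IsProbabilityMeasure (μ.map V) := Measure.isProbabilityMeasure_map hV.aemeasurable
  have hF : Measurable fun q : 𝒴 × 𝒱 => A.indicator (1 : 𝒴 × 𝒱 → ℝ≥0∞) q * ψ q.2 :=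
    (measurable_one.indicator hA).mul (hψ.comp measurable_snd)
  rw [← lintegral_map (f := fun q : 𝒴 × 𝒱 => A.indicator (1 : 𝒴 × 𝒱 → ℝ≥0∞) q * ψ q.2) hF
      (hY.prodMk hV),
    (indepFun_iff_map_prod_eq_prod_map_map hY.aemeasurable hV.aemeasurable).1 h,
    lintegral_prod_symm' _ hF, ← lintegral_map hψ hV, ← lintegral_const_mul b hψ]
  refine lintegral_mono fun v => ?_
  have hAi : Measurable fun y => A.indicator (1 : 𝒴 × 𝒱 → ℝ≥0∞) (y, v) :=
    (measurable_one.indicator hA).comp measurable_prodMk_right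
  change ∫⁻ y, A.indicator (1 : 𝒴 × 𝒱 → ℝ≥0∞) (y, v) * ψ v ∂(μ.map Y) ≤ b * ψ v
  rw [lintegral_mul_const _ hAi]
  refine mul_le_mul_left ?_ _
  have hAv : MeasurableSet {y | (y, v) ∈ A} := measurable_prodMk_right hA
  have e : ∀ y, A.indicator (1 : 𝒴 × 𝒱 → ℝ≥0∞) (y, v) = {y | (y, v) ∈ A}.indicator 1 y := by
    intro y
    rfl
  rw [lintegral_congr e, lintegral_indicator_one hAv, Measure.map_apply hY hAv]
  exact hb v

end Independence

/-! ### Competing groups -/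

section Competitors

variable {r : ℕ} [NeZero r] {E : Finset (Fin r × Fin r)} {ref : Fin r → Fin r}
  {Ω : Type*} [MeasurableSpace Ω] {μ : Measure Ω} [IsProbabilityMeasure μ]
  {f : Param E ref → ℝ} {P : ℕ → Ω → Param E ref} {X : ℕ → Ω → ℕ → Fin r}
  {n m : ℕ} {a : ℝ} {R : Fin n → Ω → ℝ} {Z : Ω → Fin n → Fin m → Fin r}

/-- The law of a part of the obfuscated data. -/
lemma IsObfuscation.measure_inter (hO : IsObfuscation μ P X a R Z) (hM : IsMarkovModel μ f P X)
    (hr : 2 ≤ r) (ha1 : a ≤ 1) (D : Fin n → Prop) [DecidablePred D] (z : Fin n → Fin m → Fin r)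
    {A : Set (((ℕ → Param E ref) × (ℕ → ℕ → Fin r)) × (Fin n → ℝ))} (hA : MeasurableSet A) :
    μ {ω | source P X R ω ∈ A ∧ ∀ u, D u → Z ω u = z u}
      = ∫⁻ ω, A.indicator 1 (source P X R ω) * ∏ u, ∏ k : Fin m,
        (if D u then ENNReal.ofReal (channel r (R u ω) (X u ω k) (z u k)) else 1) ∂μ := by
  have key := hO.lintegral_prod hM (A.indicator 1) (measurable_one.indicator hA)
    (fun _ u k l => if D u then (if l = z u k then 1 else 0) else 1)
    (fun _ _ _ => measurable_const)
  have hset : MeasurableSet {ω | source P X R ω ∈ A ∧ ∀ u, D u → Z ω u = z u} := by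
    refine MeasurableSet.inter (hO.measurable_source hM hA) ?_
    have : MeasurableSet {z' : Fin n → Fin m → Fin r | ∀ u, D u → z' u = z u} :=
      MeasurableSet.of_discrete
    exact hO.measurable_obfuscated this
  rw [← lintegral_indicator_one hset]
  refine Eq.trans (lintegral_congr fun ω => ?_) (key.trans (lintegral_congr_ae ?_))
  · by_cases hZ : ∀ u, D u → Z ω u = z u
    · have e : ∏ u, ∏ k : Fin m, (if D u then (if Z ω u k = z u k then (1 : ℝ≥0∞) else 0) else 1)
          = 1 := by
        refine Finset.prod_eq_one fun u _ => Finset.prod_eq_one fun k _ => ?_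
        split_ifs with h1 h2
        · rfl
        · exact absurd (congrFun (hZ u h1) k) h2
        · rfl
      rw [e, mul_one]
      by_cases hs : source P X R ω ∈ A
      · have hmem : ω ∈ {ω | source P X R ω ∈ A ∧ ∀ u, D u → Z ω u = z u} := ⟨hs, hZ⟩
        rw [Set.indicator_of_mem hs, Set.indicator_of_mem hmem]
        rfl
      · rw [Set.indicator_of_notMem hs, Set.indicator_of_notMem fun h => hs h.1]
    · rw [Set.indicator_of_notMem fun h => hZ h.2]
      push Not at hZ
      obtain ⟨u, hu, hne⟩ := hZ
      obtain ⟨k, hk⟩ := Function.ne_iff.1 hne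
      rw [Finset.prod_eq_zero (Finset.mem_univ u), mul_zero]
      refine Finset.prod_eq_zero (Finset.mem_univ k) ?_
      rw [if_pos hu, if_neg hk]
  · filter_upwards [hO.ae_noise_mem] with ω hω
    congr 1
    refine Finset.prod_congr rfl fun u _ => Finset.prod_congr rfl fun k _ => ?_
    split_ifs with h
    · simp
    · simp only [mul_one]
      exact sum_channel hr (hω u).1 ((hω u).2.trans ha1) _

lemma IsAssociationGraph.indepFun_group {G : SimpleGraph ℕ} (hG : IsAssociationGraph G μ P X)
    (hM : IsMarkovModel μ f P X) {C : Finset ℕ}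
    (hC : ∀ u, u ∈ C ↔ u ∈ (G.connectedComponentMk 0).supp) (n : ℕ) :
    IndepFun (fun ω (i : C) => (P i ω, X i ω))
      (fun ω (j : {j : Fin n // (j : ℕ) ∉ C}) => (P j ω, X j ω)) μ := by
  classical
  set S : Finset G.ConnectedComponent := {G.connectedComponentMk 0} with hS
  set T : Finset G.ConnectedComponent :=
    Finset.univ.image fun j : {j : Fin n // (j : ℕ) ∉ C} => G.connectedComponentMk j with hT
  have hdisj : Disjoint S T := by
    rw [Finset.disjoint_singleton_left, hT, Finset.mem_image]
    rintro ⟨j, -, hj⟩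
    exact j.2 ((hC _).2 hj)
  have hm : ∀ K : G.ConnectedComponent, Measurable fun (ω : Ω) (u : K.supp) => (P u ω, X u ω) :=
    fun K => measurable_pi_iff.2 fun u => (hM.measurable_param u).prodMk (hM.measurable_trace u)
  have h := hG.indep_groups.indepFun_finset S T hdisj hm
  have h1 : Measurable fun (F : ∀ K : S, K.1.supp → Param E ref × (ℕ → Fin r)) (i : C) =>
      F ⟨G.connectedComponentMk 0, Finset.mem_singleton_self _⟩ ⟨i, (hC i).1 i.2⟩ :=
    measurable_pi_iff.2 fun i => (measurable_pi_apply _).comp (measurable_pi_apply _)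
  have h2 : Measurable fun (F : ∀ K : T, K.1.supp → Param E ref × (ℕ → Fin r))
      (j : {j : Fin n // (j : ℕ) ∉ C}) =>
      F ⟨G.connectedComponentMk j, Finset.mem_image_of_mem _ (Finset.mem_univ j)⟩ ⟨j, rfl⟩ :=
    measurable_pi_iff.2 fun j => (measurable_pi_apply _).comp (measurable_pi_apply _)
  exact h.comp h1 h2

lemma IsAssociationGraph.indepFun_pair {G : SimpleGraph ℕ} (hG : IsAssociationGraph G μ P X)
    (hM : IsMarkovModel μ f P X) {C : Finset ℕ}
    (hC : ∀ u, u ∈ C ↔ u ∈ (G.connectedComponentMk 0).supp) {u w : ℕ} (hu : u ∈ C) (hw : w ∉ C) :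
    IndepFun (fun ω => (P u ω, X u ω)) (X w) μ := by
  have h := hG.indepFun_group hM hC (w + 1)
  have h1 : Measurable fun (F : C → Param E ref × (ℕ → Fin r)) => F ⟨u, hu⟩ :=
    measurable_pi_apply _
  have h2 : Measurable fun (F : {j : Fin (w + 1) // (j : ℕ) ∉ C} → Param E ref × (ℕ → Fin r)) =>
      (F ⟨⟨w, Nat.lt_succ_self w⟩, hw⟩).2 :=
    measurable_snd.comp (measurable_pi_apply _)
  exact h.comp h1 h2

lemma IsMarkovModel.measure_closedBall_le (hM : IsMarkovModel μ f P X) {δ : ℝ}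
    (hf : ∀ x, f x ≤ δ) (u : ℕ) (q : Param E ref) {η : ℝ} (hη : 0 ≤ η) :
    μ {ω | dist (P u ω) q ≤ η}
      ≤ ENNReal.ofReal δ * ENNReal.ofReal ((2 * η) ^ Fintype.card (FreeEdge E ref)) := by
  have e : {ω | dist (P u ω) q ≤ η} = P u ⁻¹' Metric.closedBall q η := rfl
  rw [e, ← Measure.map_apply (hM.measurable_param u) Metric.isClosed_closedBall.measurableSet,
    hM.law_param u, withDensity_apply _ Metric.isClosed_closedBall.measurableSet]
  calc _ ≤ ∫⁻ _x in Metric.closedBall q η, ENNReal.ofReal δ :=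
        lintegral_mono fun x => ENNReal.ofReal_le_ofReal (hf x)
    _ = _ := by rw [setLIntegral_const, Real.volume_pi_closedBall _ hη]

lemma IsMarkovModel.measure_forall_closedBall_le (hM : IsMarkovModel μ f P X) {δ : ℝ}
    (hf : ∀ x, f x ≤ δ) (C : Finset ℕ) (q : C → Param E ref) {η : ℝ} (hη : 0 ≤ η) :
    μ {ω | ∀ i : C, dist (P i ω) (q i) ≤ η}
      ≤ (ENNReal.ofReal δ * ENNReal.ofReal ((2 * η) ^ Fintype.card (FreeEdge E ref))) ^ C.card := by
  have hind : iIndepFun (fun (i : C) => P i) μ := hM.indep_param.precomp Subtype.val_injective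
  have h := hind.measure_inter_preimage_eq_mul Finset.univ
    (sets := fun i => Metric.closedBall (q i) η)
    (fun i _ => Metric.isClosed_closedBall.measurableSet)
  have e : {ω | ∀ i : C, dist (P i ω) (q i) ≤ η}
      = ⋂ i ∈ (Finset.univ : Finset C), P i ⁻¹' Metric.closedBall (q i) η := by
    ext ω; simp [Metric.mem_closedBall]
  rw [e, h]
  calc _ ≤ ∏ _i : C, ENNReal.ofReal δ * ENNReal.ofReal ((2 * η) ^ Fintype.card (FreeEdge E ref)) :=
        Finset.prod_le_prod' fun i _ => hM.measure_closedBall_le hf i (q i) hη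
    _ = _ := by rw [Finset.prod_const, Finset.card_univ, Fintype.card_coe]

/-- It is unlikely that a tuple of users outside of the group `C` looks like a group and has
parameters close to those of `C`. -/
lemma measure_exists_competitor_le {G : SimpleGraph ℕ} (hG : IsAssociationGraph G μ P X)
    (hM : IsMarkovModel μ f P X) (hO : IsObfuscation μ P X a R Z) {C : Finset ℕ}
    (hC : ∀ u, u ∈ C ↔ u ∈ (G.connectedComponentMk 0).supp) (hr : 2 ≤ r) (ha1 : a ≤ 1)
    {δ : ℝ} (hf : ∀ x, f x ≤ δ) {η : ℝ} (hη : 0 ≤ η) (τ : ℝ) {i₀ : C}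
    (hconn : ∀ i : C, Relation.ReflTransGen (fun i j : C => G.Adj i j) i₀ i) :
    μ {ω | ∃ w : C → {j : Fin n // (j : ℕ) ∉ C}, LooksLikeGroup (fun i j : C => G.Adj i j)
        (fun j j' : {j : Fin n // (j : ℕ) ∉ C} =>
          LooksDependent (extendPath (Z ω j)) (extendPath (Z ω j')) m τ) w ∧
        ∀ i : C, dist (P i ω) (P (w i) ω) ≤ η}
      ≤ (n * C.card ^ C.card : ℕ) * (ENNReal.ofReal δ *
        ENNReal.ofReal ((2 * η) ^ Fintype.card (FreeEdge E ref))) ^ C.card := by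
  classical
  set κ := {j : Fin n // (j : ℕ) ∉ C} with hκ
  set b := (ENNReal.ofReal δ *
        ENNReal.ofReal ((2 * η) ^ Fintype.card (FreeEdge E ref))) ^ C.card with hb
  set LG : (κ → Fin m → Fin r) → (C → κ) → Prop := fun ζ w =>
    LooksLikeGroup (fun i j : C => G.Adj i j)
      (fun j j' : κ => LooksDependent (extendPath (ζ j)) (extendPath (ζ j')) m τ) w with hLG
  set ZD : Ω → κ → Fin m → Fin r := fun ω j => Z ω j with hZD
  have hZDm : Measurable ZD := measurable_pi_iff.2 fun j =>
    (measurable_pi_apply (j : Fin n)).comp hO.measurable_obfuscated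
  set Y : Ω → C → Param E ref := fun ω i => P i ω with hY
  set U : Ω → κ → Param E ref × (ℕ → Fin r) := fun ω j => (P j ω, X j ω) with hU
  set V : Ω → Fin n → ℝ := fun ω u => R u ω with hV
  have hYm : Measurable Y := measurable_pi_iff.2 fun i => hM.measurable_param i
  have hUm : Measurable U := measurable_pi_iff.2 fun j =>
    (hM.measurable_param j).prodMk (hM.measurable_trace j)
  have hVm : Measurable V := measurable_pi_iff.2 hO.measurable_noise
  have hYU : IndepFun Y U μ := by
    have h1 : Measurable fun (F : C → Param E ref × (ℕ → Fin r)) i => (F i).1 :=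
      measurable_pi_iff.2 fun i => measurable_fst.comp (measurable_pi_apply i)
    exact (hG.indepFun_group hM hC n).comp h1 measurable_id
  have hYUV : IndepFun (fun ω => (Y ω, U ω)) V μ := by
    have h1 : Measurable fun (t : (ℕ → Param E ref) × (ℕ → ℕ → Fin r)) =>
        ((fun i : C => t.1 i), fun j : κ => (t.1 j, t.2 j)) :=
      (measurable_pi_iff.2 fun i => (measurable_pi_apply _).comp measurable_fst).prodMk
        (measurable_pi_iff.2 fun j => ((measurable_pi_apply _).comp measurable_fst).prodMk
          ((measurable_pi_apply _).comp measurable_snd))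
    exact (hO.noise_indep_data.comp measurable_id h1).symm
  have hind := indepFun_prodMk_right hYm hUm hVm hYU hYUV
  have hone : ∀ (ζ : κ → Fin m → Fin r) (w : C → κ),
      μ {ω | (∀ i : C, dist (P i ω) (P (w i) ω) ≤ η) ∧ ZD ω = ζ} ≤ b * μ (ZD ⁻¹' {ζ}) := by
    intro ζ w
    set z : Fin n → Fin m → Fin r := fun u => if h : (u : ℕ) ∉ C then ζ ⟨u, h⟩ else fun _ => 0
      with hz
    have hZz : ∀ ω, (∀ u : Fin n, (u : ℕ) ∉ C → Z ω u = z u) ↔ ZD ω = ζ := by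
      intro ω
      constructor
      · intro h
        funext j
        have := h j j.2
        simpa [hz, j.2] using this
      · rintro rfl u hu
        simp [hz, hu, hZD]
    set A : Set (((ℕ → Param E ref) × (ℕ → ℕ → Fin r)) × (Fin n → ℝ)) :=
      {t | ∀ i : C, dist (t.1.1 i) (t.1.1 (w i)) ≤ η} with hA
    have hAm : MeasurableSet A := by
      have : A = ⋂ i : C, {t | dist (t.1.1 i) (t.1.1 (w i)) ≤ η} := by ext; simp [hA]
      rw [this]
      refine MeasurableSet.iInter fun i => measurableSet_le (Measurable.dist ?_ ?_) measurable_const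
      · exact (measurable_pi_apply _).comp (measurable_fst.comp measurable_fst)
      · exact (measurable_pi_apply _).comp (measurable_fst.comp measurable_fst)
    set A' : Set ((C → Param E ref) × ((κ → Param E ref × (ℕ → Fin r)) × (Fin n → ℝ))) :=
      {q | ∀ i : C, dist (q.1 i) (q.2.1 (w i)).1 ≤ η} with hA'
    have hAm' : MeasurableSet A' := by
      have : A' = ⋂ i : C, {q | dist (q.1 i) (q.2.1 (w i)).1 ≤ η} := by ext; simp [hA']
      rw [this]
      refine MeasurableSet.iInter fun i => measurableSet_le (Measurable.dist ?_ ?_) measurable_const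
      · exact (measurable_pi_apply _).comp measurable_fst
      · exact measurable_fst.comp
          ((measurable_pi_apply _).comp (measurable_fst.comp measurable_snd))
    set ψ : (κ → Param E ref × (ℕ → Fin r)) × (Fin n → ℝ) → ℝ≥0∞ := fun q =>
      ∏ u : Fin n, ∏ k : Fin m, (if h : (u : ℕ) ∉ C then
        ENNReal.ofReal (channel r (q.2 u) ((q.1 ⟨u, h⟩).2 k) (z u k)) else 1) with hψ
    have hψm : Measurable ψ := by
      refine Finset.measurable_prod _ fun u _ => Finset.measurable_prod _ fun k _ => ?_
      by_cases h : (u : ℕ) ∉ C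
      · simp only [dif_pos h]
        refine Measurable.ennreal_ofReal ?_
        have hR : Measurable fun q : (κ → Param E ref × (ℕ → Fin r)) × (Fin n → ℝ) => q.2 u :=
          (measurable_pi_apply u).comp measurable_snd
        have hX : Measurable fun q : (κ → Param E ref × (ℕ → Fin r)) × (Fin n → ℝ) =>
            (q.1 ⟨u, h⟩).2 k :=
          (measurable_pi_apply (k : ℕ)).comp
            (measurable_snd.comp ((measurable_pi_apply _).comp measurable_fst))
        unfold channel
        exact Measurable.ite (measurableSet_eq_fun measurable_const hX)
          (measurable_const.sub hR) (hR.div_const _)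
      · simp only [dif_neg h]
        exact measurable_const
    have hψe : ∀ ω, ∏ u : Fin n, ∏ k : Fin m, (if (u : ℕ) ∉ C then
          ENNReal.ofReal (channel r (R u ω) (X u ω k) (z u k)) else 1) = ψ (U ω, V ω) := by
      intro ω
      refine Finset.prod_congr rfl fun u _ => Finset.prod_congr rfl fun k _ => ?_
      by_cases h : (u : ℕ) ∉ C
      · rw [if_pos h, dif_pos h]
      · rw [if_neg h, dif_neg h]
    have h1 := hO.measure_inter hM hr ha1 (fun u => (u : ℕ) ∉ C) z hAm
    have h2 := hO.measure_inter hM hr ha1 (fun u => (u : ℕ) ∉ C) z MeasurableSet.univ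
    have h3 := lintegral_indicator_mul_le_of_indepFun hYm (hUm.prodMk hVm) hind hAm' (b := b)
      (fun v => hM.measure_forall_closedBall_le hf C (fun i => (v.1 (w i)).1) hη) hψm
    simp only [hZz, hψe, Set.mem_univ, true_and, Set.indicator_univ, Pi.one_apply, one_mul]
      at h1 h2
    have e1 : {ω | (∀ i : C, dist (P i ω) (P (w i) ω) ≤ η) ∧ ZD ω = ζ}
        = {ω | source P X R ω ∈ A ∧ ZD ω = ζ} := rfl
    have e2 : ZD ⁻¹' {ζ} = {ω | ZD ω = ζ} := rfl
    rw [e1, e2, h1, h2]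
    exact h3
  have hsub : {ω | ∃ w : C → κ, LG (ZD ω) w ∧ ∀ i : C, dist (P i ω) (P (w i) ω) ≤ η} ⊆
      ⋃ ζ ∈ (Finset.univ : Finset (κ → Fin m → Fin r)),
        ⋃ w ∈ Finset.univ.filter (LG ζ),
          {ω | (∀ i : C, dist (P i ω) (P (w i) ω) ≤ η) ∧ ZD ω = ζ} := by
    rintro ω ⟨w, hw, hd⟩
    simp only [Set.mem_iUnion]
    exact ⟨ZD ω, Finset.mem_univ _, w, by simpa using hw, hd, rfl⟩
  have hcard : ∀ ζ, ((Finset.univ.filter (LG ζ)).card : ℝ≥0∞)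
      ≤ (n * C.card ^ C.card : ℕ) := by
    intro ζ
    have h := ncard_looksLikeGroup_le (κ := κ)
      (D := fun j j' : κ => LooksDependent (extendPath (ζ j)) (extendPath (ζ j')) m τ) hconn
    have e : {w : C → κ | LG ζ w}.ncard = (Finset.univ.filter (LG ζ)).card := by
      rw [← Set.ncard_coe_finset]
      congr 1
      ext w; simp
    have h' : (Finset.univ.filter (LG ζ)).card ≤ Fintype.card κ * C.card ^ C.card := by
      rw [← e, ← Fintype.card_coe C]; exact h
    have hκn : Fintype.card κ ≤ n :=
      (Fintype.card_subtype_le _).trans_eq (Fintype.card_fin n)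
    exact_mod_cast h'.trans (Nat.mul_le_mul_right _ hκn)
  calc _ ≤ _ := measure_mono hsub
    _ ≤ ∑ ζ, μ (⋃ w ∈ Finset.univ.filter (LG ζ),
          {ω | (∀ i : C, dist (P i ω) (P (w i) ω) ≤ η) ∧ ZD ω = ζ}) := measure_biUnion_finset_le _ _
    _ ≤ ∑ ζ, ∑ w ∈ Finset.univ.filter (LG ζ),
          μ {ω | (∀ i : C, dist (P i ω) (P (w i) ω) ≤ η) ∧ ZD ω = ζ} :=
        Finset.sum_le_sum fun ζ _ => measure_biUnion_finset_le _ _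
    _ ≤ ∑ ζ, ∑ _w ∈ Finset.univ.filter (LG ζ), b * μ (ZD ⁻¹' {ζ}) :=
        Finset.sum_le_sum fun ζ _ => Finset.sum_le_sum fun w _ => hone ζ w
    _ ≤ ∑ ζ, (n * C.card ^ C.card : ℕ) * (b * μ (ZD ⁻¹' {ζ})) := by
        refine Finset.sum_le_sum fun ζ _ => ?_
        rw [Finset.sum_const, nsmul_eq_mul]
        exact mul_le_mul_left (hcard ζ) _
    _ = (n * C.card ^ C.card : ℕ) * b := by
        rw [← Finset.mul_sum, ← Finset.mul_sum, sum_measure_preimage_singleton _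
          fun ζ _ => hZDm (measurableSet_singleton ζ)]
        simp

end Competitors

/-! ### The adversary's algorithm -/

section Algorithm

variable {r : ℕ} [NeZero r] {E : Finset (Fin r × Fin r)} {ref : Fin r → Fin r}

/-- The adversary accepts a tuple `v` of observed paths as the data of the group `C` if it looks
like a group, if its members visit all states sufficiently often, and if their transitions fit
the parameters of the members of `C`. -/
def Accepts (G : SimpleGraph ℕ) (C : Finset ℕ) (E : Finset (Fin r × Fin r)) (ref : Fin r → Fin r)
    (ε τ : ℝ) {n m : ℕ} (p : Fin n → Param E ref) (Y : Fin n → Fin m → Fin r) (v : C → Fin n) :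
    Prop :=
  LooksLikeGroup (fun i j : C => G.Adj i j)
    (fun j j' : Fin n => LooksDependent (extendPath (Y j)) (extendPath (Y j')) m τ) v ∧
  ∀ (i : C) (h : (i : ℕ) < n) (x : Fin r), τ * m ≤ freq (extendPath (Y (v i))) m x ∧
    ∀ x', |transitionSum (window m) (transition E ref (p ⟨i, h⟩) x x') (extendPath (Y (v i))) m x x'|
      ≤ 3 * ε * m

/-- The data point at time `k` of the path that is assigned to user `0` by some tuple in `S`. -/
def readOff {C : Finset ℕ} (h0 : 0 ∈ C) {n m : ℕ} (k : ℕ)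
    (q : Set (C → Fin n) × (Fin n → Fin m → Fin r)) : Fin r :=
  open Classical in
  if h : q.1.Nonempty ∧ k < m then q.2 (h.1.some ⟨0, h0⟩) ⟨k, h.2⟩ else 0

lemma measurableSet_accepts (G : SimpleGraph ℕ) (C : Finset ℕ) (ε τ : ℝ) {n m : ℕ}
    (v : C → Fin n) : MeasurableSet
      {q : (Fin n → Param E ref) × (Fin n → Fin m → Fin r) | Accepts G C E ref ε τ q.1 q.2 v} := by
  have hext : ∀ j : Fin n, Measurable fun q : (Fin n → Param E ref) × (Fin n → Fin m → Fin r) =>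
      extendPath (q.2 j) := fun j =>
    (measurable_of_finite (fun Y : Fin n → Fin m → Fin r => extendPath (Y j))).comp measurable_snd
  refine MeasurableSet.inter ?_ ?_
  · exact measurable_snd (MeasurableSet.of_discrete (s := {Y : Fin n → Fin m → Fin r |
      LooksLikeGroup (fun i j : C => G.Adj i j)
        (fun j j' : Fin n => LooksDependent (extendPath (Y j)) (extendPath (Y j')) m τ) v}))
  · have e : {q : (Fin n → Param E ref) × (Fin n → Fin m → Fin r) |
        ∀ (i : C) (h : (i : ℕ) < n) (x : Fin r), τ * m ≤ freq (extendPath (q.2 (v i))) m x ∧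
          ∀ x', |transitionSum (window m) (transition E ref (q.1 ⟨i, h⟩) x x')
            (extendPath (q.2 (v i))) m x x'| ≤ 3 * ε * m}
        = ⋂ (i : C) (h : (i : ℕ) < n) (x : Fin r),
          {q | τ * m ≤ freq (extendPath (q.2 (v i))) m x} ∩ ⋂ x',
          {q | |transitionSum (window m) (transition E ref (q.1 ⟨i, h⟩) x x')
            (extendPath (q.2 (v i))) m x x'| ≤ 3 * ε * m} := by
      ext q; simp
    change MeasurableSet {q : (Fin n → Param E ref) × (Fin n → Fin m → Fin r) |
        ∀ (i : C) (h : (i : ℕ) < n) (x : Fin r), τ * m ≤ freq (extendPath (q.2 (v i))) m x ∧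
          ∀ x', |transitionSum (window m) (transition E ref (q.1 ⟨i, h⟩) x x')
            (extendPath (q.2 (v i))) m x x'| ≤ 3 * ε * m}
    rw [e]
    refine MeasurableSet.iInter fun i => MeasurableSet.iInter fun h =>
      MeasurableSet.iInter fun x => MeasurableSet.inter ?_ (MeasurableSet.iInter fun x' => ?_)
    · exact measurable_snd (MeasurableSet.of_discrete (s := {Y : Fin n → Fin m → Fin r |
        τ * m ≤ freq (extendPath (Y (v i))) m x}))
    · refine measurableSet_le (Measurable.abs ?_) measurable_const
      have hq : Measurable fun q : (Fin n → Param E ref) × (Fin n → Fin m → Fin r) =>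
          transition E ref (q.1 ⟨i, h⟩) x x' :=
        (measurable_transition x x').comp ((measurable_pi_apply _).comp measurable_fst)
      have hB : ∀ k, Measurable fun _ : (Fin n → Param E ref) × (Fin n → Fin m → Fin r) =>
          window m k := fun k => measurable_const
      exact measurable_transitionSum_comp hB hq (hext (v i)) m x x'

/-- The adversary's estimator of the data point of user `0` at time `k`. -/
def groupEstimator (G : SimpleGraph ℕ) {C : Finset ℕ} (h0 : 0 ∈ C) (E : Finset (Fin r × Fin r))
    (ref : Fin r → Fin r) (ε τ : ℝ) (n m k : ℕ) : Estimator E ref n m :=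
  ⟨fun q => readOff h0 k ({v | Accepts G C E ref ε τ q.1 q.2 v}, q.2), by
    refine (measurable_of_finite (readOff h0 k)).comp (Measurable.prodMk ?_ measurable_snd)
    exact measurable_set_iff.2 fun v => measurableSet_setOfPred.1 (measurableSet_accepts G C ε τ v)⟩

/-- The properties of parameters, data and obfuscated data under which the algorithm succeeds. -/
structure IsTypical (G : SimpleGraph ℕ) (C : Finset ℕ) (ε τ η : ℝ) {n m : ℕ}
    (p : ℕ → Param E ref) (X : ℕ → ℕ → Fin r) (z : Fin n → Fin m → Fin r) : Prop where
  admissible : ∀ u, p u ∈ admissible E ref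
  fits : ∀ (u : Fin n) (x x' : Fin r),
    |transitionSum (window m) (transition E ref (p u) x x') (X u) m x x'| ≤ ε * m
  unchanged : ∀ u : Fin n, hammingCount (extendPath (z u)) (X u) m ≤ ε * m
  separated : ∀ u ∈ C, u ≠ 0 → η < dist (p 0) (p u)
  no_competitor : ∀ w : C → {j : Fin n // (j : ℕ) ∉ C},
    LooksLikeGroup (fun i j : C => G.Adj i j)
      (fun j j' : {j : Fin n // (j : ℕ) ∉ C} =>
        LooksDependent (extendPath (z j)) (extendPath (z j')) m τ) w →
    ¬ ∀ i : C, dist (p i) (p (w i)) ≤ η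
  linked : ∀ i j : C, G.Adj i j → ∃ x y, 2 * τ * m ^ 2 < |empCov (X i) (X j) m x y|
  isolated : ∀ (u : C) (w : Fin n), (w : ℕ) ∉ C → ∀ x y, |empCov (X u) (X w) m x y| ≤ τ / 2 * m ^ 2
  visits : ∀ (u : C) (x : Fin r), 2 * τ * m ≤ freq (X u) m x

variable {G : SimpleGraph ℕ} {C : Finset ℕ} {ε τ η : ℝ} {n m : ℕ} {p : ℕ → Param E ref}
  {X : ℕ → ℕ → Fin r} {z : Fin n → Fin m → Fin r}

lemma IsTypical.accepts (h : IsTypical G C ε τ η p X z) (href : ∀ i, (i, ref i) ∈ E)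
    (hCn : ∀ u ∈ C, u < n) (hε : 8 * ε ≤ τ) (hτ : 0 ≤ τ) (σ : Equiv.Perm (Fin n)) :
    Accepts G C E ref ε τ (fun w : Fin n => p w) (fun v => z (σ.symm v))
      (fun i : C => σ ⟨i, hCn i i.2⟩) := by
  have hm : (0 : ℝ) ≤ (m : ℝ) := Nat.cast_nonneg m
  have hm2 : (0 : ℝ) ≤ (m : ℝ) ^ 2 := sq_nonneg _
  refine ⟨⟨fun i j hij => ?_, fun i b hib => ?_⟩, fun i hi x => ⟨?_, fun x' => ?_⟩⟩
  · obtain ⟨x, y, hxy⟩ := h.linked i j hij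
    refine ⟨x, y, ?_⟩
    simp only [Equiv.symm_apply_apply]
    have h1 := abs_empCov_sub_le (h.unchanged ⟨i, hCn i i.2⟩) (h.unchanged ⟨j, hCn j j.2⟩) x y
    have h2 := abs_sub_abs_le_abs_sub (empCov (X i) (X j) m x y)
      (empCov (extendPath (z ⟨i, hCn i i.2⟩)) (extendPath (z ⟨j, hCn j j.2⟩)) m x y)
    rw [abs_sub_comm] at h2
    simp only at h1
    nlinarith
  · by_contra hb
    have hw : ((σ.symm b : Fin n) : ℕ) ∉ C := by
      intro hw
      refine hb ⟨⟨_, hw⟩, ?_⟩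
      simp
    obtain ⟨x, y, hxy⟩ := hib
    simp only [Equiv.symm_apply_apply] at hxy
    have h1 := abs_empCov_sub_le (h.unchanged ⟨i, hCn i i.2⟩) (h.unchanged (σ.symm b)) x y
    have h2 := abs_sub_abs_le_abs_sub
      (empCov (extendPath (z ⟨i, hCn i i.2⟩)) (extendPath (z (σ.symm b))) m x y)
      (empCov (X i) (X (σ.symm b)) m x y)
    have h3 := h.isolated i (σ.symm b) hw x y
    simp only at h1
    nlinarith
  · simp only [Equiv.symm_apply_apply]
    have h1 := (abs_freq_sub_le (extendPath (z ⟨i, hCn i i.2⟩)) (X i) m x).trans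
      (h.unchanged ⟨i, hCn i i.2⟩)
    have h2 := h.visits i x
    have h3 := (abs_le.1 h1).1
    nlinarith
  · simp only [Equiv.symm_apply_apply]
    have h1 := abs_transitionSum_sub_le (transition_nonneg (h.admissible i) x x')
      (transition_le_one href (h.admissible i) x x') (extendPath (z ⟨i, hCn i i.2⟩)) (X i) m x x'
    have h2 := h.unchanged ⟨i, hCn i i.2⟩
    have h3 := h.fits ⟨i, hCn i i.2⟩ x x'
    have h4 := abs_sub_abs_le_abs_sub
      (transitionSum (window m) (transition E ref (p i) x x') (extendPath (z ⟨i, hCn i i.2⟩)) m x x')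
      (transitionSum (window m) (transition E ref (p i) x x') (X i) m x x')
    simp only at h2 h3
    linarith

lemma IsTypical.dist_le (h : IsTypical G C ε τ η p X z) (href : ∀ i, (i, ref i) ∈ E)
    (hτm : ε * m + 1 ≤ τ * m / 2) (hpos : 0 < τ * m) (hη : 12 * ε / τ ≤ η) {i : ℕ}
    {u : Fin n} (hfreq : ∀ x, τ * m ≤ freq (extendPath (z u)) m x)
    (hfit : ∀ x x', |transitionSum (window m) (transition E ref (p i) x x') (extendPath (z u)) m x x'|
      ≤ 3 * ε * m) (hε : 0 ≤ ε) : dist (p i) (p u) ≤ η := by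
  have hm : (0 : ℝ) < m := by
    rcases (Nat.cast_nonneg (α := ℝ) m).eq_or_lt with h0 | h0
    · rw [← h0, mul_zero] at hpos; exact absurd hpos (lt_irrefl _)
    · exact h0
  have hτ : 0 < τ := pos_of_mul_pos_left hpos hm.le
  have hη0 : 0 ≤ 12 * ε / τ := by positivity
  refine (dist_pi_le_iff (hη0.trans hη)).2 fun e => ?_
  set x := e.1.1
  set x' := e.1.2
  have hham := h.unchanged u
  have h1 : |transitionSum (window m) (transition E ref (p i) x x') (X u) m x x'| ≤ 5 * ε * m := by
    have a1 := abs_transitionSum_sub_le (transition_nonneg (h.admissible i) x x')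
      (transition_le_one href (h.admissible i) x x') (extendPath (z u)) (X u) m x x'
    have a2 := hfit x x'
    have a3 := abs_sub_abs_le_abs_sub
      (transitionSum (window m) (transition E ref (p i) x x') (X u) m x x')
      (transitionSum (window m) (transition E ref (p i) x x') (extendPath (z u)) m x x')
    rw [abs_sub_comm] at a3
    linarith
  have h2 := h.fits u x x'
  have h3 : τ * m / 2 ≤ freq (X u) m x - 1 := by
    have b1 := (abs_le.1 ((abs_freq_sub_le (extendPath (z u)) (X u) m x).trans hham)).2
    have b2 := hfreq x
    linarith
  have h4 := abs_sub_le_of_transitionSum (by linarith) h2 h1 h3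
  rw [Real.dist_eq, ← transition_freeEdge (p i) e, ← transition_freeEdge (p u) e]
  refine h4.trans (le_trans (le_of_eq ?_) hη)
  field_simp
  ring

lemma IsTypical.eq_of_accepts (h : IsTypical G C ε τ η p X z) (href : ∀ i, (i, ref i) ∈ E)
    (hCn : ∀ u ∈ C, u < n) (h0 : 0 ∈ C) (hε0 : 0 ≤ ε) (hε : 8 * ε ≤ τ)
    (hτm : ε * m + 1 ≤ τ * m / 2) (hpos : 0 < τ * m) (hη : 12 * ε / τ ≤ η)
    (hconn : ∀ i : C, Relation.ReflTransGen (fun i j : C => G.Adj i j) ⟨0, h0⟩ i)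
    (σ : Equiv.Perm (Fin n)) {v : C → Fin n}
    (hv : Accepts G C E ref ε τ (fun w : Fin n => p w) (fun v => z (σ.symm v)) v) :
    ((σ.symm (v ⟨0, h0⟩) : Fin n) : ℕ) = 0 := by
  have hm2 : (0 : ℝ) ≤ (m : ℝ) ^ 2 := sq_nonneg _
  have hcross : ∀ u w : Fin n, (u : ℕ) ∈ C → (w : ℕ) ∉ C →
      ¬ LooksDependent (extendPath (z u)) (extendPath (z w)) m τ := by
    rintro u w hu hw ⟨x, y, hxy⟩
    have h1 := abs_empCov_sub_le (h.unchanged u) (h.unchanged w) x y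
    have h2 := abs_sub_abs_le_abs_sub (empCov (extendPath (z u)) (extendPath (z w)) m x y)
      (empCov (X u) (X w) m x y)
    have h3 := h.isolated ⟨u, hu⟩ w hw x y
    simp only at h3
    nlinarith
  have hdist : ∀ i : C, dist (p i) (p (σ.symm (v i) : Fin n)) ≤ η := fun i =>
    h.dist_le href hτm hpos hη (fun x => (hv.2 i (hCn i i.2) x).1)
      (fun x x' => (hv.2 i (hCn i i.2) x).2 x') hε0
  have hside : ∀ i : C, ((σ.symm (v i) : Fin n) : ℕ) ∈ C ↔
      ((σ.symm (v ⟨0, h0⟩) : Fin n) : ℕ) ∈ C := by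
    intro i
    induction hconn i with
    | refl => exact Iff.rfl
    | @tail b c _ hbc ih =>
      rw [← ih]
      constructor
      · intro hc
        by_contra hb
        exact hcross _ _ hc hb (hv.1.1 c b hbc.symm)
      · intro hb
        by_contra hc
        exact hcross _ _ hb hc (hv.1.1 b c hbc)
  by_cases hC0 : ((σ.symm (v ⟨0, h0⟩) : Fin n) : ℕ) ∈ C
  · by_contra hne
    exact absurd (hdist ⟨0, h0⟩) (not_le.2 (h.separated _ hC0 hne))
  · exfalso
    refine h.no_competitor (fun i => ⟨σ.symm (v i), fun hi => hC0 ((hside i).1 hi)⟩)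
      ⟨fun i j hij => hv.1.1 i j hij, fun i b hib => ?_⟩ hdist
    obtain ⟨i', hi'⟩ := hv.1.2 i (σ b.1) (by simpa using hib)
    exact ⟨i', Subtype.ext (by simp [hi'])⟩

/-- On typical samples the estimator reads off a data point of user `0` correctly, unless this
data point has been changed. -/
lemma IsTypical.groupEstimator_eq (h : IsTypical G C ε τ η p X z) (href : ∀ i, (i, ref i) ∈ E)
    (hCn : ∀ u ∈ C, u < n) (h0 : 0 ∈ C) (hε0 : 0 ≤ ε) (hε : 8 * ε ≤ τ)
    (hτm : ε * m + 1 ≤ τ * m / 2) (hpos : 0 < τ * m) (hη : 12 * ε / τ ≤ η)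
    (hconn : ∀ i : C, Relation.ReflTransGen (fun i j : C => G.Adj i j) ⟨0, h0⟩ i)
    (σ : Equiv.Perm (Fin n)) {k : ℕ} (hk : k < m) :
    (groupEstimator G h0 E ref ε τ n m k).1 (fun w : Fin n => p w, fun v => z (σ.symm v))
      = z ⟨0, hCn 0 h0⟩ ⟨k, hk⟩ := by
  have hτ : 0 ≤ τ := by linarith
  have hne : {v : C → Fin n | Accepts G C E ref ε τ (fun w : Fin n => p w)
      (fun v => z (σ.symm v)) v}.Nonempty := ⟨_, h.accepts href hCn hε hτ σ⟩
  have hcond : {v : C → Fin n | Accepts G C E ref ε τ (fun w : Fin n => p w)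
      (fun v => z (σ.symm v)) v}.Nonempty ∧ k < m := ⟨hne, hk⟩
  change readOff h0 k ({v : C → Fin n | Accepts G C E ref ε τ (fun w : Fin n => p w)
      (fun v => z (σ.symm v)) v}, fun v => z (σ.symm v)) = _
  rw [readOff, dif_pos hcond]
  have h1 := h.eq_of_accepts href hCn h0 hε0 hε hτm hpos hη hconn σ hcond.1.some_mem
  have h2 : σ.symm (hcond.1.some ⟨0, h0⟩) = ⟨0, hCn 0 h0⟩ := Fin.ext h1
  change z (σ.symm (hcond.1.some ⟨0, h0⟩)) ⟨k, hk⟩ = _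
  rw [h2]

end Algorithm

/-! ### Mixing on the scale of the lag -/

section Mixing

variable {r : ℕ} {E : Finset (Fin r × Fin r)} {ref : Fin r → Fin r}
  {Ω : Type*} [MeasurableSpace Ω] {μ : Measure Ω} [IsProbabilityMeasure μ]
  {f : Param E ref → ℝ} {P : ℕ → Ω → Param E ref} {X : ℕ → Ω → ℕ → Fin r}

/-- After `L` steps the chain is nearly in equilibrium, which gives every state probability of
order at least `1 / L`. -/
def IsMixed (E : Finset (Fin r × Fin r)) (ref : Fin r → Fin r) (L : ℕ) (p : Param E ref) : Prop :=
  ∀ x a b, 3 / (L : ℝ) ≤ (transMatrix E ref p ^ L) a x ∧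
    (transMatrix E ref p ^ L) a x - (transMatrix E ref p ^ L) b x ≤ 1 / (16 * (L : ℝ))

lemma measurableSet_isMixed (L : ℕ) : MeasurableSet {p : Param E ref | IsMixed E ref L p} := by
  have e : {p : Param E ref | IsMixed E ref L p} = ⋂ (x : Fin r) (a : Fin r) (b : Fin r),
      {p | 3 / (L : ℝ) ≤ (transMatrix E ref p ^ L) a x} ∩
      {p | (transMatrix E ref p ^ L) a x - (transMatrix E ref p ^ L) b x ≤ 1 / (16 * (L : ℝ))} := by
    ext p
    simp [IsMixed]
  rw [e]
  exact MeasurableSet.iInter fun x => MeasurableSet.iInter fun a => MeasurableSet.iInter fun b =>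
    (measurableSet_le measurable_const (measurable_transMatrix_pow L a x)).inter
      (measurableSet_le ((measurable_transMatrix_pow L a x).sub (measurable_transMatrix_pow L b x))
        measurable_const)

variable [NeZero r]

lemma eventually_isMixed (hirr : IsIrreducible E) (haper : IsAperiodic E)
    (href : ∀ i, (i, ref i) ∈ E) {p : Param E ref} (hp : p ∈ admissible E ref) :
    ∀ᶠ L in atTop, IsMixed E ref L p := by
  obtain ⟨κ, N, hκ, hκ1, hN, hlow, hosc⟩ := exists_mixing hirr haper href hp
  have h1 : ∀ᶠ L : ℕ in atTop, 3 / (L : ℝ) < κ :=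
    (tendsto_const_div_atTop_nhds_zero_nat 3).eventually_lt_const hκ
  have hq : Tendsto (fun k : ℕ => (16 * N : ℝ) * ((k : ℝ) * (1 - κ) ^ k + (1 - κ) ^ k)) atTop
      (𝓝 0) := by
    have h2 := (tendsto_self_mul_const_pow_of_lt_one (r := 1 - κ) (by linarith) (by linarith)).add
      (tendsto_pow_atTop_nhds_zero_of_lt_one (r := 1 - κ) (by linarith) (by linarith))
    simpa using h2.const_mul (16 * N : ℝ)
  have h3 := (hq.comp (Nat.tendsto_div_const_atTop hN.ne')).eventually_le_const one_pos
  filter_upwards [h1, h3, eventually_ge_atTop N, eventually_gt_atTop 0] with L hL1 hL3 hLN hL0 x a b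
  refine ⟨hL1.le.trans (hlow L hLN a x), (hosc L a b x).trans ?_⟩
  have hL0' : (0 : ℝ) < L := Nat.cast_pos.2 hL0
  rw [le_div_iff₀ (by positivity)]
  refine le_trans ?_ hL3
  have h4 : (L : ℝ) ≤ N * ((L / N : ℕ) + 1) := by
    exact_mod_cast (Nat.lt_mul_div_succ L hN).le
  have h5 : 0 ≤ (1 - κ) ^ (L / N) := pow_nonneg (by linarith) _
  simp only [Function.comp]
  nlinarith [mul_le_mul_of_nonneg_right h4 h5]

lemma tendsto_measure_not_isMixed (hM : IsMarkovModel μ f P X) (hirr : IsIrreducible E)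
    (haper : IsAperiodic E) (href : ∀ i, (i, ref i) ∈ E)
    (hadm : ∀ᵐ ω ∂μ, ∀ u, P u ω ∈ admissible E ref) {L : ℕ → ℕ} (hL : Tendsto L atTop atTop)
    (u : ℕ) : Tendsto (fun n => μ {ω | ¬ IsMixed E ref (L n) (P u ω)}) atTop (𝓝 0) := by
  refine tendsto_measure_of_ae_eventually_notMem
    (fun n => (hM.measurable_param u (measurableSet_isMixed (L n))).compl) ?_
  filter_upwards [hadm] with ω hω
  filter_upwards [hL.eventually (eventually_isMixed hirr haper href (hω u))] with n hn
  exact fun h => h hn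

section Deterministic

variable {p : Param E ref} {L m : ℕ} {ε : ℝ} {y : ℕ → Fin r}

lemma IsMixed.abs_sub_le (h : IsMixed E ref L p) (x a : Fin r) :
    |(transMatrix E ref p ^ L) a x - (transMatrix E ref p ^ L) 0 x| ≤ 1 / (16 * (L : ℝ)) :=
  abs_le.2 ⟨by have := (h x 0 a).2; linarith, (h x a 0).2⟩

lemma lag_error_le (hL : 0 < L) (hLε : (L : ℝ) ^ 2 * ε ≤ 1 / (16 * r ^ 2))
    (hLm : (L : ℝ) ^ 2 / m ≤ 1 / 16) (hm : 0 < m) :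
    L * ((r : ℝ) ^ 2 * (ε * m)) + m * (1 / (16 * (L : ℝ))) + L ≤ 3 / 16 * m / L := by
  have hL' : (0 : ℝ) < L := Nat.cast_pos.2 hL
  have hm' : (0 : ℝ) < m := Nat.cast_pos.2 hm
  have hr' : (0 : ℝ) < r := Nat.cast_pos.2 (NeZero.pos r)
  rw [div_le_iff₀ hm'] at hLm
  rw [le_div_iff₀ (by positivity)] at hLε
  rw [le_div_iff₀ hL']
  have e : (L * ((r : ℝ) ^ 2 * (ε * m)) + m * (1 / (16 * (L : ℝ))) + L) * L
      = (L : ℝ) ^ 2 * ε * (16 * r ^ 2) * m / 16 + m / 16 + L ^ 2 := by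
    field_simp
  rw [e]
  nlinarith

lemma IsMixed.le_freq (h : IsMixed E ref L p) (hp : p ∈ admissible E ref)
    (href : ∀ i, (i, ref i) ∈ E) (hL : 0 < L) (hLε : (L : ℝ) ^ 2 * ε ≤ 1 / (16 * r ^ 2))
    (hLm : (L : ℝ) ^ 2 / m ≤ 1 / 16) (hm : 0 < m)
    (H : ∀ l < L, ∀ x x', |transitionSum (lagWeight (fun _ => 1) L l m) (transition E ref p x x') y m
      x x'| ≤ ε * m) (x : Fin r) : 2 * (1 / (L : ℝ)) * m ≤ freq y m x := by
  have hQ : ∀ l a, |(transMatrix E ref p ^ l) a x| ≤ 1 := fun l a =>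
    abs_le.2 ⟨by linarith [transMatrix_pow_nonneg hp l a x], transMatrix_pow_le_one href hp l a x⟩
  have h1 := abs_freq_sub_const_le hQ (transMatrix_pow_nonneg hp L 0 x)
    (transMatrix_pow_le_one href hp L 0 x) (h.abs_sub_le x) H
  have h2 := (abs_le.1 (h1.trans (lag_error_le hL hLε hLm hm))).1
  have h3 := mul_le_mul_of_nonneg_right (h x 0 0).1 (Nat.cast_nonneg (α := ℝ) m)
  have h4 : 0 ≤ (m : ℝ) / L := by positivity
  have e1 : 3 / 16 * (m : ℝ) / L = 3 / 16 * (m / L) := by ring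
  have e2 : 3 / (L : ℝ) * m = 3 * (m / L) := by ring
  have e3 : 2 * (1 / (L : ℝ)) * m = 2 * (m / L) := by ring
  rw [e1] at h2
  rw [e2] at h3
  rw [e3]
  linarith

lemma IsMixed.abs_empCov_le (h : IsMixed E ref L p) (hp : p ∈ admissible E ref)
    (href : ∀ i, (i, ref i) ∈ E) (hL : 0 < L) (hLε : (L : ℝ) ^ 2 * ε ≤ 1 / (16 * r ^ 2))
    (hLm : (L : ℝ) ^ 2 / m ≤ 1 / 16) (hm : 0 < m)
    (H : ∀ l < L, ∀ x x', |transitionSum (lagWeight (fun _ => 1) L l m) (transition E ref p x x') y m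
      x x'| ≤ ε * m) {y' : ℕ → Fin r} {z : Fin r}
    (H' : ∀ l < L, ∀ x x', |transitionSum (lagWeight (visits y' z) L l m) (transition E ref p x x') y
      m x x'| ≤ ε * m) (x : Fin r) : |empCov y y' m x z| ≤ 1 / (L : ℝ) / 2 * m ^ 2 := by
  have hQ : ∀ l a, |(transMatrix E ref p ^ l) a x| ≤ 1 := fun l a =>
    abs_le.2 ⟨by linarith [transMatrix_pow_nonneg hp l a x], transMatrix_pow_le_one href hp l a x⟩
  have h1 := CorrelatedPrivacy.abs_empCov_le hQ (transMatrix_pow_nonneg hp L 0 x)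
    (transMatrix_pow_le_one href hp L 0 x) (h.abs_sub_le x) H H'
  refine h1.trans ((mul_le_mul_of_nonneg_left (lag_error_le hL hLε hLm hm) (by positivity)).trans ?_)
  have h4 : 0 ≤ (m : ℝ) ^ 2 / L := by positivity
  have e1 : 2 * (m : ℝ) * (3 / 16 * m / L) = 3 / 8 * (m ^ 2 / L) := by ring
  have e2 : 1 / (L : ℝ) / 2 * m ^ 2 = 1 / 2 * (m ^ 2 / L) := by ring
  rw [e1, e2]
  linarith

end Deterministic

end Mixing

/-! ### Typical samples have high probability -/

section Limits

variable {Ω : Type*} [MeasurableSpace Ω] {μ : Measure Ω}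

lemma tendsto_measure_of_eventually_subset {A B : ℕ → Set Ω}
    (hB : Tendsto (fun n => μ (B n)) atTop (𝓝 0)) (h : ∀ᶠ n in atTop, A n ⊆ B n) :
    Tendsto (fun n => μ (A n)) atTop (𝓝 0) :=
  tendsto_of_tendsto_of_tendsto_of_le_of_le' tendsto_const_nhds hB
    (Eventually.of_forall fun _ => zero_le) (h.mono fun _ hn => measure_mono hn)

lemma tendsto_measure_union {A B : ℕ → Set Ω} (hA : Tendsto (fun n => μ (A n)) atTop (𝓝 0))
    (hB : Tendsto (fun n => μ (B n)) atTop (𝓝 0)) :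
    Tendsto (fun n => μ (A n ∪ B n)) atTop (𝓝 0) :=
  tendsto_of_tendsto_of_tendsto_of_le_of_le tendsto_const_nhds (by simpa using hA.add hB)
    (fun _ => zero_le) (fun _ => measure_union_le _ _)

lemma tendsto_measure_exists {ι : Type*} [Finite ι] {A : ι → ℕ → Set Ω}
    (h : ∀ i, Tendsto (fun n => μ (A i n)) atTop (𝓝 0)) :
    Tendsto (fun n => μ {ω | ∃ i, ω ∈ A i n}) atTop (𝓝 0) := by
  have := Fintype.ofFinite ι
  have h1 : Tendsto (fun n => ∑ i, μ (A i n)) atTop (𝓝 0) := by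
    simpa using tendsto_finsetSum Finset.univ fun i _ => h i
  refine tendsto_of_tendsto_of_tendsto_of_le_of_le tendsto_const_nhds h1 (fun _ => zero_le)
    fun n => ?_
  have e : {ω | ∃ i, ω ∈ A i n} = ⋃ i, A i n := by ext; simp
  simp only [e]
  exact measure_iUnion_fintype_le μ fun i => A i n

lemma tendsto_ofReal_zero {g : ℕ → ℝ} (h : Tendsto g atTop (𝓝 0)) :
    Tendsto (fun n => ENNReal.ofReal (g n)) atTop (𝓝 0) := by
  simpa using ENNReal.tendsto_ofReal h

lemma tendsto_natCast_mul_ofReal {N M : ℕ → ℕ} {e : ℕ → ℝ} (he : ∀ n, 0 ≤ e n)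
    (h : Tendsto (fun n => (M n : ℝ) * e n) atTop (𝓝 0)) (K : ℕ)
    (hN : ∀ᶠ n in atTop, N n ≤ K * M n) :
    Tendsto (fun n => (N n : ℝ≥0∞) * ENNReal.ofReal (e n)) atTop (𝓝 0) := by
  have h1 : Tendsto (fun n => ENNReal.ofReal (K * (M n * e n))) atTop (𝓝 0) :=
    tendsto_ofReal_zero (by simpa using h.const_mul (K : ℝ))
  refine tendsto_of_tendsto_of_tendsto_of_le_of_le' tendsto_const_nhds h1
    (Eventually.of_forall fun _ => zero_le) (hN.mono fun n hn => ?_)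
  rw [← ENNReal.ofReal_natCast, ← ENNReal.ofReal_mul (Nat.cast_nonneg _), ← mul_assoc]
  refine ENNReal.ofReal_le_ofReal (mul_le_mul_of_nonneg_right ?_ (he n))
  exact_mod_cast hn

end Limits

/-- Rates for the accuracy `ε` of the empirical transition frequencies and the lag `L`, given the
number of observations `m` and the noise `a`, at which a group of `s` users with `d` parameters each
can be identified. -/
structure AreRates (s d : ℕ) (m L : ℕ → ℕ) (a ε : ℕ → ℝ) : Prop where
  nonneg : ∀ n, 0 ≤ ε n
  lag : Tendsto L atTop atTop
  samples : Tendsto m atTop atTop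
  lag_sq_mul : Tendsto (fun n => (L n : ℝ) ^ 2 * ε n) atTop (𝓝 0)
  lag_sq_div : Tendsto (fun n => (L n : ℝ) ^ 2 / m n) atTop (𝓝 0)
  transitions : Tendsto (fun n => ((n * L n : ℕ) : ℝ) * Real.exp (-(ε n ^ 2 * m n / 4))) atTop (𝓝 0)
  flips : Tendsto (fun n : ℕ => (n : ℝ) * Real.exp (-(ε n * m n / 2))) atTop (𝓝 0)
  noise : ∀ᶠ n in atTop, 4 * a n ≤ ε n
  competitors : Tendsto (fun n : ℕ => (n : ℝ) * ((L n * ε n) ^ d) ^ s) atTop (𝓝 0)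

namespace AreRates

variable {s d : ℕ} {m L : ℕ → ℕ} {a ε : ℕ → ℝ}

lemma eventually_lag_pos (h : AreRates s d m L a ε) : ∀ᶠ n in atTop, 0 < L n :=
  h.lag.eventually_gt_atTop 0

lemma tendsto_lag_mul (h : AreRates s d m L a ε) :
    Tendsto (fun n => (L n : ℝ) * ε n) atTop (𝓝 0) := by
  refine tendsto_of_tendsto_of_tendsto_of_le_of_le' tendsto_const_nhds h.lag_sq_mul
    (Eventually.of_forall fun n => mul_nonneg (Nat.cast_nonneg _) (h.nonneg n))
    (h.eventually_lag_pos.mono fun n hn => mul_le_mul_of_nonneg_right ?_ (h.nonneg n))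
  exact_mod_cast Nat.le_self_pow two_ne_zero (L n)

lemma tendsto_accuracy (h : AreRates s d m L a ε) : Tendsto ε atTop (𝓝 0) := by
  refine tendsto_of_tendsto_of_tendsto_of_le_of_le' tendsto_const_nhds h.tendsto_lag_mul
    (Eventually.of_forall h.nonneg) (h.eventually_lag_pos.mono fun n hn => ?_)
  have : (1 : ℝ) ≤ L n := by exact_mod_cast hn
  nlinarith [h.nonneg n]

lemma tendsto_threshold (h : AreRates s d m L a ε) :
    Tendsto (fun n => 1 / (L n : ℝ)) atTop (𝓝 0) :=
  tendsto_one_div_atTop_nhds_zero_nat.comp h.lag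

end AreRates

section HighProbability

variable {r : ℕ} [NeZero r] {E : Finset (Fin r × Fin r)} {ref : Fin r → Fin r}
  {Ω : Type*} [MeasurableSpace Ω] {μ : Measure Ω} [IsProbabilityMeasure μ]
  {f : Param E ref → ℝ} {P : ℕ → Ω → Param E ref} {X : ℕ → Ω → ℕ → Fin r}
  {m L : ℕ → ℕ} {a ε : ℕ → ℝ} {R : ∀ n : ℕ, Fin n → Ω → ℝ}
  {Z : ∀ n : ℕ, Ω → Fin n → Fin (m n) → Fin r} {G : SimpleGraph ℕ} {C : Finset ℕ} {s d : ℕ}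

lemma IsMarkovModel.measure_dist_le (hM : IsMarkovModel μ f P X) {δ : ℝ}
    (hf : ∀ x, f x ≤ δ) {u v : ℕ} (huv : u ≠ v) {η : ℝ} (hη : 0 ≤ η) :
    μ {ω | dist (P u ω) (P v ω) ≤ η}
      ≤ ENNReal.ofReal δ * ENNReal.ofReal ((2 * η) ^ Fintype.card (FreeEdge E ref)) := by
  have hA : MeasurableSet {q : Param E ref × Param E ref | dist q.1 q.2 ≤ η} :=
    (isClosed_le continuous_dist continuous_const).measurableSet
  have h := lintegral_indicator_mul_le_of_indepFun (hM.measurable_param u) (hM.measurable_param v)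
    (hM.indep_param.indepFun huv) hA (fun v => hM.measure_closedBall_le hf u v hη)
    (ψ := 1) measurable_one
  simp only [Pi.one_apply, mul_one, lintegral_const, measure_univ] at h
  refine le_trans (le_of_eq ?_) h
  have hm : MeasurableSet {ω | dist (P u ω) (P v ω) ≤ η} :=
    ((hM.measurable_param u).prodMk (hM.measurable_param v)) hA
  rw [← lintegral_indicator_one hm]
  rfl

lemma IsMarkovModel.tendsto_measure_not_fits (hM : IsMarkovModel μ f P X)
    (href : ∀ i, (i, ref i) ∈ E) (hadm : ∀ᵐ ω ∂μ, ∀ u, P u ω ∈ admissible E ref)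
    (hR : AreRates s d m L a ε) :
    Tendsto (fun n => μ {ω | ∃ i : Fin n × Fin r × Fin r, ε n * m n < |transitionSum (window (m n))
        (transition E ref (P i.1 ω) i.2.1 i.2.2) (X i.1 ω) (m n) i.2.1 i.2.2|}) atTop (𝓝 0) := by
  have h1 := tendsto_natCast_mul_ofReal (fun n => (Real.exp_pos _).le) hR.transitions (r * r * 2)
    (N := fun n => n * (r * r) * 2) (hR.eventually_lag_pos.mono fun n hn => by
      have := Nat.le_mul_of_pos_right (r * r * 2 * n) hn
      nlinarith)
  refine tendsto_of_tendsto_of_tendsto_of_le_of_le' tendsto_const_nhds h1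
    (Eventually.of_forall fun _ => zero_le) ?_
  filter_upwards [hR.tendsto_accuracy.eventually_le_const one_pos] with n hn
  refine (hM.measure_exists_window href hadm (hR.nonneg n) hn n (m n)).trans (le_of_eq ?_)
  push_cast
  ring

lemma IsMarkovModel.tendsto_measure_lag (hM : IsMarkovModel μ f P X)
    (href : ∀ i, (i, ref i) ∈ E) (hadm : ∀ᵐ ω ∂μ, ∀ u, P u ω ∈ admissible E ref)
    (hR : AreRates s d m L a ε) (u : ℕ) :
    Tendsto (fun n => μ {ω | ∃ i : Fin (L n) × Fin r × Fin r, ε n * m n <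
        |transitionSum (lagWeight (fun _ => 1) (L n) i.1 (m n))
        (transition E ref (P u ω) i.2.1 i.2.2) (X u ω) (m n) i.2.1 i.2.2|}) atTop (𝓝 0) := by
  have h1 := tendsto_natCast_mul_ofReal (fun n => (Real.exp_pos _).le) hR.transitions (r * r * 2)
    (N := fun n => L n * (r * r) * 2) ((eventually_ge_atTop 1).mono fun n hn => by
      have := Nat.le_mul_of_pos_left (L n * (r * r) * 2) hn
      nlinarith)
  refine tendsto_of_tendsto_of_tendsto_of_le_of_le' tendsto_const_nhds h1
    (Eventually.of_forall fun _ => zero_le) ?_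
  filter_upwards [hR.tendsto_accuracy.eventually_le_const one_pos] with n hn
  refine (hM.measure_exists_lag href hadm (hR.nonneg n) hn u (L n) (m n)).trans (le_of_eq ?_)
  push_cast
  ring

lemma IsAssociationGraph.tendsto_measure_lag_visits (hG : IsAssociationGraph G μ P X)
    (hM : IsMarkovModel μ f P X) (href : ∀ i, (i, ref i) ∈ E)
    (hadm : ∀ᵐ ω ∂μ, ∀ u, P u ω ∈ admissible E ref)
    (hC : ∀ u, u ∈ C ↔ u ∈ (G.connectedComponentMk 0).supp)
    (hR : AreRates s d m L a ε) {u : ℕ} (hu : u ∈ C) :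
    Tendsto (fun n => μ {ω | ∃ w : {w : Fin n // (w : ℕ) ∉ C},
        ω ∈ {ω | ∃ i : Fin r × Fin (L n) × Fin r × Fin r, ε n * m n <
          |transitionSum (lagWeight (visits (X w ω) i.1) (L n) i.2.1 (m n))
          (transition E ref (P u ω) i.2.2.1 i.2.2.2) (X u ω) (m n) i.2.2.1 i.2.2.2|}})
      atTop (𝓝 0) := by
  have h1 := tendsto_natCast_mul_ofReal (fun n => (Real.exp_pos _).le) hR.transitions
    (r * r * r * 2) (N := fun n => n * (r * (L n * (r * r))) * 2)
    (Eventually.of_forall fun n => le_of_eq (by ring))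
  refine tendsto_of_tendsto_of_tendsto_of_le_of_le' tendsto_const_nhds h1
    (Eventually.of_forall fun _ => zero_le) ?_
  filter_upwards [hR.tendsto_accuracy.eventually_le_const one_pos] with n hn
  refine (measure_iUnion_fintype_le_card_mul fun w : {w : Fin n // (w : ℕ) ∉ C} =>
    hM.measure_exists_lag_visits href hadm (hR.nonneg n) hn u w (L n) (m n)
      (hG.indepFun_pair hM hC hu w.2)).trans ?_
  have hcard : (Fintype.card {w : Fin n // (w : ℕ) ∉ C} : ℝ≥0∞) ≤ n := by
    exact_mod_cast (Fintype.card_subtype_le _).trans_eq (Fintype.card_fin n)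
  refine (mul_le_mul_left hcard _).trans (le_of_eq ?_)
  push_cast
  ring

lemma tendsto_measure_not_unchanged (hM : IsMarkovModel μ f P X) (hr : 2 ≤ r)
    (hO : ∀ᶠ n in atTop, IsObfuscation μ P X (a n) (R n) (Z n)) (hR : AreRates s d m L a ε) :
    Tendsto (fun n => μ {ω | ∃ u : Fin n,
      ε n * m n < hammingCount (extendPath (Z n ω u)) (X u ω) (m n)}) atTop (𝓝 0) := by
  have h1 := tendsto_natCast_mul_ofReal (M := fun n => n)
    (e := fun n => Real.exp (-(ε n * m n / 2))) (fun n => (Real.exp_pos _).le) hR.flips 1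
    (N := fun n => n) (Eventually.of_forall fun n => by simp)
  refine tendsto_of_tendsto_of_tendsto_of_le_of_le' tendsto_const_nhds h1
    (Eventually.of_forall fun _ => zero_le) ?_
  filter_upwards [hO, hR.noise, hR.tendsto_accuracy.eventually_le_const one_pos] with n hn hn2 hn3
  exact hn.measure_exists_hammingCount hM hr (by linarith) hn2

lemma tendsto_measure_ne (hM : IsMarkovModel μ f P X) (hr : 2 ≤ r)
    (hO : ∀ᶠ n in atTop, IsObfuscation μ P X (a n) (R n) (Z n)) (hR : AreRates s d m L a ε)
    (u k : ℕ) :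
    Tendsto (fun n => μ {ω | ∃ (hu : u < n) (hk : k < m n), Z n ω ⟨u, hu⟩ ⟨k, hk⟩ ≠ X u ω k})
      atTop (𝓝 0) := by
  refine tendsto_of_tendsto_of_tendsto_of_le_of_le' tendsto_const_nhds
    (tendsto_ofReal_zero hR.tendsto_accuracy) (Eventually.of_forall fun _ => zero_le) ?_
  filter_upwards [hO, hR.noise, hR.tendsto_accuracy.eventually_le_const one_pos,
    eventually_gt_atTop u, hR.samples.eventually_gt_atTop k] with n hn hn2 hn3 hu hk
  have hε := hR.nonneg n
  simp only [hu, hk, exists_true_left]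
  exact (hn.measure_ne_le hM hr (by linarith) ⟨u, hu⟩ ⟨k, hk⟩).trans
    (ENNReal.ofReal_le_ofReal (by linarith))

lemma tendsto_measure_not_separated (hM : IsMarkovModel μ f P X)
    {δ : ℝ} (hf : ∀ x, f x ≤ δ) (hd : Fintype.card (FreeEdge E ref) = d) (hd0 : d ≠ 0)
    (hR : AreRates s d m L a ε) {u : ℕ} (hu : u ≠ 0) :
    Tendsto (fun n => μ {ω | dist (P 0 ω) (P u ω) ≤ 12 * (L n * ε n)}) atTop (𝓝 0) := by
  have h1 : Tendsto (fun n => (2 * (12 * (L n * ε n))) ^ d) atTop (𝓝 0) := by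
    have := ((hR.tendsto_lag_mul.const_mul 12).const_mul 2).pow d
    simpa [hd0] using this
  have h2 := ENNReal.Tendsto.const_mul (a := ENNReal.ofReal δ) (tendsto_ofReal_zero h1)
    (Or.inr ENNReal.ofReal_ne_top)
  rw [mul_zero] at h2
  refine tendsto_of_tendsto_of_tendsto_of_le_of_le tendsto_const_nhds h2 (fun _ => zero_le)
    fun n => ?_
  have := hM.measure_dist_le hf hu.symm (η := 12 * (L n * ε n))
    (mul_nonneg (by norm_num) (mul_nonneg (Nat.cast_nonneg _) (hR.nonneg n)))
  rwa [hd] at this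

lemma tendsto_measure_exists_competitor (hG : IsAssociationGraph G μ P X)
    (hM : IsMarkovModel μ f P X) (hr : 2 ≤ r)
    (hO : ∀ᶠ n in atTop, IsObfuscation μ P X (a n) (R n) (Z n))
    (hC : ∀ u, u ∈ C ↔ u ∈ (G.connectedComponentMk 0).supp) {δ : ℝ} (hδ : 0 ≤ δ)
    (hf : ∀ x, f x ≤ δ) (hd : Fintype.card (FreeEdge E ref) = d) (hs : C.card = s)
    (hR : AreRates s d m L a ε) {i₀ : C}
    (hconn : ∀ i : C, Relation.ReflTransGen (fun i j : C => G.Adj i j) i₀ i) :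
    Tendsto (fun n => μ {ω | ∃ w : C → {j : Fin n // (j : ℕ) ∉ C},
        LooksLikeGroup (fun i j : C => G.Adj i j) (fun j j' : {j : Fin n // (j : ℕ) ∉ C} =>
          LooksDependent (extendPath (Z n ω j)) (extendPath (Z n ω j')) (m n) (1 / L n)) w ∧
        ∀ i : C, dist (P i ω) (P (w i) ω) ≤ 12 * (L n * ε n)}) atTop (𝓝 0) := by
  have h1 : Tendsto (fun n : ℕ => (s ^ s * (δ * 24 ^ d) ^ s) * ((n : ℝ) * ((L n * ε n) ^ d) ^ s)) atTop
      (𝓝 0) := by simpa using hR.competitors.const_mul (s ^ s * (δ * 24 ^ d) ^ s)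
  refine tendsto_of_tendsto_of_tendsto_of_le_of_le' tendsto_const_nhds (tendsto_ofReal_zero h1)
    (Eventually.of_forall fun _ => zero_le) ?_
  filter_upwards [hO, hR.noise, hR.tendsto_accuracy.eventually_le_const one_pos] with n hn hn2 hn3
  have hη : 0 ≤ 12 * (L n * ε n) :=
    mul_nonneg (by norm_num) (mul_nonneg (Nat.cast_nonneg _) (hR.nonneg n))
  refine (measure_exists_competitor_le hG hM hn hC hr (by linarith) hf hη (1 / L n) hconn).trans
    (le_of_eq ?_)
  rw [hd, hs, ← ENNReal.ofReal_mul hδ, ← ENNReal.ofReal_pow (by positivity),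
    ← ENNReal.ofReal_natCast, ← ENNReal.ofReal_mul (Nat.cast_nonneg _)]
  congr 1
  push_cast
  rw [show 2 * (12 * ((L n : ℝ) * ε n)) = 24 * (L n * ε n) by ring, mul_pow 24, ← mul_assoc δ,
    mul_pow (δ * 24 ^ d)]
  ring

lemma tendsto_measure_not_linked (hG : IsAssociationGraph G μ P X) (hM : IsMarkovModel μ f P X)
    (hR : AreRates s d m L a ε) :
    Tendsto (fun n => μ {ω | ∃ q : {q : C × C // G.Adj q.1 q.2}, ω ∈ {ω | ∀ x z,
      |empCov (X q.1.1 ω) (X q.1.2 ω) (m n) x z| ≤ 2 * (1 / (L n : ℝ)) * m n ^ 2}}) atTop (𝓝 0) :=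
  tendsto_measure_exists
    (A := fun (q : {q : C × C // G.Adj q.1 q.2}) n => {ω | ∀ x z,
      |empCov (X q.1.1 ω) (X q.1.2 ω) (m n) x z| ≤ 2 * (1 / (L n : ℝ)) * m n ^ 2})
    fun q => hG.tendsto_measure_undetected hM q.2 hR.samples (t := fun n => 2 * (1 / (L n : ℝ)))
      (by simpa using hR.tendsto_threshold.const_mul 2)

end HighProbability

/-! ### The error probability of the algorithm -/

section ErrorProbability

variable {r : ℕ} [NeZero r] {E : Finset (Fin r × Fin r)} {ref : Fin r → Fin r}
  {Ω : Type*} [MeasurableSpace Ω] {μ : Measure Ω} [IsProbabilityMeasure μ]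
  {f : Param E ref → ℝ} {P : ℕ → Ω → Param E ref} {X : ℕ → Ω → ℕ → Fin r}
  {m L : ℕ → ℕ} {a ε : ℕ → ℝ} {R : ∀ n : ℕ, Fin n → Ω → ℝ}
  {Z : ∀ n : ℕ, Ω → Fin n → Fin (m n) → Fin r} {G : SimpleGraph ℕ} {C : Finset ℕ} {s d : ℕ}

lemma tendsto_measure_not_isTypical (hM : IsMarkovModel μ f P X) (hG : IsAssociationGraph G μ P X)
    (hr : 2 ≤ r) (hirr : IsIrreducible E) (haper : IsAperiodic E) (href : ∀ i, (i, ref i) ∈ E)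
    (hadm : ∀ᵐ ω ∂μ, ∀ u, P u ω ∈ admissible E ref)
    (hO : ∀ᶠ n in atTop, IsObfuscation μ P X (a n) (R n) (Z n))
    (hC : ∀ u, u ∈ C ↔ u ∈ (G.connectedComponentMk 0).supp) {δ : ℝ} (hδ : 0 ≤ δ)
    (hf : ∀ x, f x ≤ δ) (hd : Fintype.card (FreeEdge E ref) = d) (hd0 : d ≠ 0) (hs : C.card = s)
    (hR : AreRates s d m L a ε) {i₀ : C}
    (hconn : ∀ i : C, Relation.ReflTransGen (fun i j : C => G.Adj i j) i₀ i) :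
    Tendsto (fun n => μ {ω | ¬ IsTypical G C (ε n) (1 / L n) (12 * (L n * ε n))
      (fun u => P u ω) (fun u => X u ω) (Z n ω)}) atTop (𝓝 0) := by
  have e0 : Tendsto (fun _ : ℕ => μ {ω | ¬ ∀ u, P u ω ∈ admissible E ref}) atTop (𝓝 0) := by
    rw [ae_iff] at hadm
    rw [hadm]
    exact tendsto_const_nhds
  have e1 := hM.tendsto_measure_not_fits href hadm hR
  have e2 := tendsto_measure_not_unchanged hM hr hO hR
  have e3 := tendsto_measure_exists (ι := {u : C // (u : ℕ) ≠ 0})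
    (A := fun u n => {ω | dist (P 0 ω) (P u.1 ω) ≤ 12 * (L n * ε n)})
    fun u => tendsto_measure_not_separated hM hf hd hd0 hR u.2
  have e4 := tendsto_measure_exists_competitor hG hM hr hO hC hδ hf hd hs hR hconn
  have e5 := tendsto_measure_not_linked (C := C) hG hM hR
  have e6 := tendsto_measure_exists (ι := C)
    (A := fun u n => {ω | ¬ IsMixed E ref (L n) (P u ω)})
    fun u => tendsto_measure_not_isMixed hM hirr haper href hadm hR.lag u
  have e7 := tendsto_measure_exists fun u : C => hM.tendsto_measure_lag href hadm hR u
  have e8 := tendsto_measure_exists fun u : C =>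
    hG.tendsto_measure_lag_visits hM href hadm hC hR u.2
  have e := tendsto_measure_union e0 (tendsto_measure_union e1 (tendsto_measure_union e2
    (tendsto_measure_union e3 (tendsto_measure_union e4 (tendsto_measure_union e5
    (tendsto_measure_union e6 (tendsto_measure_union e7 e8)))))))
  refine tendsto_measure_of_eventually_subset e ?_
  have hr' : (0 : ℝ) < r := Nat.cast_pos.2 (NeZero.pos r)
  filter_upwards [hR.eventually_lag_pos, hR.samples.eventually_gt_atTop 0,
    hR.lag_sq_mul.eventually_le_const (show (0 : ℝ) < 1 / (16 * r ^ 2) by positivity),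
    hR.lag_sq_div.eventually_le_const (show (0 : ℝ) < 1 / 16 by norm_num)] with n hL hm hLε hLm
  intro ω hω
  by_contra hn
  simp only [Set.mem_union, not_or, Set.mem_ofPred_eq, not_not] at hn
  obtain ⟨n0, n1, n2, n3, n4, n5, n6, n7, n8⟩ := hn
  push Not at n1 n2 n3 n4 n5 n6 n7 n8
  have hH : ∀ u : C, ∀ l < L n, ∀ x x', |transitionSum (lagWeight (fun _ => 1) (L n) l (m n))
      (transition E ref (P u ω) x x') (X u ω) (m n) x x'| ≤ ε n * m n := fun u l hl x x' =>
    n7 u (⟨l, hl⟩, x, x')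
  refine hω ⟨n0, fun u x x' => n1 (u, x, x'), n2, fun u hu hu0 => n3 ⟨⟨u, hu⟩, hu0⟩,
    fun w hw hall => ?_, fun i j hij => ?_, fun u w hw x y => ?_, fun u x => ?_⟩
  · obtain ⟨i, hi⟩ := n4 w hw
    exact absurd (hall i) (not_le.2 hi)
  · exact n5 ⟨(i, j), hij⟩
  · exact (n6 u).abs_empCov_le (n0 u) href hL hLε hLm hm (hH u)
      (fun l hl x x' => n8 u ⟨w, hw⟩ (y, ⟨l, hl⟩, x, x')) x
  · exact (n6 u).le_freq (n0 u) href hL hLε hLm hm (hH u) x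

/-- The algorithm succeeds with high probability. -/
theorem tendsto_errorProb_groupEstimator (hM : IsMarkovModel μ f P X)
    (hG : IsAssociationGraph G μ P X)
    (hr : 2 ≤ r) (hirr : IsIrreducible E) (haper : IsAperiodic E) (href : ∀ i, (i, ref i) ∈ E)
    (hadm : ∀ᵐ ω ∂μ, ∀ u, P u ω ∈ admissible E ref)
    (hO : ∀ᶠ n in atTop, IsObfuscation μ P X (a n) (R n) (Z n))
    (hC : ∀ u, u ∈ C ↔ u ∈ (G.connectedComponentMk 0).supp) {δ : ℝ} (hδ : 0 ≤ δ)
    (hf : ∀ x, f x ≤ δ) (hd : Fintype.card (FreeEdge E ref) = d) (hd0 : d ≠ 0) (hs : C.card = s)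
    (hR : AreRates s d m L a ε) (h0 : 0 ∈ C)
    (hconn : ∀ i : C, Relation.ReflTransGen (fun i j : C => G.Adj i j) ⟨0, h0⟩ i)
    (Pi : ∀ n : ℕ, Ω → Equiv.Perm (Fin n)) (k : ℕ) :
    Tendsto (fun n => errorProb μ P X (anonymize (Pi n) (Z n)) 0 k
      (groupEstimator G h0 E ref (ε n) (1 / L n) n (m n) k)) atTop (𝓝 0) := by
  refine tendsto_measure_of_eventually_subset (tendsto_measure_union
    (tendsto_measure_not_isTypical hM hG hr hirr haper href hadm hO hC hδ hf hd hd0 hs hR hconn)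
    (tendsto_measure_ne hM hr hO hR 0 k)) ?_
  filter_upwards [hR.eventually_lag_pos, hR.samples.eventually_gt_atTop k,
    hR.samples.eventually_gt_atTop 0,
    hR.lag_sq_mul.eventually_le_const (show (0 : ℝ) < 1 / 8 by positivity),
    hR.lag_sq_div.eventually_le_const (show (0 : ℝ) < 1 / 16 by norm_num),
    eventually_gt_atTop (C.sup id)] with n hL hk hm hLε hLm hCn ω hω
  by_contra hn
  simp only [Set.mem_union, not_or, Set.mem_ofPred_eq, not_not] at hn
  obtain ⟨ht, hz⟩ := hn
  push Not at hz
  have hCn' : ∀ u ∈ C, u < n := fun u hu => (Finset.le_sup (f := id) hu).trans_lt hCn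
  have hL' : (1 : ℝ) ≤ L n := by exact_mod_cast hL
  have hm' : (0 : ℝ) < m n := Nat.cast_pos.2 hm
  have hε := hR.nonneg n
  have h8 : 8 * ε n ≤ 1 / L n := by
    rw [le_div_iff₀ (by linarith)]
    nlinarith [mul_nonneg hε (sub_nonneg.2 hL')]
  refine hω ?_
  change (groupEstimator G h0 E ref (ε n) (1 / L n) n (m n) k).1
    (fun w : Fin n => P w ω, fun v => Z n ω ((Pi n ω).symm v)) = X 0 ω k
  rw [ht.groupEstimator_eq href hCn' h0 hε h8 ?_ (by positivity) (le_of_eq ?_) hconn (Pi n ω) hk]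
  · exact hz (hCn' 0 h0) hk
  · rw [div_le_iff₀ hm'] at hLm
    have h1 : 8 * ε n * m n ≤ 1 / L n * m n := mul_le_mul_of_nonneg_right h8 hm'.le
    have h2 : 16 ≤ 1 / (L n : ℝ) * m n := by
      rw [one_div, ← div_eq_inv_mul, le_div_iff₀ (by linarith)]
      nlinarith
    linarith
  · field_simp

end ErrorProbability

/-! ### Choice of the rates -/

section Rates

lemma tendsto_natCast_rpow_atTop {q : ℝ} (hq : 0 < q) :
    Tendsto (fun n : ℕ => (n : ℝ) ^ q) atTop atTop :=
  (tendsto_rpow_atTop hq).comp tendsto_natCast_atTop_atTop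

lemma tendsto_natCast_rpow_zero {q : ℝ} (hq : q < 0) :
    Tendsto (fun n : ℕ => (n : ℝ) ^ q) atTop (𝓝 0) := by
  have := (tendsto_rpow_neg_atTop (neg_pos.2 hq)).comp
    (tendsto_natCast_atTop_atTop (R := ℝ))
  rw [neg_neg] at this
  exact this

lemma tendsto_natCast_rpow_mul_exp (p : ℝ) {q b : ℝ} (hq : 0 < q) (hb : 0 < b) :
    Tendsto (fun n : ℕ => (n : ℝ) ^ p * Real.exp (-(b * (n : ℝ) ^ q))) atTop (𝓝 0) := by
  refine ((tendsto_rpow_mul_exp_neg_mul_atTop_nhds_zero (p / q) b hb).comp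
    (tendsto_natCast_rpow_atTop hq)).congr fun n => ?_
  simp only [Function.comp]
  rw [← Real.rpow_mul (Nat.cast_nonneg n), mul_div_cancel₀ _ hq.ne', neg_mul]

/-- The lag used by the algorithm. -/
def lagRate (γ : ℝ) (n : ℕ) : ℕ := ⌊(n : ℝ) ^ (γ / 4)⌋₊ + 1

/-- The accuracy used by the algorithm, for groups of `s` users with `d` parameters each. -/
def accuracyRate (s d : ℕ) (γ : ℝ) (n : ℕ) : ℝ := (n : ℝ) ^ (-(1 / ((s : ℝ) * d) + γ))

lemma lagRate_le {γ : ℝ} (hγ : 0 < γ) {n : ℕ} (hn : 1 ≤ n) :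
    (lagRate γ n : ℝ) ≤ 2 * (n : ℝ) ^ (γ / 4) := by
  have h1 : (1 : ℝ) ≤ (n : ℝ) ^ (γ / 4) :=
    Real.one_le_rpow (by exact_mod_cast hn) (by linarith)
  have h2 := Nat.floor_le (zero_le_one.trans h1)
  unfold lagRate
  push_cast
  linarith

lemma tendsto_lagRate {γ : ℝ} (hγ : 0 < γ) : Tendsto (lagRate γ) atTop atTop :=
  (tendsto_add_atTop_nat 1).comp
    (tendsto_nat_floor_atTop.comp (tendsto_natCast_rpow_atTop (by linarith)))

theorem areRates {s d : ℕ} (hs : 0 < s) (hd : 0 < d) {c c' α β γ : ℝ} (hc : 0 < c)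
    (hγ : 0 < γ) (hγα : γ ≤ α / 4) (hγβ : γ < β) {m : ℕ → ℕ}
    (hm : ∀ n : ℕ, |(m n : ℝ) - c * (n : ℝ) ^ (2 / ((s : ℝ) * d) + α)| ≤ 1) {a : ℕ → ℝ}
    (ha : ∀ n : ℕ, a n = c' * (n : ℝ) ^ (-(1 / ((s : ℝ) * d) + β))) :
    AreRates s d m (lagRate γ) a (accuracyRate s d γ) := by
  have hs' : (0 : ℝ) < s := Nat.cast_pos.2 hs
  have hd' : (0 : ℝ) < d := Nat.cast_pos.2 hd
  set κ : ℝ := 1 / ((s : ℝ) * d) with hκ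
  have hκ0 : 0 < κ := by positivity
  have h2κ : 2 / ((s : ℝ) * d) = 2 * κ := by rw [hκ]; ring
  rw [h2κ] at hm
  have hq : 0 < 2 * κ + α := by linarith
  have hlow : ∀ᶠ n : ℕ in atTop, c / 2 * (n : ℝ) ^ (2 * κ + α) ≤ m n := by
    filter_upwards [(tendsto_natCast_rpow_atTop hq).eventually_ge_atTop (2 / c)] with n hn
    rw [div_le_iff₀ hc] at hn
    linarith [(abs_le.1 (hm n)).1]
  have hε : ∀ n, accuracyRate s d γ n = (n : ℝ) ^ (-(κ + γ)) := fun n => rfl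
  have hε0 : ∀ n, 0 ≤ accuracyRate s d γ n := fun n => Real.rpow_nonneg (Nat.cast_nonneg n) _
  have hL2 : ∀ n : ℕ, 1 ≤ n → (lagRate γ n : ℝ) ^ 2 ≤ 4 * (n : ℝ) ^ (γ / 2) := fun n hn => by
    have h1 := pow_le_pow_left₀ (Nat.cast_nonneg _) (lagRate_le hγ hn) 2
    rw [mul_pow, ← Real.rpow_natCast ((n : ℝ) ^ (γ / 4)), ← Real.rpow_mul (Nat.cast_nonneg n)] at h1
    refine h1.trans (le_of_eq ?_)
    norm_num
    ring_nf
  refine ⟨hε0, tendsto_lagRate hγ, ?_, ?_, ?_, ?_, ?_, ?_, ?_⟩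
  · refine (tendsto_natCast_atTop_iff (R := ℝ)).1 ?_
    exact tendsto_atTop_mono' _ hlow
      ((tendsto_natCast_rpow_atTop hq).const_mul_atTop (by positivity))
  · have h1 := (tendsto_natCast_rpow_zero (q := γ / 2 + -(κ + γ)) (by linarith)).const_mul 4
    rw [mul_zero] at h1
    refine tendsto_of_tendsto_of_tendsto_of_le_of_le' tendsto_const_nhds h1
      (Eventually.of_forall fun n => mul_nonneg (sq_nonneg _) (hε0 n)) ?_
    filter_upwards [eventually_ge_atTop 1] with n hn
    rw [Real.rpow_add (by exact_mod_cast hn), ← mul_assoc]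
    exact mul_le_mul_of_nonneg_right (hL2 n hn) (hε0 n)
  · have h1 := (tendsto_natCast_rpow_zero (q := γ / 2 - (2 * κ + α)) (by linarith)).const_mul
      (4 / (c / 2))
    rw [mul_zero] at h1
    refine tendsto_of_tendsto_of_tendsto_of_le_of_le' tendsto_const_nhds h1
      (Eventually.of_forall fun n => by positivity) ?_
    filter_upwards [eventually_ge_atTop 1, hlow] with n hn hn2
    have hn0 : (0 : ℝ) < n := by exact_mod_cast hn
    have hpos : 0 < c / 2 * (n : ℝ) ^ (2 * κ + α) :=
      mul_pos (by linarith) (Real.rpow_pos_of_pos hn0 _)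
    refine (div_le_div₀ (by positivity) (hL2 n hn) hpos hn2).trans (le_of_eq ?_)
    rw [Real.rpow_sub hn0, mul_div_mul_comm]
  · have h1 := (tendsto_natCast_rpow_mul_exp (1 + γ / 4) (q := α - 2 * γ) (b := c / 8)
      (by linarith) (by linarith)).const_mul 2
    rw [mul_zero] at h1
    refine tendsto_of_tendsto_of_tendsto_of_le_of_le' tendsto_const_nhds h1
      (Eventually.of_forall fun n => by positivity) ?_
    filter_upwards [eventually_ge_atTop 1, hlow] with n hn hn2
    have hn0 : (0 : ℝ) < n := by exact_mod_cast hn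
    rw [← mul_assoc]
    refine mul_le_mul ?_ (Real.exp_le_exp.2 (neg_le_neg ?_)) (Real.exp_pos _).le (by positivity)
    · rw [Real.rpow_add hn0, Real.rpow_one]
      push_cast
      nlinarith [mul_le_mul_of_nonneg_left (lagRate_le hγ hn) hn0.le]
    · have e : accuracyRate s d γ n ^ 2 * (c / 2 * (n : ℝ) ^ (2 * κ + α))
          = c / 2 * (n : ℝ) ^ (α - 2 * γ) := by
        rw [hε, ← Real.rpow_natCast, ← Real.rpow_mul hn0.le, mul_left_comm, ← Real.rpow_add hn0]
        congr 2
        push_cast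
        ring
      have := mul_le_mul_of_nonneg_left hn2 (sq_nonneg (accuracyRate s d γ n))
      rw [e] at this
      linarith
  · have h1 := tendsto_natCast_rpow_mul_exp 1 (q := κ + α - γ) (b := c / 4)
      (by linarith) (by linarith)
    refine tendsto_of_tendsto_of_tendsto_of_le_of_le' tendsto_const_nhds h1
      (Eventually.of_forall fun n => by positivity) ?_
    filter_upwards [eventually_ge_atTop 1, hlow] with n hn hn2
    have hn0 : (0 : ℝ) < n := by exact_mod_cast hn
    rw [Real.rpow_one]
    refine mul_le_mul_of_nonneg_left (Real.exp_le_exp.2 (neg_le_neg ?_)) hn0.le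
    have e : accuracyRate s d γ n * (c / 2 * (n : ℝ) ^ (2 * κ + α))
        = c / 2 * (n : ℝ) ^ (κ + α - γ) := by
      rw [hε, mul_left_comm, ← Real.rpow_add hn0]
      congr 2
      ring
    have := mul_le_mul_of_nonneg_left hn2 (hε0 n)
    rw [e] at this
    linarith
  · filter_upwards [eventually_ge_atTop 1,
      (tendsto_natCast_rpow_atTop (sub_pos.2 hγβ)).eventually_ge_atTop (4 * c')] with n hn hn2
    have hn0 : (0 : ℝ) < n := by exact_mod_cast hn
    rw [ha, hε, ← mul_assoc, show -(κ + γ) = (β - γ) + -(κ + β) by ring, Real.rpow_add hn0]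
    exact mul_le_mul_of_nonneg_right hn2 (Real.rpow_nonneg hn0.le _)
  · have h1 := (tendsto_natCast_rpow_zero (q := -(3 / 4 * γ * d * s))
      (by have : 0 < 3 / 4 * γ * d * s := by positivity
          linarith)).const_mul ((2 ^ d) ^ s)
    rw [mul_zero] at h1
    refine tendsto_of_tendsto_of_tendsto_of_le_of_le' tendsto_const_nhds h1
      (Eventually.of_forall fun n => mul_nonneg (Nat.cast_nonneg n) (pow_nonneg (pow_nonneg
        (mul_nonneg (Nat.cast_nonneg _) (hε0 n)) _) _)) ?_
    filter_upwards [eventually_ge_atTop 1] with n hn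
    have hn0 : (0 : ℝ) < n := by exact_mod_cast hn
    have h2 : (lagRate γ n : ℝ) * accuracyRate s d γ n ≤ 2 * (n : ℝ) ^ (-(κ + 3 / 4 * γ)) := by
      rw [hε, show -(κ + 3 / 4 * γ) = γ / 4 + -(κ + γ) by ring, Real.rpow_add hn0, ← mul_assoc]
      exact mul_le_mul_of_nonneg_right (lagRate_le hγ hn) (Real.rpow_nonneg hn0.le _)
    have h3 := pow_le_pow_left₀ (pow_nonneg (mul_nonneg (Nat.cast_nonneg _) (hε0 n)) d)
      (pow_le_pow_left₀ (mul_nonneg (Nat.cast_nonneg _) (hε0 n)) h2 d) s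
    refine (mul_le_mul_of_nonneg_left h3 hn0.le).trans (le_of_eq ?_)
    have hκds : κ * d * s = 1 := by rw [hκ]; field_simp
    rw [mul_pow, mul_pow, ← Real.rpow_natCast ((n : ℝ) ^ _) d, ← Real.rpow_mul hn0.le,
      ← Real.rpow_natCast ((n : ℝ) ^ _) s, ← Real.rpow_mul hn0.le, mul_left_comm]
    congr 1
    nth_rewrite 1 [← Real.rpow_one (n : ℝ)]
    rw [← Real.rpow_add hn0]
    congr 1
    linear_combination -hκds

lemma reflTransGen_subtype {V : Type*} {G : SimpleGraph V} {v : V} {C : Finset V}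
    (hC : ∀ u, u ∈ C ↔ u ∈ (G.connectedComponentMk v).supp) (h0 : v ∈ C) (i : C) :
    Relation.ReflTransGen (fun i j : C => G.Adj i j) ⟨v, h0⟩ i := by
  obtain ⟨i, hi⟩ := i
  have hr : G.Reachable v i :=
    (SimpleGraph.ConnectedComponent.exact ((SimpleGraph.ConnectedComponent.mem_supp_iff _ _).1
      ((hC i).1 hi))).symm
  have h := (SimpleGraph.reachable_iff_reflTransGen v i).1 hr
  induction h with
  | refl => exact Relation.ReflTransGen.refl
  | @tail b c hb hbc ih =>
    have hb' : G.Reachable v b := (SimpleGraph.reachable_iff_reflTransGen v b).2 hb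
    have hbC : b ∈ C := (hC b).2 ((SimpleGraph.ConnectedComponent.mem_supp_iff _ _).2
      (SimpleGraph.ConnectedComponent.sound hb'.symm))
    exact (ih hbC hb').tail hbc

end Rates

end CorrelatedPrivacy

end

/-- Users and times are numbered `0, 1, 2, …`; the claim is about user `0`.  The adversary's
algorithm `alg` depends only on the transition graph, the association graph, the number of data
points and the constants, not on the density `f` or on the joint law of the data.  The hypothesis
`hm` covers every rounding of `c n ^ (2 / (s (|E| - r)) + α)` to an integer. -/
theorem mainTheorem8 {r : ℕ} [NeZero r] (hr : 2 ≤ r)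
    (E : Finset (Fin r × Fin r)) (hirr : CorrelatedPrivacy.IsIrreducible E)
    (haper : CorrelatedPrivacy.IsAperiodic E)
    (ref : Fin r → Fin r) (href : ∀ i, (i, ref i) ∈ E)
    (G : SimpleGraph ℕ) (s : ℕ) (hs : 0 < s)
    (hGs : (G.connectedComponentMk 0).supp.ncard = s)
    (c c' α β : ℝ) (hc : 0 < c) (hc' : 0 < c') (hα : 0 < α) (hβ : α / 4 < β)
    (m : ℕ → ℕ)
    (hm : ∀ n : ℕ, |(m n : ℝ) - c * (n : ℝ) ^ (2 / ((s : ℝ) * ((E.card : ℝ) - r)) + α)| ≤ 1)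
    (a : ℕ → ℝ)
    (ha : ∀ n : ℕ, a n = c' * (n : ℝ) ^ (-(1 / ((s : ℝ) * ((E.card : ℝ) - r)) + β))) :
    ∃ alg : ∀ n : ℕ, ℕ → CorrelatedPrivacy.Estimator E ref n (m n),
      ∀ {Ω : Type*} [MeasurableSpace Ω] (μ : Measure Ω) [IsProbabilityMeasure μ]
        (f : CorrelatedPrivacy.Param E ref → ℝ) (S : Set (CorrelatedPrivacy.Param E ref))
        (δ₁ δ₂ : ℝ)
        (P : ℕ → Ω → CorrelatedPrivacy.Param E ref) (X : ℕ → Ω → ℕ → Fin r)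
        (R : ∀ n : ℕ, Fin n → Ω → ℝ) (Z : ∀ n : ℕ, Ω → Fin n → Fin (m n) → Fin r)
        (Pi : ∀ n : ℕ, Ω → Equiv.Perm (Fin n)),
        Measurable f → S ⊆ CorrelatedPrivacy.admissible E ref → 0 < δ₁ → 0 < δ₂ →
        (∀ x ∈ S, δ₁ ≤ f x ∧ f x ≤ δ₂) → (∀ x, x ∉ S → f x = 0) →
        CorrelatedPrivacy.IsMarkovModel μ f P X →
        CorrelatedPrivacy.IsAssociationGraph G μ P X →
        (∀ n : ℕ, 1 ≤ n → a n ≤ 1 →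
          CorrelatedPrivacy.IsObfuscation μ P X (a n) (R n) (Z n) ∧
          CorrelatedPrivacy.IsRandomPermutation μ P X (R n) (Z n) (Pi n)) →
        CorrelatedPrivacy.NoPrivacy μ P X
            (fun n => CorrelatedPrivacy.anonymize (Pi n) (Z n)) 0 ∧
          ∀ k : ℕ, Tendsto (fun n => CorrelatedPrivacy.errorProb μ P X
            (CorrelatedPrivacy.anonymize (Pi n) (Z n)) 0 k (alg n k)) atTop (𝓝 0) := by
  have hd1 := CorrelatedPrivacy.card_freeEdge href
  have hdpos : 0 < Fintype.card (CorrelatedPrivacy.FreeEdge E ref) :=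
    Fintype.card_pos_iff.2 (CorrelatedPrivacy.nonempty_freeEdge hr hirr haper)
  obtain ⟨d, hd⟩ : ∃ d, Fintype.card (CorrelatedPrivacy.FreeEdge E ref) = d := ⟨_, rfl⟩
  rw [hd] at hd1 hdpos
  have hdE : (E.card : ℝ) - r = d := by
    rw [← hd1]
    push_cast
    ring
  rw [hdE] at hm ha
  have hfin : (G.connectedComponentMk 0).supp.Finite :=
    Set.finite_of_ncard_pos (hGs.symm ▸ hs)
  set C : Finset ℕ := hfin.toFinset with hCdef
  have hC : ∀ u, u ∈ C ↔ u ∈ (G.connectedComponentMk 0).supp := fun u => hfin.mem_toFinset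
  have hCs : C.card = s := by rw [← hGs, Set.ncard_eq_toFinset_card _ hfin]
  have h0 : 0 ∈ C := (hC 0).2 rfl
  set γ := min (α / 2) β / 2 with hγ
  have hβ0 : 0 < β := by linarith
  have hγ0 : 0 < γ := half_pos (lt_min (by linarith) hβ0)
  have hγα : γ ≤ α / 4 := by linarith [min_le_left (α / 2) β]
  have hγβ : γ < β := by linarith [min_le_right (α / 2) β]
  have hR := CorrelatedPrivacy.areRates hs hdpos hc hγ0 hγα hγβ hm ha
  refine ⟨fun n k => CorrelatedPrivacy.groupEstimator G h0 E ref
    (CorrelatedPrivacy.accuracyRate s d γ n) (1 / CorrelatedPrivacy.lagRate γ n) n (m n) k, ?_⟩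
  intro Ω _ μ _ f S δ₁ δ₂ P X R Z Pi hf hS _ hδ₂ hfS hfS' hM hG hO
  have hfδ : ∀ x, f x ≤ δ₂ := fun x => by
    by_cases hx : x ∈ S
    · exact (hfS x hx).2
    · exact (hfS' x hx).trans_le hδ₂.le
  have hO' : ∀ᶠ n in Filter.atTop, CorrelatedPrivacy.IsObfuscation μ P X (a n) (R n) (Z n) := by
    filter_upwards [hR.noise, hR.tendsto_accuracy.eventually_le_const one_pos,
      Filter.eventually_ge_atTop 1] with n h1 h2 h3
    exact (hO n h3 (by linarith)).1
  have key : ∀ k : ℕ, Filter.Tendsto (fun n => CorrelatedPrivacy.errorProb μ P X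
      (CorrelatedPrivacy.anonymize (Pi n) (Z n)) 0 k (CorrelatedPrivacy.groupEstimator G h0 E ref
        (CorrelatedPrivacy.accuracyRate s d γ n) (1 / CorrelatedPrivacy.lagRate γ n) n (m n) k))
      Filter.atTop (nhds 0) := fun k =>
    CorrelatedPrivacy.tendsto_errorProb_groupEstimator hM hG hr hirr haper href
      (hM.ae_admissible hf hS hfS') hO' hC hδ₂.le hfδ hd hdpos.ne' hCs hR h0
      (CorrelatedPrivacy.reflTransGen_subtype hC h0) Pi k
  exact ⟨fun k => tendsto_of_tendsto_of_tendsto_of_le_of_le tendsto_const_nhds (key k)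
    (fun _ => zero_le) fun n => iInf_le _ _, key⟩
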